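/- Let $n\in\mathbb N$, let $B=\operatorname{diag}(b_1,\dots,b_n)$ with $b_j\in\mathbb C\setminus\{0\}$, let $Q\in L^1([0,1];\mathbb C^{n\times n})$, and let $C,D\in\mathbb C^{n\times n}$ satisfy $\operatorname{rank}\begin{pmatrix} C & D\end{pmatrix}=n$. Let $L_{C,D}(Q)$ be the operator in $L^2([0,1];\mathbb C^n)$ given by $y\mapsto -iB^{-1}y'+Q(x)y$ on the domain of all absolutely continuous $y:[0,1]\to\mathbb C^n$ with $-iB^{-1}y'+Qy\in L^2([0,1];\mathbb C^n)$ and $Cy(0)+Dy(1)=0$. For $\lambda\in\mathbb C$ let $\Phi(\cdot,\lambda)$ be the matrix solution of $-iB^{-1}\Phi'+Q(x)\Phi=\lambda\Phi$ on $[0,1]$ with $\Phi(0,\lambda)=I_n$, and let $\Delta(\lambda):=\det(C+D\,\Phi(1,\lambda))$ be the characteristic determinant. Call $z\in\mathbb C$ feasible if $\operatorname{Re}(ib_jz)\neq 0$ for all $j$ and $\operatorname{Re}(ib_jz)\ne\operatorname{Re}(ib_kz)$ whenever $b_j\ne b_k$. Assume that there exist real numbers $c,R>0$, an integer $s\ge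 0$ and three feasible numbers $z_1,z_2,z_3$ such that (i) the origin is an interior point of the triangle with vertices $z_1,z_2,z_3$; (ii) for $k\in\{1,2,3\}$, with $\tau_k:=\sum_{j:\ \operatorname{Re}(ib_jz_k)>0} b_j$, $$|\Delta(\lambda)|\ \ge\ \frac{c\,e^{\operatorname{Re}(i\tau_k\lambda)}}{|\lambda|^s}\qquad\text{for all }\lambda\in\mathbb C\text{ with }|\lambda|>R,\ \arg\lambda=\arg z_k .$$ Then the system of root functions (eigenfunctions and associated functions) of $L_{C,D}(Q)$ is complete and minimal in $L^2([0,1];\mathbb C^n)$. That is, if a basis is chosen in each root subspace $\bigcup_{m\ge 1}\ker(L_{C,D}(Q)-\lambda)^m$, $\lambda\in\mathbb C$, then the family formed by all these basis functions has dense linear span in $L^2([0,1];\mathbb C^n)$, and no member of it lies in the closed linear span of the other members. -/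

import Mathlib

open MeasureTheory Set Complex
open scoped Matrix

namespace FirstOrderBVP

/-- Lebesgue measure on `[0,1]`. -/
noncomputable abbrev unitVol : Measure ℝ := volume.restrict (Icc (0 : ℝ) 1)

/-- The Hilbert space `L²([0,1]; ℂⁿ)`. -/
abbrev L2 (n : ℕ) : Type := Lp (EuclideanSpace ℂ (Fin n)) 2 unitVol

/-- The differential expression `-i B⁻¹ y' + Q(x) y` with `B = diag(b₁, …, bₙ)`. -/
noncomputable def diffExpr {n : ℕ} (b : Fin n → ℂ) (Q : ℝ → Matrix (Fin n) (Fin n) ℂ)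
    (y : ℝ → Fin n → ℂ) (x : ℝ) : Fin n → ℂ :=
  (-I) • ((Matrix.diagonal b)⁻¹ *ᵥ deriv y x) + Q x *ᵥ y x

/-- An absolutely continuous function on `[0,1]` is differentiable almost everywhere. -/
theorem ae_differentiableAt_of_ac {n : ℕ} {y : ℝ → Fin n → ℂ}
    (hy : AbsolutelyContinuousOnInterval y 0 1) :
    ∀ᵐ x ∂unitVol, DifferentiableAt ℝ y x := by
  have h := hy.boundedVariationOn.locallyBoundedVariationOn.ae_differentiableWithinAt_of_mem
  rw [uIcc_of_le zero_le_one] at h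
  rw [unitVol, ← Measure.restrict_congr_set Ioo_ae_eq_Icc, ae_restrict_iff' measurableSet_Ioo]
  filter_upwards [h] with x hx hxI
  exact (hx (Ioo_subset_Icc_self hxI)).differentiableAt (Icc_mem_nhds hxI.1 hxI.2)

theorem ac_const_smul {n : ℕ} {y : ℝ → Fin n → ℂ} (c : ℂ)
    (hy : AbsolutelyContinuousOnInterval y 0 1) :
    AbsolutelyContinuousOnInterval (fun x => c • y x) 0 1 := by
  unfold AbsolutelyContinuousOnInterval at *
  refine squeeze_zero (fun t => Finset.sum_nonneg fun i _ => dist_nonneg) (fun t => ?_)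
    (by simpa using hy.const_mul ‖c‖)
  rw [Finset.mul_sum]
  exact Finset.sum_le_sum fun i _ => by rw [dist_smul₀]

/-- The graph of `L_{C,D}(Q)`: the pairs `(f, g)` in `L²` such that `f` is (the class of) an
absolutely continuous `y` on `[0,1]` with `C y(0) + D y(1) = 0` and `g = -i B⁻¹ y' + Q y`. -/
noncomputable def bvpGraph {n : ℕ} (b : Fin n → ℂ) (Q : ℝ → Matrix (Fin n) (Fin n) ℂ)
    (C D : Matrix (Fin n) (Fin n) ℂ) : Submodule ℂ (L2 n × L2 n) where
  carrier := {p | ∃ y : ℝ → Fin n → ℂ, AbsolutelyContinuousOnInterval y 0 1 ∧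
    (∀ᵐ x ∂unitVol, p.1 x = WithLp.toLp 2 (y x)) ∧
    (∀ᵐ x ∂unitVol, p.2 x = WithLp.toLp 2 (diffExpr b Q y x)) ∧
    C *ᵥ y 0 + D *ᵥ y 1 = 0}
  add_mem' := by
    rintro ⟨f, g⟩ ⟨f', g'⟩ ⟨y, hy, hf, hg, hb⟩ ⟨y', hy', hf', hg', hb'⟩
    refine ⟨y + y', hy.add hy', ?_, ?_, ?_⟩
    · filter_upwards [hf, hf', Lp.coeFn_add f f'] with x h1 h2 h3
      simp only [Prod.fst_add, Pi.add_apply] at *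
      rw [h3, h1, h2, WithLp.toLp_add]
    · filter_upwards [hg, hg', Lp.coeFn_add g g', ae_differentiableAt_of_ac hy,
        ae_differentiableAt_of_ac hy'] with x h1 h2 h3 h4 h5
      simp only [Prod.snd_add, Pi.add_apply] at *
      rw [h3, h1, h2, ← WithLp.toLp_add]
      congr 1
      simp only [diffExpr, deriv_add h4 h5, Pi.add_apply, Matrix.mulVec_add, smul_add]
      abel
    · simp only [Pi.add_apply, Matrix.mulVec_add]
      rw [add_add_add_comm, hb, hb', add_zero]
  zero_mem' := by
    refine ⟨fun _ => 0, ?_, ?_, ?_, by simp⟩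
    · simpa [AbsolutelyContinuousOnInterval] using tendsto_const_nhds
    · filter_upwards [Lp.coeFn_zero (EuclideanSpace ℂ (Fin n)) 2 unitVol] with x h
      simpa using h
    · filter_upwards [Lp.coeFn_zero (EuclideanSpace ℂ (Fin n)) 2 unitVol] with x h
      simpa [diffExpr] using h
  smul_mem' := by
    rintro c ⟨f, g⟩ ⟨y, hy, hf, hg, hb⟩
    refine ⟨fun x => c • y x, ac_const_smul c hy, ?_, ?_, ?_⟩
    · filter_upwards [hf, Lp.coeFn_smul c f] with x h1 h2
      simp only [Prod.smul_fst, Pi.smul_apply] at *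
      rw [h2, h1, WithLp.toLp_smul]
    · filter_upwards [hg, Lp.coeFn_smul c g, ae_differentiableAt_of_ac hy] with x h1 h2 h3
      simp only [Prod.smul_snd, Pi.smul_apply] at *
      rw [h2, h1, ← WithLp.toLp_smul]
      congr 1
      simp only [diffExpr, deriv_fun_const_smul c h3, Matrix.mulVec_smul, smul_add]
      rw [smul_comm]
    · simp only [Matrix.mulVec_smul]
      rw [← smul_add, hb, smul_zero]

theorem bvpGraph_single_valued {n : ℕ} (b : Fin n → ℂ) (Q : ℝ → Matrix (Fin n) (Fin n) ℂ)
    (C D : Matrix (Fin n) (Fin n) ℂ) :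
    ∀ p ∈ bvpGraph b Q C D, p.1 = 0 → p.2 = 0 := by
  rintro ⟨f, g⟩ ⟨y, hy, hf, hg, -⟩ (rfl : f = 0)
  have hcont : ContinuousOn y (Icc 0 1) := by
    simpa [uIcc_of_le zero_le_one] using hy.continuousOn
  have h0 : y =ᵐ[unitVol] fun _ => 0 := by
    filter_upwards [hf, Lp.coeFn_zero (EuclideanSpace ℂ (Fin n)) 2 unitVol] with x h1 h2
    have h3 : WithLp.toLp 2 (y x) = (0 : EuclideanSpace ℂ (Fin n)) := by
      rw [← h1]; simpa using h2
    simpa using congrArg WithLp.ofLp h3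
  have h1 : EqOn y (fun _ => 0) (Icc 0 1) :=
    Measure.eqOn_Icc_of_ae_eq volume zero_ne_one h0 hcont continuousOn_const
  refine Lp.ext ?_
  have hI : ∀ᵐ x ∂unitVol, x ∈ Ioo (0 : ℝ) 1 := by
    rw [unitVol, ← Measure.restrict_congr_set Ioo_ae_eq_Icc]
    exact ae_restrict_mem measurableSet_Ioo
  filter_upwards [hg, hI, Lp.coeFn_zero (EuclideanSpace ℂ (Fin n)) 2 unitVol] with x h2 h3 h4
  have h5 : y =ᶠ[nhds x] fun _ => 0 := by
    filter_upwards [Icc_mem_nhds h3.1 h3.2] with t ht using h1 ht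
  rw [h4]
  rw [h2]
  simp [diffExpr, h5.deriv_eq, h5.eq_of_nhds]

/-- The operator `L_{C,D}(Q)` in `L²([0,1]; ℂⁿ)`. -/
noncomputable def bvpOperator {n : ℕ} (b : Fin n → ℂ) (Q : ℝ → Matrix (Fin n) (Fin n) ℂ)
    (C D : Matrix (Fin n) (Fin n) ℂ) : L2 n →ₗ.[ℂ] L2 n :=
  (bvpGraph b Q C D).toLinearPMap

theorem bvpOperator_graph {n : ℕ} (b : Fin n → ℂ) (Q : ℝ → Matrix (Fin n) (Fin n) ℂ)
    (C D : Matrix (Fin n) (Fin n) ℂ) :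
    (bvpOperator b Q C D).graph = bvpGraph b Q C D :=
  Submodule.toLinearPMap_graph_eq _ (bvpGraph_single_valued b Q C D)

section Abstract

variable {E : Type*} [AddCommGroup E] [Module ℂ E]

/-- `ker (T - μ)ᵏ` for an unbounded operator `T`, with its natural domain: `x` lies in
`ker (T - μ)ᵏ⁺¹` iff `x ∈ dom T` and `T x - μ x ∈ ker (T - μ)ᵏ`. -/
def kerPow (T : E →ₗ.[ℂ] E) (μ : ℂ) : ℕ → Submodule ℂ E
  | 0 => ⊥
  | k + 1 => ((kerPow T μ k).comap (T.toFun - μ • T.domain.subtype)).map T.domain.subtype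

/-- The root subspace of `T` at `μ`: the eigenvectors and associated vectors at `μ`, and `0`.
It is `{0}` if `μ` is not an eigenvalue. -/
def rootSubspace (T : E →ₗ.[ℂ] E) (μ : ℂ) : Submodule ℂ E :=
  ⨆ k, kerPow T μ k

/-- The linear span of the family is dense. -/
def IsCompleteFamily [TopologicalSpace E] {ι : Type*} (e : ι → E) : Prop :=
  Dense (Submodule.span ℂ (range e) : Set E)

/-- No member of the family lies in the closed linear span of the other members. -/
def IsMinimalFamily [TopologicalSpace E] {ι : Type*} (e : ι → E) : Prop :=
  ∀ i, e i ∉ closure (Submodule.span ℂ (e '' {j | j ≠ i}) : Set E)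

end Abstract

/-- `Φ` is the fundamental matrix at `μ`: its columns are absolutely continuous solutions of
`-i B⁻¹ y' + Q y = μ y` on `[0,1]`, and `Φ(0) = I`. -/
def IsFundamentalMatrix {n : ℕ} (b : Fin n → ℂ) (Q : ℝ → Matrix (Fin n) (Fin n) ℂ) (μ : ℂ)
    (Φ : ℝ → Matrix (Fin n) (Fin n) ℂ) : Prop :=
  Φ 0 = 1 ∧ ∀ k, AbsolutelyContinuousOnInterval (fun x j => Φ x j k) 0 1 ∧
    ∀ᵐ x ∂unitVol, diffExpr b Q (fun t j => Φ t j k) x = μ • (fun j => Φ x j k)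

/-- The fundamental matrix `Φ(·, μ)`; for nonsingular `B` and integrable `Q` it exists and is
unique on `[0,1]`. -/
noncomputable def fundamentalMatrix {n : ℕ} (b : Fin n → ℂ) (Q : ℝ → Matrix (Fin n) (Fin n) ℂ)
    (μ : ℂ) : ℝ → Matrix (Fin n) (Fin n) ℂ :=
  Classical.epsilon (IsFundamentalMatrix b Q μ)

/-- The characteristic determinant `Δ(μ) = det (C + D Φ(1, μ))`. -/
noncomputable def charDet {n : ℕ} (b : Fin n → ℂ) (Q : ℝ → Matrix (Fin n) (Fin n) ℂ)
    (C D : Matrix (Fin n) (Fin n) ℂ) (μ : ℂ) : ℂ :=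
  (C + D * fundamentalMatrix b Q μ 1).det

/-- `z` lies on none of the lines `Re (i b_j z) = 0` and, for `b_j ≠ b_k`,
`Re (i b_j z) = Re (i b_k z)`. -/
def Feasible {n : ℕ} (b : Fin n → ℂ) (z : ℂ) : Prop :=
  (∀ j, (I * b j * z).re ≠ 0) ∧ ∀ j k, b j ≠ b k → (I * b j * z).re ≠ (I * b k * z).re

/-- The sum of those `b_j` with `Re (i b_j z) > 0`. -/
noncomputable def tau {n : ℕ} (b : Fin n → ℂ) (z : ℂ) : ℂ :=
  ∑ j with 0 < (I * b j * z).re, b j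

end FirstOrderBVP

/-! Variation of parameters and Cramer's rule write the resolvent as `N(μ)/Δ(μ)`, where `Δ` is the
characteristic determinant and both `Δ` and the operator function `N` are entire
(`isCharacteristicPair_bvp`). Everything about root subspaces is then read off from this pair
(`IsCharacteristicPair`).

Completeness. Let `φ` be a functional that vanishes on every root subspace. The Taylor coefficients
of `N(·)g` at a zero of `Δ` of order `m` form, up to order `m - 1`, a chain of root vectors, so `F_g
= φ(N(·)g)/Δ` is entire. As a quotient of functions of exponential type it is of exponential type
(Poisson–Jensen, `exists_exp_bound_of_mul`). On the three rays it is `O(|μ|^s)`, since the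
exponential in the upper bound for `N` is the one in the assumed lower bound for `Δ`. The resolvent
identity `F_g = (μ - ν) F_{R g} + φ(R g)`, with `R` the resolvent at `ν`, trades a power of `μ` for
a factor `R`; hence `F_{R^s g}` is bounded on the rays. The rays cut the plane into sectors of
opening less than `π`, so Phragmén–Lindelöf (`norm_le_of_three_rays`) and Liouville make it
constant. This forces `φ(R^{s+2} g) = 0` for all `g`, and since the domain is dense, so is the range
of `R^{s+2}`; thus `φ = 0` (`functional_eq_zero`).

The upper bound for `N` needs no asymptotics of solutions, which suits a merely integrable `Q`. By a
Schur complement, the components of `N(μ)g` before the embedding into `L²` are determinants whose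
rows combine rows of a bordered fundamental matrix at the times `0`, `x`, `1`. Such minors solve a
linear system whose diagonal consists of sums of distinct exponents, so Grönwall bounds them by
`exp` of the sum of the positive parts of `Re (i b_j μ)` (`exists_norm_det_rows_le`,
`exists_norm_det_boundaryMatrix_le`).

Minimality. The vectors whose resolvent is regular at `μ` form a closed subspace. It contains all
root subspaces at other points and meets the one at `μ`, which is finite-dimensional, only in `0`
(`isMinimalFamily`). -/

namespace FirstOrderBVP

/-! ### Calculus of absolutely continuous functions -/

section AbsoluteContinuity

open Filter Topology AbsolutelyContinuousOnInterval

/-- Absolute continuity only concerns sums of increments, so it passes to any function whose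
increments are dominated. The other closure properties are obtained from this comparison. -/
theorem ac_of_dist_le {X Y : Type*} [PseudoMetricSpace X] [PseudoMetricSpace Y]
    {f : ℝ → X} {g : ℝ → Y} {a b L : ℝ}
    (hg : AbsolutelyContinuousOnInterval g a b)
    (h : ∀ x ∈ uIcc a b, ∀ y ∈ uIcc a b, dist (f x) (f y) ≤ L * dist (g x) (g y)) :
    AbsolutelyContinuousOnInterval f a b := by
  unfold AbsolutelyContinuousOnInterval at *
  refine squeeze_zero' (Eventually.of_forall fun t => Finset.sum_nonneg fun i _ => dist_nonneg)
    ?_ (by simpa using hg.const_mul L)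
  -- The bound on increments is available only between points of `uIcc a b`; the principal part of
  -- the filter supplies that the endpoints lie there.
  filter_upwards [mem_inf_of_right (mem_principal_self _)] with E hE
  rw [Finset.mul_sum]
  exact Finset.sum_le_sum fun i hi => h _ (hE.1 i hi).1 _ (hE.1 i hi).2

theorem ac_const {X : Type*} [PseudoMetricSpace X] (c : X) (a b : ℝ) :
    AbsolutelyContinuousOnInterval (fun _ => c) a b := by
  simpa [AbsolutelyContinuousOnInterval] using tendsto_const_nhds

theorem ac_congr {X : Type*} [PseudoMetricSpace X] {f g : ℝ → X} {a b : ℝ}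
    (hf : AbsolutelyContinuousOnInterval f a b) (h : EqOn f g (uIcc a b)) :
    AbsolutelyContinuousOnInterval g a b :=
  ac_of_dist_le (L := 1) hf fun x hx y hy => by rw [h hx, h hy, one_mul]

theorem ac_comp_lipschitz {X Y : Type*} [PseudoMetricSpace X] [PseudoMetricSpace Y]
    {f : ℝ → X} {φ : X → Y} {a b : ℝ} {K : NNReal}
    (hf : AbsolutelyContinuousOnInterval f a b) (hφ : LipschitzOnWith K φ (f '' uIcc a b)) :
    AbsolutelyContinuousOnInterval (fun x => φ (f x)) a b :=
  ac_of_dist_le hf fun _ hx _ hy => hφ.dist_le_mul _ (mem_image_of_mem f hx) _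
    (mem_image_of_mem f hy)

theorem ac_pi_apply {J : Type*} [Fintype J] {X : Type*} [PseudoMetricSpace X]
    {f : ℝ → J → X} {a b : ℝ} (hf : AbsolutelyContinuousOnInterval f a b) (j : J) :
    AbsolutelyContinuousOnInterval (fun x => f x j) a b :=
  ac_of_dist_le (L := 1) hf fun x _ y _ => by
    rw [one_mul]; exact dist_le_pi_dist (f x) (f y) j

theorem ac_finset_sum {ι F : Type*} [SeminormedAddCommGroup F] (s : Finset ι) {f : ι → ℝ → F}
    {a b : ℝ} (hf : ∀ i ∈ s, AbsolutelyContinuousOnInterval (f i) a b) :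
    AbsolutelyContinuousOnInterval (fun x => ∑ i ∈ s, f i x) a b := by
  classical
  induction s using Finset.induction_on with
  | empty => simpa using ac_const (0 : F) a b
  | insert i s hi ih =>
    simp only [Finset.sum_insert hi]
    exact (hf i (Finset.mem_insert_self i s)).fun_add
      (ih fun j hj => hf j (Finset.mem_insert_of_mem hj))

theorem ac_finset_prod {ι : Type*} (s : Finset ι) {f : ι → ℝ → ℂ}
    {a b : ℝ} (hf : ∀ i ∈ s, AbsolutelyContinuousOnInterval (f i) a b) :
    AbsolutelyContinuousOnInterval (fun x => ∏ i ∈ s, f i x) a b := by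
  classical
  induction s using Finset.induction_on with
  | empty => simpa using ac_const (1 : ℂ) a b
  | insert i s hi ih =>
    simp only [Finset.prod_insert hi]
    exact (hf i (Finset.mem_insert_self i s)).fun_smul
      (ih fun j hj => hf j (Finset.mem_insert_of_mem hj))

/-- Increments of the primitive of `h` are dominated by those of the primitive of `‖h‖`, which
reduces the vector-valued case to the real one. -/
theorem ac_integral {F : Type*} [NormedAddCommGroup F] [NormedSpace ℝ F]
    {h : ℝ → F} {a b : ℝ} (hh : IntervalIntegrable h volume a b) :
    AbsolutelyContinuousOnInterval (fun x => ∫ t in a..x, h t) a b := by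
  refine ac_of_dist_le (L := 1)
    (hh.norm.absolutelyContinuousOnInterval_intervalIntegral left_mem_uIcc) fun x hx y hy => ?_
  have h1 : ∀ {u}, u ∈ uIcc a b → IntervalIntegrable h volume a u := fun hu =>
    hh.mono_set (uIcc_subset_uIcc left_mem_uIcc hu)
  rw [one_mul, dist_eq_norm, intervalIntegral.integral_interval_sub_left (h1 hx) (h1 hy),
    Real.dist_eq, intervalIntegral.integral_interval_sub_left (h1 hx).norm (h1 hy).norm]
  exact intervalIntegral.norm_integral_le_abs_integral_norm

/-- Fundamental theorem of calculus for absolutely continuous vector-valued functions. -/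
theorem ac_eq_add_integral {F : Type*} [NormedAddCommGroup F] [NormedSpace ℝ F] [CompleteSpace F]
    {y h : ℝ → F} {a b : ℝ} (hy : AbsolutelyContinuousOnInterval y a b)
    (hh : IntervalIntegrable h volume a b)
    (hd : ∀ᵐ x, x ∈ uIcc a b → HasDerivAt y (h x) x) {x : ℝ} (hx : x ∈ uIcc a b) :
    y x = y a + ∫ t in a..x, h t := by
  obtain ⟨C, hC⟩ := (hy.fun_sub (ac_integral hh)).const_of_ae_hasDerivAt_zero (by
    filter_upwards [hd, hh.ae_hasDerivAt_integral] with x h1 h2 hx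
    simpa using (h1 hx).fun_sub (h2 hx a left_mem_uIcc))
  have h1 := hC x hx
  have h2 := hC a left_mem_uIcc
  simp only [intervalIntegral.integral_same, sub_zero] at h2
  rw [h2, ← h1]; abel

end AbsoluteContinuity

/-! ### Grönwall inequality with integrable coefficient -/

section Gronwall

/-- With `K` the primitive of `k`, the integrand is the derivative of `exp (2K) / 2`; the discarded
term is `-1/2`. In the weight `exp (2K)`, integration against a nonnegative `k` thus gains a factor
`1/2`. Both Grönwall and the invertibility of Volterra operators rest on this gain. -/
theorem integral_mul_exp_le {k : ℝ → ℝ} {a b x : ℝ} (hab : a ≤ b)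
    (hk : IntervalIntegrable k volume a b) (hx : x ∈ Icc a b) :
    IntervalIntegrable (fun t => k t * Real.exp (2 * ∫ r in a..t, k r)) volume a b ∧
    ∫ t in a..x, k t * Real.exp (2 * ∫ r in a..t, k r) ≤
      Real.exp (2 * ∫ r in a..x, k r) / 2 := by
  have hK : AbsolutelyContinuousOnInterval (fun x => ∫ t in a..x, k t) a b := ac_integral hk
  have hE : AbsolutelyContinuousOnInterval (fun x => Real.exp (2 * ∫ t in a..x, k t) / 2) a b := by
    have hcont := hK.continuousOn
    obtain ⟨C, hC⟩ := hK.exists_bound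
    -- The exponential is Lipschitz only on bounded sets, hence the bound `C` on the primitive.
    have hc : ContDiffOn ℝ 1 (fun u : ℝ => Real.exp (2 * u) / 2) (Icc (-C) C) := by fun_prop
    obtain ⟨L, hL⟩ := hc.exists_lipschitzOnWith (by decide) (convex_Icc _ _) isCompact_Icc
    refine ac_comp_lipschitz (φ := fun u : ℝ => Real.exp (2 * u) / 2) hK (hL.mono ?_)
    rintro _ ⟨t, ht, rfl⟩
    exact abs_le.1 (hC t ht)
  have hI : IntervalIntegrable (fun t => k t * Real.exp (2 * ∫ r in a..t, k r)) volume a b :=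
    hk.mul_continuousOn (Real.continuous_exp.comp_continuousOn (hK.continuousOn.const_smul (2 : ℝ)))
  refine ⟨hI, ?_⟩
  have hx' : x ∈ uIcc a b := by rwa [uIcc_of_le hab]
  have := ac_eq_add_integral hE hI (by
    filter_upwards [hk.ae_hasDerivAt_integral] with t ht htm
    have h1 := (((ht htm a left_mem_uIcc).const_mul 2).exp).div_const 2
    exact h1.congr_deriv (by ring)) hx'
  simp only [intervalIntegral.integral_same, mul_zero, Real.exp_zero] at this
  linarith

/-- A Grönwall inequality with integrable coefficient. -/
theorem gronwall_integral {w k : ℝ → ℝ} {a b A : ℝ} (hab : a ≤ b)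
    (hw : ContinuousOn w (Icc a b)) (hk : IntervalIntegrable k volume a b)
    (hk0 : ∀ t, 0 ≤ k t) (hA : 0 ≤ A)
    (h : ∀ x ∈ Icc a b, w x ≤ A + ∫ t in a..x, k t * w t) {x : ℝ} (hx : x ∈ Icc a b) :
    w x ≤ 2 * A * Real.exp (2 * ∫ t in a..b, k t) := by
  set K : ℝ → ℝ := fun x => ∫ t in a..x, k t with hKdef
  have hKc : ContinuousOn K (Icc a b) := by
    simpa [uIcc_of_le hab] using (ac_integral hk).continuousOn
  have hK0 : ∀ x ∈ Icc a b, 0 ≤ K x := fun x hx =>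
    intervalIntegral.integral_nonneg hx.1 fun t _ => hk0 t
  obtain ⟨m, hm, hmax⟩ := isCompact_Icc.exists_isMaxOn ⟨a, left_mem_Icc.2 hab⟩
    (hw.mul (Real.continuous_exp.comp_continuousOn (hKc.const_smul (-2 : ℝ))))
  set M := w m * Real.exp (-2 * K m) with hM
  have hle : ∀ t ∈ Icc a b, w t ≤ M * Real.exp (2 * K t) := fun t ht => by
    have h1 : w t * Real.exp (-2 * K t) ≤ M := hmax ht
    have h2 : w t = w t * Real.exp (-2 * K t) * Real.exp (2 * K t) := by
      rw [mul_assoc, ← Real.exp_add]; simp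
    rw [h2]
    gcongr
  have hkm : ∀ u ∈ Icc a b, IntervalIntegrable k volume a u := fun u hu =>
    hk.mono_set (by rw [uIcc_of_le hab, uIcc_of_le hu.1]; exact Icc_subset_Icc_right hu.2)
  have hM2 : M ≤ 2 * A := by
    by_cases hM0 : M ≤ 0
    · linarith
    push Not at hM0
    have h1 := h m hm
    obtain ⟨hI, hI2⟩ := integral_mul_exp_le hab hk hm
    have h2 : ∫ t in a..m, k t * w t ≤ ∫ t in a..m, M * (k t * Real.exp (2 * K t)) := by
      refine intervalIntegral.integral_mono_on hm.1 ?_ ?_ ?_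
      · refine (hkm m hm).mul_continuousOn (hw.mono ?_)
        rw [uIcc_of_le hm.1]; exact Icc_subset_Icc_right hm.2
      · refine (hI.mono_set ?_).const_mul M
        rw [uIcc_of_le hab, uIcc_of_le hm.1]; exact Icc_subset_Icc_right hm.2
      · intro t ht
        have := mul_le_mul_of_nonneg_left (hle t ⟨ht.1, ht.2.trans hm.2⟩) (hk0 t)
        linarith
    rw [intervalIntegral.integral_const_mul] at h2
    have h3 := mul_le_mul_of_nonneg_left hI2 hM0.le
    have h4 : w m = M * Real.exp (2 * K m) := by
      rw [hM, mul_assoc, ← Real.exp_add]; simp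
    have h5 : 1 ≤ Real.exp (2 * K m) := Real.one_le_exp (by have := hK0 m hm; linarith)
    have h6 : M * Real.exp (2 * K m) ≤ 2 * A := by
      have : M * (Real.exp (2 * K m) / 2) = w m / 2 := by rw [h4]; ring
      linarith
    nlinarith
  have h7 : K x ≤ K b := by
    rw [hKdef]
    refine intervalIntegral.integral_mono_interval le_rfl hx.1 hx.2 ?_ hk
    exact Filter.Eventually.of_forall hk0
  calc w x ≤ M * Real.exp (2 * K x) := hle x hx
    _ ≤ 2 * A * Real.exp (2 * K x) := by gcongr
    _ ≤ 2 * A * Real.exp (2 * K b) := by gcongr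

end Gronwall

/-- The invertible element `1 - x ^ m` factors as `1 - x` times a geometric sum, and the two factors
commute. -/
theorem isUnit_one_sub_of_norm_pow_lt_one {R : Type*} [NormedRing R] [HasSummableGeomSeries R]
    {x : R} {m : ℕ} (h : ‖x ^ m‖ < 1) : IsUnit (1 - x) := by
  have h1 := isUnit_one_sub_of_norm_lt_one h
  rw [← mul_neg_geom_sum x m] at h1
  refine ((Commute.isUnit_mul_iff ?_).1 h1).1
  exact Commute.sum_right _ _ _ fun i _ =>
    ((Commute.one_left _).sub_left (Commute.refl x)).pow_right i

/-! ### Volterra operators and linear systems with integrable coefficients -/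

section Volterra

open unitInterval

variable {J : Type*}

/-- The extension of a function on `[0,1]` to `ℝ` that is constant outside `[0,1]`. -/
noncomputable def lineExt (y : C(I, J → ℂ)) (t : ℝ) : J → ℂ := y (projIcc 0 1 zero_le_one t)

theorem continuous_lineExt (y : C(I, J → ℂ)) : Continuous (lineExt y) :=
  y.continuous.comp continuous_projIcc

theorem lineExt_coe (y : C(I, J → ℂ)) (x : I) : lineExt y x = y x := by
  simp [lineExt]

theorem lineExt_of_mem (y : C(I, J → ℂ)) {x : ℝ} (hx : x ∈ Icc (0 : ℝ) 1) :
    lineExt y x = y ⟨x, hx⟩ := by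
  simp [lineExt, projIcc_of_mem _ hx]

variable [Fintype J]

theorem norm_lineExt_le (y : C(I, J → ℂ)) (t : ℝ) : ‖lineExt y t‖ ≤ ‖y‖ :=
  y.norm_coe_le_norm _

/-- The primitive vanishing at `0` of an integrable function, as a continuous function. -/
noncomputable def primitive (h : ℝ → J → ℂ) (hh : IntervalIntegrable h volume 0 1) :
    C(I, J → ℂ) where
  toFun x := ∫ t in (0 : ℝ)..x, h t
  continuous_toFun := by
    have := (ac_integral hh).continuousOn
    rw [uIcc_of_le zero_le_one] at this
    exact continuousOn_iff_continuous_domRestrict.1 this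

theorem primitive_apply (h : ℝ → J → ℂ) (hh : IntervalIntegrable h volume 0 1) (x : I) :
    primitive h hh x = ∫ t in (0 : ℝ)..x, h t := rfl

/-- The entries of `A` are integrable on `[0,1]`. -/
def EntryIntegrable (A : ℝ → Matrix J J ℂ) : Prop :=
  ∀ i j, IntervalIntegrable (fun t => A t i j) volume 0 1

/-- The sum of the absolute values of the entries. -/
noncomputable def entrySum (A : Matrix J J ℂ) : ℝ := ∑ i, ∑ j, ‖A i j‖

theorem entrySum_nonneg (A : Matrix J J ℂ) : 0 ≤ entrySum A :=
  Finset.sum_nonneg fun _ _ => Finset.sum_nonneg fun _ _ => norm_nonneg _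

theorem EntryIntegrable.entrySum {A : ℝ → Matrix J J ℂ} (hA : EntryIntegrable A) :
    IntervalIntegrable (fun t => entrySum (A t)) volume 0 1 := by
  refine ⟨?_, ?_⟩
  · exact integrable_finsetSum _ fun i _ => integrable_finsetSum _ fun j _ => (hA i j).1.norm
  · exact integrable_finsetSum _ fun i _ => integrable_finsetSum _ fun j _ => (hA i j).2.norm

theorem norm_mulVec_le_entrySum (A : Matrix J J ℂ) (v : J → ℂ) :
    ‖A *ᵥ v‖ ≤ entrySum A * ‖v‖ := by
  refine (pi_norm_le_iff_of_nonneg (mul_nonneg (entrySum_nonneg A) (norm_nonneg v))).2 fun i => ?_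
  calc ‖(A *ᵥ v) i‖ ≤ ∑ j, ‖A i j‖ * ‖v‖ := by
        refine (norm_sum_le _ _).trans (Finset.sum_le_sum fun j _ => ?_)
        rw [norm_mul]
        gcongr
        exact norm_le_pi_norm v j
    _ = (∑ j, ‖A i j‖) * ‖v‖ := by rw [Finset.sum_mul]
    _ ≤ entrySum A * ‖v‖ := by
        gcongr
        exact Finset.single_le_sum (f := fun i => ∑ j, ‖A i j‖)
          (fun _ _ => Finset.sum_nonneg fun _ _ => norm_nonneg _) (Finset.mem_univ i)

theorem intervalIntegrable_pi {h : ℝ → J → ℂ} {a b : ℝ}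
    (hh : ∀ j, IntervalIntegrable (fun t => h t j) volume a b) :
    IntervalIntegrable h volume a b :=
  ⟨Integrable.of_eval fun j => (hh j).1, Integrable.of_eval fun j => (hh j).2⟩

theorem EntryIntegrable.mulVec {A : ℝ → Matrix J J ℂ} (hA : EntryIntegrable A) {y : ℝ → J → ℂ}
    (hy : ContinuousOn y (Icc 0 1)) :
    IntervalIntegrable (fun t => A t *ᵥ y t) volume 0 1 := by
  refine intervalIntegrable_pi fun i => ?_
  have h1 : ∀ j, IntervalIntegrable (fun t => A t i j * y t j) volume 0 1 := fun j =>
    (hA i j).mul_continuousOn (by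
      rw [uIcc_of_le zero_le_one]; exact (continuous_apply j).comp_continuousOn hy)
  have h2 := IntervalIntegrable.sum Finset.univ fun j _ => h1 j
  rwa [show (∑ j, fun t => A t i j * y t j) = fun t => (A t *ᵥ y t) i by
    ext t; simp [Matrix.mulVec, dotProduct]] at h2

/-- The Volterra operator `y ↦ ∫₀ˣ A(t) y(t) dt`. -/
noncomputable def volterra (A : ℝ → Matrix J J ℂ) (hA : EntryIntegrable A) :
    C(I, J → ℂ) →L[ℂ] C(I, J → ℂ) :=
  LinearMap.mkContinuous
    { toFun := fun y => primitive (fun t => A t *ᵥ lineExt y t)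
        (hA.mulVec (continuous_lineExt y).continuousOn)
      map_add' := fun y z => by
        ext1 x
        have hx : uIcc (0 : ℝ) x ⊆ uIcc 0 1 :=
          uIcc_subset_uIcc left_mem_uIcc (by rw [uIcc_of_le zero_le_one]; exact x.2)
        simp only [primitive_apply, ContinuousMap.add_apply]
        rw [← intervalIntegral.integral_add
          ((hA.mulVec (continuous_lineExt y).continuousOn).mono_set hx)
          ((hA.mulVec (continuous_lineExt z).continuousOn).mono_set hx)]
        simp [lineExt, Matrix.mulVec_add]
      map_smul' := fun c y => by
        ext1 x
        simp only [primitive_apply, ContinuousMap.smul_apply, RingHom.id_apply]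
        rw [← intervalIntegral.integral_smul]
        simp [lineExt, Matrix.mulVec_smul] }
    (∫ t in (0 : ℝ)..1, entrySum (A t)) fun y => by
      refine (ContinuousMap.norm_le _ (mul_nonneg (intervalIntegral.integral_nonneg zero_le_one
        fun t _ => entrySum_nonneg _) (norm_nonneg _))).2 fun x => ?_
      have hx : uIcc (0 : ℝ) x ⊆ uIcc 0 1 :=
        uIcc_subset_uIcc left_mem_uIcc (by rw [uIcc_of_le zero_le_one]; exact x.2)
      rw [← intervalIntegral.integral_mul_const]
      refine (intervalIntegral.norm_integral_le_of_norm_le x.2.1 ?_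
        ((hA.entrySum.mono_set hx).mul_const ‖y‖)).trans ?_
      · refine Filter.Eventually.of_forall fun t _ => (norm_mulVec_le_entrySum _ _).trans ?_
        gcongr
        · exact entrySum_nonneg _
        · exact norm_lineExt_le y t
      · refine intervalIntegral.integral_mono_interval le_rfl x.2.1 x.2.2 ?_
          (hA.entrySum.mul_const _)
        exact Filter.Eventually.of_forall fun t => mul_nonneg (entrySum_nonneg _) (norm_nonneg _)

theorem volterra_apply (A : ℝ → Matrix J J ℂ) (hA : EntryIntegrable A) (y : C(I, J → ℂ)) (x : I) :
    volterra A hA y x = ∫ t in (0 : ℝ)..x, A t *ᵥ lineExt y t := rfl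

theorem norm_volterra_apply_le (A : ℝ → Matrix J J ℂ) (hA : EntryIntegrable A)
    (y : C(I, J → ℂ)) (x : I) :
    ‖volterra A hA y x‖ ≤ ∫ t in (0 : ℝ)..x, entrySum (A t) * ‖lineExt y t‖ := by
  have hx : uIcc (0 : ℝ) x ⊆ uIcc 0 1 :=
    uIcc_subset_uIcc left_mem_uIcc (by rw [uIcc_of_le zero_le_one]; exact x.2)
  exact intervalIntegral.norm_integral_le_of_norm_le x.2.1
    (Filter.Eventually.of_forall fun t _ => norm_mulVec_le_entrySum _ _)
    ((hA.entrySum.mono_set hx).mul_continuousOn (continuous_lineExt y).norm.continuousOn)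

/-- In the sup norm weighted by `exp (2 ∫ entrySum A)` the Volterra operator halves norms, by
`integral_mul_exp_le`; the weight is at least `1`, which starts the induction. -/
theorem norm_volterra_pow_apply_le (A : ℝ → Matrix J J ℂ) (hA : EntryIntegrable A) (m : ℕ)
    (y : C(I, J → ℂ)) (x : I) :
    ‖(volterra A hA ^ m) y x‖ ≤
      (1 / 2) ^ m * Real.exp (2 * ∫ t in (0 : ℝ)..x, entrySum (A t)) * ‖y‖ := by
  induction m generalizing x with
  | zero =>
    simp only [pow_zero, one_apply_eq_self, one_mul]
    refine (y.norm_coe_le_norm x).trans (le_mul_of_one_le_left (norm_nonneg _) ?_)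
    exact Real.one_le_exp (mul_nonneg zero_le_two
      (intervalIntegral.integral_nonneg x.2.1 fun t _ => entrySum_nonneg _))
  | succ m ih =>
    rw [pow_succ', mul_apply_eq_comp]
    have hx : uIcc (0 : ℝ) x ⊆ uIcc 0 1 :=
      uIcc_subset_uIcc left_mem_uIcc (by rw [uIcc_of_le zero_le_one]; exact x.2)
    obtain ⟨hI, hle⟩ := integral_mul_exp_le zero_le_one hA.entrySum x.2
    refine (norm_volterra_apply_le A hA _ x).trans ?_
    have h1 : ∫ t in (0 : ℝ)..x, entrySum (A t) * ‖lineExt ((volterra A hA ^ m) y) t‖ ≤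
        ∫ t in (0 : ℝ)..x, ((1 / 2) ^ m * ‖y‖) *
          (entrySum (A t) * Real.exp (2 * ∫ r in (0 : ℝ)..t, entrySum (A r))) := by
      refine intervalIntegral.integral_mono_on x.2.1 ((hA.entrySum.mono_set hx).mul_continuousOn
        (continuous_lineExt _).norm.continuousOn) ((hI.mono_set hx).const_mul _) fun t ht => ?_
      have h2 := ih ⟨t, ht.1, ht.2.trans x.2.2⟩
      rw [lineExt_of_mem _ ⟨ht.1, ht.2.trans x.2.2⟩]
      calc _ ≤ entrySum (A t) *
          ((1 / 2) ^ m * Real.exp (2 * ∫ r in (0 : ℝ)..t, entrySum (A r)) * ‖y‖) :=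
            mul_le_mul_of_nonneg_left h2 (entrySum_nonneg _)
        _ = _ := by ring
    refine h1.trans ?_
    rw [intervalIntegral.integral_const_mul]
    calc _ ≤ ((1 / 2) ^ m * ‖y‖) * (Real.exp (2 * ∫ r in (0 : ℝ)..x, entrySum (A r)) / 2) := by
          gcongr
      _ = _ := by ring

theorem isUnit_one_sub_volterra (A : ℝ → Matrix J J ℂ) (hA : EntryIntegrable A) :
    IsUnit (1 - volterra A hA) := by
  set V := volterra A hA
  set E := Real.exp (2 * ∫ t in (0 : ℝ)..1, entrySum (A t))
  obtain ⟨m, hm⟩ := exists_pow_lt_of_lt_one (inv_pos.2 (Real.exp_pos _) : 0 < E⁻¹)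
    (by norm_num : (1 / 2 : ℝ) < 1)
  have hV : ‖V ^ m‖ < 1 := by
    refine (ContinuousLinearMap.opNorm_le_bound _ (by positivity) fun y =>
      (ContinuousMap.norm_le _ (by positivity)).2 fun x =>
        (norm_volterra_pow_apply_le A hA m y x).trans ?_).trans_lt
      (b := (1 / 2) ^ m * E) ?_
    · gcongr
      refine Real.exp_le_exp.2 (mul_le_mul_of_nonneg_left ?_ zero_le_two)
      exact intervalIntegral.integral_mono_interval le_rfl x.2.1 x.2.2
        (Filter.Eventually.of_forall fun t => entrySum_nonneg _) hA.entrySum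
    · calc (1 / 2) ^ m * E < E⁻¹ * E := by gcongr
        _ = 1 := inv_mul_cancel₀ (Real.exp_pos _).ne'
  exact isUnit_one_sub_of_norm_pow_lt_one (R := C(I, J → ℂ) →L[ℂ] C(I, J → ℂ)) hV

/-- The solution operator of `y = u + ∫₀ˣ A y`. -/
noncomputable def solutionOp (A : ℝ → Matrix J J ℂ) (hA : EntryIntegrable A) :
    C(I, J → ℂ) →L[ℂ] C(I, J → ℂ) := Ring.inverse (1 - volterra A hA)

theorem solutionOp_eq (A : ℝ → Matrix J J ℂ) (hA : EntryIntegrable A) (u : C(I, J → ℂ)) :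
    solutionOp A hA u = u + volterra A hA (solutionOp A hA u) := by
  have h := Ring.mul_inverse_cancel _ (isUnit_one_sub_volterra A hA)
  have h2 := congrArg (fun T : C(I, J → ℂ) →L[ℂ] C(I, J → ℂ) => T u) h
  simp only [mul_apply_eq_comp, sub_apply,
    one_apply_eq_self, sub_eq_iff_eq_add] at h2
  exact h2

theorem eq_solutionOp (A : ℝ → Matrix J J ℂ) (hA : EntryIntegrable A) {u y : C(I, J → ℂ)}
    (hy : y = u + volterra A hA y) : y = solutionOp A hA u := by
  have h := Ring.inverse_mul_cancel _ (isUnit_one_sub_volterra A hA)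
  have h2 := congrArg (fun T : C(I, J → ℂ) →L[ℂ] C(I, J → ℂ) => T y) h
  simp only [mul_apply_eq_comp, sub_apply,
    one_apply_eq_self] at h2
  rw [sub_eq_iff_eq_add.2 hy] at h2
  exact h2.symm

/-- Constant functions, as a linear operator. -/
noncomputable def constOp : (J → ℂ) →L[ℂ] C(I, J → ℂ) :=
  LinearMap.mkContinuous
    { toFun := fun v => ContinuousMap.const I v
      map_add' := fun _ _ => rfl
      map_smul' := fun _ _ => rfl } 1 fun v => by
      rw [one_mul]
      exact (ContinuousMap.norm_le _ (norm_nonneg v)).2 fun _ => le_rfl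

@[simp] theorem constOp_apply (v : J → ℂ) (x : I) : constOp v x = v := rfl

/-- Absolutely continuous solutions of `y' = A y + h`. -/
def IsSolution (A : ℝ → Matrix J J ℂ) (h y : ℝ → J → ℂ) : Prop :=
  AbsolutelyContinuousOnInterval y 0 1 ∧
    ∀ᵐ x, x ∈ Icc (0 : ℝ) 1 → HasDerivAt y (A x *ᵥ y x + h x) x

/-- Solutions are extended by constants outside `[0,1]`, so two-sided derivatives are under control
only in the open interval. -/
theorem ae_mem_Ioo_of_mem_Icc : ∀ᵐ x : ℝ, x ∈ Icc (0 : ℝ) 1 → x ∈ Ioo (0 : ℝ) 1 := by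
  have h1 : ∀ᵐ x : ℝ, x ≠ 0 := by simp [ae_iff, measure_singleton]
  have h2 : ∀ᵐ x : ℝ, x ≠ 1 := by simp [ae_iff, measure_singleton]
  filter_upwards [h1, h2] with x h1 h2 hx
  exact ⟨lt_of_le_of_ne hx.1 h1.symm, lt_of_le_of_ne hx.2 h2⟩

theorem isSolution_lineExt {A : ℝ → Matrix J J ℂ} (hA : EntryIntegrable A) {h : ℝ → J → ℂ}
    (hh : IntervalIntegrable h volume 0 1) {v : J → ℂ} {y : C(I, J → ℂ)}
    (hy : y = constOp v + primitive h hh + volterra A hA y) :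
    IsSolution A h (lineExt y) := by
  have hAy := hA.mulVec (continuous_lineExt y).continuousOn
  have hI : IntervalIntegrable (fun t => A t *ᵥ lineExt y t + h t) volume 0 1 := hAy.add hh
  have hform : ∀ x ∈ Icc (0 : ℝ) 1,
      v + ∫ t in (0 : ℝ)..x, (A t *ᵥ lineExt y t + h t) = lineExt y x := by
    intro x hx
    have hxs : uIcc (0 : ℝ) x ⊆ uIcc 0 1 :=
      uIcc_subset_uIcc left_mem_uIcc (by rw [uIcc_of_le zero_le_one]; exact hx)
    rw [intervalIntegral.integral_add (hAy.mono_set hxs) (hh.mono_set hxs), lineExt_of_mem y hx]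
    have h1 := congrArg (fun u : C(I, J → ℂ) => u ⟨x, hx⟩) hy
    simp only [ContinuousMap.add_apply, constOp_apply, primitive_apply, volterra_apply] at h1
    rw [h1]; abel
  refine ⟨ac_congr ((ac_const v 0 1).fun_add (ac_integral hI)) ?_, ?_⟩
  · rw [uIcc_of_le zero_le_one]; exact hform
  · filter_upwards [hI.ae_hasDerivAt_integral, ae_mem_Ioo_of_mem_Icc] with x hx hx1 hx2
    rw [uIcc_of_le zero_le_one] at hx
    refine ((hx hx2 0 (left_mem_Icc.2 zero_le_one)).const_add v).congr_of_eventuallyEq ?_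
    filter_upwards [Icc_mem_nhds (hx1 hx2).1 (hx1 hx2).2] with t ht using (hform t ht).symm

theorem isSolution_solutionOp {A : ℝ → Matrix J J ℂ} (hA : EntryIntegrable A) {h : ℝ → J → ℂ}
    (hh : IntervalIntegrable h volume 0 1) (v : J → ℂ) :
    IsSolution A h (lineExt (solutionOp A hA (constOp v + primitive h hh))) :=
  isSolution_lineExt hA hh (solutionOp_eq A hA _)

theorem solutionOp_apply_zero {A : ℝ → Matrix J J ℂ} (hA : EntryIntegrable A) (u : C(I, J → ℂ)) :
    solutionOp A hA u 0 = u 0 := by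
  have h1 := congrArg (fun u : C(I, J → ℂ) => u 0) (solutionOp_eq A hA u)
  simpa [volterra_apply] using h1

/-- Restriction of a function that is continuous on `[0,1]`. -/
def restrictUnit (y : ℝ → J → ℂ) (hy : ContinuousOn y (Icc 0 1)) : C(I, J → ℂ) :=
  ⟨fun x => y x, continuousOn_iff_continuous_domRestrict.1 hy⟩

theorem IsSolution.continuousOn {A : ℝ → Matrix J J ℂ} {h y : ℝ → J → ℂ}
    (hy : IsSolution A h y) : ContinuousOn y (Icc 0 1) := by
  simpa [uIcc_of_le zero_le_one] using hy.1.continuousOn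

/-- Uniqueness for the Cauchy problem: the integrated equation is the fixed point equation, which
has one solution because `1 - volterra A hA` is invertible. -/
theorem IsSolution.restrict_eq {A : ℝ → Matrix J J ℂ} (hA : EntryIntegrable A) {h y : ℝ → J → ℂ}
    (hh : IntervalIntegrable h volume 0 1) (hy : IsSolution A h y) :
    restrictUnit y hy.continuousOn = solutionOp A hA (constOp (y 0) + primitive h hh) := by
  refine eq_solutionOp A hA ?_
  ext1 x
  have hx : (x : ℝ) ∈ uIcc (0 : ℝ) 1 := by rw [uIcc_of_le zero_le_one]; exact x.2
  have hxs : uIcc (0 : ℝ) x ⊆ uIcc 0 1 := uIcc_subset_uIcc left_mem_uIcc hx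
  have hAy := hA.mulVec hy.continuousOn
  have h1 := ac_eq_add_integral hy.1 (hAy.add hh) (by
    simpa [uIcc_of_le zero_le_one] using hy.2) hx
  simp only [ContinuousMap.add_apply, constOp_apply, primitive_apply, volterra_apply]
  rw [intervalIntegral.integral_add (hAy.mono_set hxs) (hh.mono_set hxs)] at h1
  have h2 : ∫ t in (0 : ℝ)..x, A t *ᵥ lineExt (restrictUnit y hy.continuousOn) t =
      ∫ t in (0 : ℝ)..x, A t *ᵥ y t := by
    refine intervalIntegral.integral_congr fun t ht => ?_
    rw [uIcc_of_le x.2.1] at ht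
    rw [lineExt_of_mem _ ⟨ht.1, ht.2.trans x.2.2⟩]
    rfl
  rw [h2]
  change y x = _
  rw [h1]; abel

end Volterra

/-! ### Growth of mixed minors of a fundamental matrix -/

section Determinants

variable {J : Type*} [DecidableEq J]

/-- The matrix whose rows with index in `S` are the rows of `N` chosen by `σ`, the others being
prescribed by `q`. -/
def mixedRows (S : Finset J) (q : J → J → ℂ) (σ : J → J) (N : Matrix J J ℂ) : Matrix J J ℂ :=
  fun j => if j ∈ S then N (σ j) else q j

theorem mixedRows_of_mem {S : Finset J} (q : J → J → ℂ) (σ : J → J) (N : Matrix J J ℂ)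
    {j : J} (hj : j ∈ S) : mixedRows S q σ N j = N (σ j) := if_pos hj

theorem mixedRows_of_notMem {S : Finset J} (q : J → J → ℂ) (σ : J → J) (N : Matrix J J ℂ)
    {j : J} (hj : j ∉ S) : mixedRows S q σ N j = q j := if_neg hj

/-- Changing a moving row stays within the family indexed by `σ`; this is why the minors satisfy a
closed linear system. -/
theorem mixedRows_updateRow {S : Finset J} (q : J → J → ℂ) (σ : J → J) (N : Matrix J J ℂ)
    {l : J} (hl : l ∈ S) (k : J) :
    (mixedRows S q σ N).updateRow l (N k) = mixedRows S q (Function.update σ l k) N := by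
  ext i j
  by_cases hi : i = l
  · subst hi; simp [mixedRows, hl]
  · simp [mixedRows, Matrix.updateRow_ne hi, Function.update_of_ne hi]

variable [Fintype J]

/-- The product rule for a multilinear map of the rows; scalars are restricted to `ℝ` because the
variable is real. -/
theorem hasDerivAt_det {M : ℝ → Matrix J J ℂ} {M' : Matrix J J ℂ} {x : ℝ}
    (h : ∀ j, HasDerivAt (fun t => M t j) (M' j) x) :
    HasDerivAt (fun t => (M t).det) (∑ l, ((M x).updateRow l (M' l)).det) x := by
  let F : ContinuousMultilinearMap ℝ (fun _ : J => J → ℂ) ℂ :=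
    { toMultilinearMap :=
        (Matrix.detRowAlternating (R := ℂ) (n := J)).toMultilinearMap.restrictScalars ℝ
      cont := Continuous.matrix_det continuous_id }
  have h1 := HasFDerivAt.multilinear_comp (f := F) (fun j => (h j).hasFDerivAt)
  have h2 := h1.hasDerivAt
  refine h2.congr_deriv ?_
  rw [sum_apply]
  refine Finset.sum_congr rfl fun l _ => ?_
  simp only [ContinuousLinearMap.comp_apply, ContinuousLinearMap.toSpanSingleton_apply, one_smul]
  rfl

theorem ac_det {M : ℝ → Matrix J J ℂ} {a b : ℝ}
    (h : ∀ i j, AbsolutelyContinuousOnInterval (fun t => M t i j) a b) :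
    AbsolutelyContinuousOnInterval (fun t => (M t).det) a b := by
  simp only [Matrix.det_apply']
  exact ac_finset_sum _ fun σ _ => (ac_const (((Equiv.Perm.sign σ : ℤ) : ℂ)) a b).fun_smul
    (ac_finset_prod _ fun i _ => h _ _)

theorem det_updateRow_sum_smul (N : Matrix J J ℂ) (l : J) (c : J → ℂ) (r : J → J → ℂ) :
    (N.updateRow l (∑ k, c k • r k)).det = ∑ k, c k * (N.updateRow l (r k)).det := by
  refine (Matrix.detRowAlternating.map_update_sum Finset.univ l (fun k => c k • r k) N).trans ?_
  exact Finset.sum_congr rfl fun k _ => Matrix.detRowAlternating.map_update_smul N l (c k) (r k)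

/-- Two moving rows coincide. Only minors with distinct row indices survive, so only sums of
distinct exponents occur as growth rates. -/
theorem mixedRows_det_eq_zero {S : Finset J} (q : J → J → ℂ) {σ : J → J} (N : Matrix J J ℂ)
    (hσ : ¬ InjOn σ S) : (mixedRows S q σ N).det = 0 := by
  simp only [InjOn, not_forall] at hσ
  obtain ⟨i, hi, j, hj, hij, hne⟩ := hσ
  refine Matrix.det_zero_of_row_eq hne ?_
  ext k
  simp [mixedRows, Finset.mem_coe.1 hi, Finset.mem_coe.1 hj, hij]

/-- The matrix `M` has absolutely continuous entries and satisfies `M' = A M`. -/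
def IsMatrixSolution (A : ℝ → Matrix J J ℂ) (M : ℝ → Matrix J J ℂ) : Prop :=
  (∀ i j, AbsolutelyContinuousOnInterval (fun t => M t i j) 0 1) ∧
    ∀ᵐ t, t ∈ Icc (0 : ℝ) 1 → ∀ i, HasDerivAt (fun t => M t i) ((A t * M t) i) t

/-- The exterior power of the system `M' = (diag a + P) M`, with frozen rows contributing nothing:
the diagonal part multiplies a minor by the sum of its exponents, and `P` couples it to the minors
with one index changed. -/
theorem hasDerivAt_mixedRows_det {a : J → ℂ} {P M : ℝ → Matrix J J ℂ} {t : ℝ}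
    (h : ∀ i, HasDerivAt (fun t => M t i) (((Matrix.diagonal a + P t) * M t) i) t)
    (S : Finset J) (q : J → J → ℂ) (σ : J → J) :
    HasDerivAt (fun t => (mixedRows S q σ (M t)).det)
      ((∑ l ∈ S, a (σ l)) * (mixedRows S q σ (M t)).det +
        ∑ l ∈ S, ∑ k, P t (σ l) k * (mixedRows S q (Function.update σ l k) (M t)).det) t := by
  let R : Matrix J J ℂ := fun j =>
    if j ∈ S then ((Matrix.diagonal a + P t) * M t) (σ j) else 0
  have h1 : ∀ j, HasDerivAt (fun t => mixedRows S q σ (M t) j) (R j) t := by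
    intro j
    by_cases hj : j ∈ S
    · simp only [mixedRows_of_mem _ _ _ hj, R, if_pos hj]
      exact h (σ j)
    · simp only [mixedRows_of_notMem _ _ _ hj, R, if_neg hj]
      exact hasDerivAt_const t (q j)
  refine (hasDerivAt_det h1).congr_deriv ?_
  rw [Finset.sum_mul, ← Finset.sum_add_distrib, ← Finset.sum_subset (Finset.subset_univ S)]
  · refine Finset.sum_congr rfl fun l hl => ?_
    have h2 : R l = a (σ l) • M t (σ l) + ∑ k, P t (σ l) k • M t k := by
      ext j
      simp only [R, if_pos hl, add_mul, Matrix.add_apply, Matrix.diagonal_mul, Pi.add_apply,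
        Pi.smul_apply, Finset.sum_apply, smul_eq_mul]
      rfl
    rw [h2, Matrix.det_updateRow_add, Matrix.det_updateRow_smul, mixedRows_updateRow q σ _ hl,
      Function.update_eq_self]
    congr 1
    refine (det_updateRow_sum_smul _ l (fun k => P t (σ l) k) (fun k => M t k)).trans ?_
    exact Finset.sum_congr rfl fun k _ => by rw [mixedRows_updateRow q σ _ hl]
  · intro l _ hl
    refine Matrix.det_eq_zero_of_row_eq_zero l fun j => ?_
    simp [R, hl]

/-- Variation of constants for one minor, whose own exponent `s` satisfies `Re s ≤ ω`; the coupling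
through `P` is bounded crudely by the sum over all minors. -/
theorem norm_mixedRows_det_le_add_integral {a : J → ℂ} {P M : ℝ → Matrix J J ℂ}
    (hP : EntryIntegrable P) (hM : IsMatrixSolution (fun t => Matrix.diagonal a + P t) M)
    {ω : ℝ} (hω : ∀ T : Finset J, (∑ j ∈ T, a j).re ≤ ω)
    (S : Finset J) (q : J → J → ℂ) (σ : J → J) {t₀ x : ℝ} (ht₀ : 0 ≤ t₀) (hx : x ∈ Icc t₀ 1) :
    Real.exp (-ω * x) * ‖(mixedRows S q σ (M x)).det‖ ≤
      Real.exp (-ω * t₀) * ‖(mixedRows S q σ (M t₀)).det‖ +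
      ∫ t in t₀..x, (Fintype.card J * entrySum (P t)) *
        ∑ σ' : J → J, Real.exp (-ω * t) * ‖(mixedRows S q σ' (M t)).det‖ := by
  have hsub : uIcc t₀ x ⊆ uIcc (0 : ℝ) 1 := by
    rw [uIcc_of_le hx.1, uIcc_of_le zero_le_one]; exact Icc_subset_Icc ht₀ hx.2
  have hac : ∀ σ, AbsolutelyContinuousOnInterval (fun t => (mixedRows S q σ (M t)).det) t₀ x := by
    intro σ
    refine (ac_det fun i j => ?_).mono hsub
    by_cases hi : i ∈ S
    · simp only [mixedRows_of_mem _ _ _ hi]; exact hM.1 _ _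
    · simp only [mixedRows_of_notMem _ _ _ hi]; exact ac_const _ _ _
  have hcont : ∀ σ, ContinuousOn (fun t => (mixedRows S q σ (M t)).det) (uIcc t₀ x) :=
    fun σ => (hac σ).continuousOn
  have hPI : IntervalIntegrable (fun t => entrySum (P t)) volume t₀ x :=
    hP.entrySum.mono_set hsub
  have hRI : IntervalIntegrable (fun t => (Fintype.card J * entrySum (P t)) *
        ∑ σ' : J → J, Real.exp (-ω * t) * ‖(mixedRows S q σ' (M t)).det‖) volume t₀ x := by
    refine (hPI.const_mul _).mul_continuousOn (continuousOn_finsetSum _ fun σ _ => ?_)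
    exact ContinuousOn.mul (by fun_prop) (hcont σ).norm
  have hRnn : ∀ t, 0 ≤ (Fintype.card J * entrySum (P t)) *
        ∑ σ' : J → J, Real.exp (-ω * t) * ‖(mixedRows S q σ' (M t)).det‖ := fun t =>
    mul_nonneg (mul_nonneg (Nat.cast_nonneg _) (entrySum_nonneg _))
      (Finset.sum_nonneg fun _ _ => by positivity)
  by_cases hσ : InjOn σ S
  swap
  · rw [mixedRows_det_eq_zero q _ hσ, mixedRows_det_eq_zero q _ hσ]
    simpa using intervalIntegral.integral_nonneg hx.1 fun t _ => hRnn t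
  set s : ℂ := ∑ l ∈ S, a (σ l) with hs
  have hsω : s.re ≤ ω := by
    -- Injectivity of `σ` on `S` turns `s` into a sum of `a` over a set of indices, to which `hω`
    -- applies.
    rw [hs, ← Finset.sum_image (f := a) (g := σ) (s := S) fun i hi j hj h => hσ hi hj h]
    exact hω _
  set G : ℝ → ℂ := fun t => ∑ l ∈ S, ∑ k, P t (σ l) k *
    (mixedRows S q (Function.update σ l k) (M t)).det with hG
  have hGI : IntervalIntegrable G volume t₀ x := by
    have : G = ∑ l ∈ S, ∑ k, fun t => P t (σ l) k *
        (mixedRows S q (Function.update σ l k) (M t)).det := by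
      ext t; simp [hG]
    rw [this]
    exact IntervalIntegrable.sum _ fun l _ => IntervalIntegrable.sum _ fun k _ =>
      ((hP _ _).mono_set hsub).mul_continuousOn (hcont _)
  have hGle : ∀ t, Real.exp (-ω * t) * ‖G t‖ ≤ (Fintype.card J * entrySum (P t)) *
        ∑ σ' : J → J, Real.exp (-ω * t) * ‖(mixedRows S q σ' (M t)).det‖ := by
    intro t
    rw [← Finset.mul_sum, mul_left_comm]
    refine mul_le_mul_of_nonneg_left ?_ (Real.exp_pos _).le
    set U := ∑ σ' : J → J, ‖(mixedRows S q σ' (M t)).det‖ with hU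
    have hU1 : ∀ σ', ‖(mixedRows S q σ' (M t)).det‖ ≤ U := fun σ' =>
      Finset.single_le_sum (f := fun σ' => ‖(mixedRows S q σ' (M t)).det‖)
        (fun _ _ => norm_nonneg _) (Finset.mem_univ σ')
    have hU0 : 0 ≤ U := Finset.sum_nonneg fun _ _ => norm_nonneg _
    calc ‖G t‖ ≤ ∑ l ∈ S, ∑ k, ‖P t (σ l) k‖ * U := by
          refine (norm_sum_le _ _).trans (Finset.sum_le_sum fun l _ => ?_)
          refine (norm_sum_le _ _).trans (Finset.sum_le_sum fun k _ => ?_)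
          rw [norm_mul]
          exact mul_le_mul_of_nonneg_left (hU1 _) (norm_nonneg _)
      _ ≤ ∑ l ∈ S, entrySum (P t) * U := by
          refine Finset.sum_le_sum fun l _ => ?_
          rw [← Finset.sum_mul]
          refine mul_le_mul_of_nonneg_right ?_ hU0
          exact Finset.single_le_sum (f := fun i => ∑ j, ‖P t i j‖)
            (fun _ _ => Finset.sum_nonneg fun _ _ => norm_nonneg _) (Finset.mem_univ (σ l))
      _ ≤ Fintype.card J * entrySum (P t) * U := by
          rw [Finset.sum_const, nsmul_eq_mul, mul_assoc]
          refine mul_le_mul_of_nonneg_right ?_ (mul_nonneg (entrySum_nonneg _) hU0)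
          exact_mod_cast Finset.card_le_univ S
  have hexpac : AbsolutelyContinuousOnInterval (fun t : ℝ => Complex.exp (-s * t)) t₀ x := by
    refine ContDiffOn.absolutelyContinuousOnInterval (ContDiff.contDiffOn ?_)
    exact ((contDiff_const.mul ofRealCLM.contDiff)).cexp
  have hFTC := ac_eq_add_integral (h := fun t => Complex.exp (-s * t) * G t)
    (hexpac.fun_smul (hac σ))
    (hGI.continuousOn_mul hexpac.continuousOn) (by
      filter_upwards [hM.2] with t ht htm
      rw [uIcc_of_le zero_le_one] at hsub
      have h1 := hasDerivAt_mixedRows_det (ht (hsub htm)) S q σ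
      have h2 : HasDerivAt (fun t : ℝ => Complex.exp (-s * t)) (Complex.exp (-s * t) * (-s)) t := by
        have h3 : HasDerivAt (fun t : ℝ => -s * (t : ℂ)) (-s) t := by
          simpa using (Complex.ofRealCLM.hasDerivAt (x := t)).const_mul (-s)
        exact h3.cexp
      refine (h2.fun_mul h1).congr_deriv ?_
      simp only [hG]
      ring) right_mem_uIcc
  simp only [smul_eq_mul] at hFTC
  have hux : (mixedRows S q σ (M x)).det = Complex.exp (s * x) *
      (Complex.exp (-s * t₀) * (mixedRows S q σ (M t₀)).det +
        ∫ t in t₀..x, Complex.exp (-s * t) * G t) := by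
    rw [← hFTC, ← mul_assoc, ← Complex.exp_add]; simp
  -- From time `t` to time `x` the propagator grows by `exp (Re s (x - t))`, which is at most `exp
  -- (ω (x - t))`.
  have hkey : ∀ t ≤ x, Real.exp (-ω * x) * (‖Complex.exp (s * x)‖ * ‖Complex.exp (-s * t)‖) ≤
      Real.exp (-ω * t) := by
    intro t ht
    rw [Complex.norm_exp, Complex.norm_exp, ← Real.exp_add, ← Real.exp_add]
    refine Real.exp_le_exp.2 ?_
    simp only [mul_re, ofReal_re, ofReal_im, mul_zero, sub_zero, neg_re]
    nlinarith
  rw [hux, norm_mul]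
  calc Real.exp (-ω * x) * (‖Complex.exp (s * x)‖ * ‖Complex.exp (-s * t₀) *
        (mixedRows S q σ (M t₀)).det + ∫ t in t₀..x, Complex.exp (-s * t) * G t‖)
      ≤ Real.exp (-ω * x) * (‖Complex.exp (s * x)‖ * (‖Complex.exp (-s * t₀)‖ *
        ‖(mixedRows S q σ (M t₀)).det‖ + ∫ t in t₀..x, ‖Complex.exp (-s * t) * G t‖)) := by
        gcongr
        refine (norm_add_le _ _).trans (add_le_add (norm_mul_le _ _) ?_)
        exact intervalIntegral.norm_integral_le_integral_norm hx.1
    _ = Real.exp (-ω * x) * (‖Complex.exp (s * x)‖ * ‖Complex.exp (-s * t₀)‖) *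
          ‖(mixedRows S q σ (M t₀)).det‖ +
        ∫ t in t₀..x, Real.exp (-ω * x) * (‖Complex.exp (s * x)‖ * ‖Complex.exp (-s * t)‖) *
          ‖G t‖ := by
        have : ∀ t : ℝ, Real.exp (-ω * x) * (‖Complex.exp (s * x)‖ * ‖Complex.exp (-s * t)‖) *
          ‖G t‖ = (Real.exp (-ω * x) * ‖Complex.exp (s * x)‖) * ‖Complex.exp (-s * t) * G t‖ :=
          fun t => by rw [norm_mul]; ring
        simp only [this]
        rw [intervalIntegral.integral_const_mul]
        ring
    _ ≤ _ := by
        gcongr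
        · exact hkey _ hx.1
        · refine intervalIntegral.integral_mono_on hx.1 ?_ hRI fun t ht => ?_
          · refine hGI.norm.continuousOn_mul ?_
            fun_prop
          · refine (mul_le_mul_of_nonneg_right (hkey t ht.2) (norm_nonneg _)).trans (hGle t)

/-- Minors of a fundamental matrix grow at most like `exp (ω t)`, where `ω` bounds all partial sums
of the real parts of the diagonal terms. -/
theorem sum_norm_mixedRows_det_le {a : J → ℂ} {P M : ℝ → Matrix J J ℂ}
    (hP : EntryIntegrable P) (hM : IsMatrixSolution (fun t => Matrix.diagonal a + P t) M)
    {ω : ℝ} (hω : ∀ T : Finset J, (∑ j ∈ T, a j).re ≤ ω)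
    (S : Finset J) (q : J → J → ℂ) {t₀ x : ℝ} (ht₀ : 0 ≤ t₀) (hx : x ∈ Icc t₀ 1) :
    ∑ σ : J → J, Real.exp (-ω * x) * ‖(mixedRows S q σ (M x)).det‖ ≤
      2 * (∑ σ : J → J, Real.exp (-ω * t₀) * ‖(mixedRows S q σ (M t₀)).det‖) *
        Real.exp (2 * (Fintype.card (J → J) * Fintype.card J * ∫ t in (0 : ℝ)..1,
          entrySum (P t))) := by
  have hsub : uIcc t₀ 1 ⊆ uIcc (0 : ℝ) 1 := by
    rw [uIcc_of_le (hx.1.trans hx.2), uIcc_of_le zero_le_one]; exact Icc_subset_Icc_left ht₀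
  have hcont : ∀ σ, ContinuousOn (fun t => (mixedRows S q σ (M t)).det) (Icc 0 1) := by
    intro σ
    rw [← uIcc_of_le (zero_le_one (α := ℝ))]
    refine (ac_det fun i j => ?_).continuousOn
    by_cases hi : i ∈ S
    · simp only [mixedRows_of_mem _ _ _ hi]; exact hM.1 _ _
    · simp only [mixedRows_of_notMem _ _ _ hi]; exact ac_const _ _ _
  have hW : ContinuousOn
      (fun t => ∑ σ : J → J, Real.exp (-ω * t) * ‖(mixedRows S q σ (M t)).det‖) (Icc t₀ 1) := by
    refine continuousOn_finsetSum _ fun σ _ => ContinuousOn.mul (by fun_prop) ?_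
    exact ((hcont σ).mono (Icc_subset_Icc_left ht₀)).norm
  have hk : IntervalIntegrable (fun t => (Fintype.card (J → J) : ℝ) * (Fintype.card J *
      entrySum (P t))) volume t₀ 1 := ((hP.entrySum.mono_set hsub).const_mul _).const_mul _
  have h := gronwall_integral (hx.1.trans hx.2) hW hk
    (fun t => mul_nonneg (Nat.cast_nonneg _) (mul_nonneg (Nat.cast_nonneg _) (entrySum_nonneg _)))
    (A := ∑ σ : J → J, Real.exp (-ω * t₀) * ‖(mixedRows S q σ (M t₀)).det‖)
    (Finset.sum_nonneg fun _ _ => by positivity) (fun u hu => by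
      refine (Finset.sum_le_sum fun σ _ =>
        norm_mixedRows_det_le_add_integral hP hM hω S q σ ht₀ hu).trans ?_
      rw [Finset.sum_add_distrib, Finset.sum_const, nsmul_eq_mul, Finset.card_univ,
        ← intervalIntegral.integral_const_mul]
      simp only [mul_assoc]
      exact le_rfl) hx
  refine h.trans ?_
  refine mul_le_mul_of_nonneg_left (Real.exp_le_exp.2 ?_)
    (mul_nonneg (zero_le_two (α := ℝ)) (Finset.sum_nonneg fun _ _ => by positivity))
  have h5 : ∫ t in t₀..1, entrySum (P t) ≤ ∫ t in (0 : ℝ)..1, entrySum (P t) :=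
    intervalIntegral.integral_mono_interval ht₀ (hx.1.trans hx.2) (le_refl (1 : ℝ))
      (Filter.Eventually.of_forall fun t => entrySum_nonneg _) hP.entrySum
  rw [intervalIntegral.integral_const_mul, intervalIntegral.integral_const_mul,
    ← mul_assoc (Fintype.card (J → J) : ℝ)]
  gcongr

/-- Determinants formed from rows of a fundamental matrix at the three times `0 ≤ x ≤ 1` are bounded
by a constant times `exp ω`. -/
theorem exists_norm_det_rows_le (J : Type*) [Fintype J] [DecidableEq J] (κ : ℝ) :
    ∃ K : ℝ, 0 ≤ K ∧ ∀ (a : J → ℂ) (P M : ℝ → Matrix J J ℂ) (ω x : ℝ),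
      EntryIntegrable P → IsMatrixSolution (fun t => Matrix.diagonal a + P t) M → M 0 = 1 →
      ∫ t in (0 : ℝ)..1, entrySum (P t) ≤ κ → (∀ T : Finset J, (∑ j ∈ T, a j).re ≤ ω) →
      x ∈ Icc (0 : ℝ) 1 → ∀ (f : J → J) (c : J → Fin 3),
        ‖Matrix.det (fun j => M ((![0, x, 1] : Fin 3 → ℝ) (c j)) (f j))‖ ≤ K * Real.exp ω := by
  set N : ℝ := ((Fintype.card (J → J) : ℕ) : ℝ) with hN
  set C₀ : ℝ := ∑ g : J → J, ‖Matrix.det (fun j => (1 : Matrix J J ℂ) (g j))‖ with hC₀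
  set E : ℝ := Real.exp (2 * (N * Fintype.card J * κ)) with hE
  have hC0 : 0 ≤ C₀ := Finset.sum_nonneg fun _ _ => norm_nonneg _
  have hE0 : 0 ≤ E := (Real.exp_pos _).le
  have hN0 : 0 ≤ N := Nat.cast_nonneg _
  refine ⟨2 * (N * (2 * (N * C₀) * E)) * E, by positivity, ?_⟩
  intro a P M ω x hP hM hM0 hκ hω hx f c
  have hexp : Real.exp (2 * (Fintype.card (J → J) * Fintype.card J *
      ∫ t in (0 : ℝ)..1, entrySum (P t))) ≤ E := by
    rw [hE, ← hN]; gcongr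
  -- On `[0,x]` only the rows assigned to time `0` are frozen; at time `x` those assigned to `x` are
  -- frozen too, and on `[x,1]` only the rows assigned to time `1` move. The growth factors `exp (ω
  -- x)` and `exp (ω (1 - x))` of the two stages multiply to `exp ω`.
  set S₁ : Finset J := Finset.univ.filter fun j => c j ≠ 0 with hS₁
  set q₁ : J → J → ℂ := fun j => M 0 (f j) with hq₁
  set S₂ : Finset J := Finset.univ.filter fun j => c j = 2 with hS₂
  set q₂ : J → J → ℂ := fun j => if c j = 0 then M 0 (f j) else M x (f j) with hq₂
  have hsum : ∀ (u : (J → J) → ℝ) (B : ℝ), (∀ σ, u σ ≤ B) → ∑ σ, u σ ≤ N * B := by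
    intro u B hB
    refine (Finset.sum_le_sum fun σ _ => hB σ).trans_eq ?_
    rw [Finset.sum_const, nsmul_eq_mul, Finset.card_univ, hN]
  have hinit : ∑ σ : J → J, Real.exp (-ω * 0) * ‖(mixedRows S₁ q₁ σ (M 0)).det‖ ≤ N * C₀ := by
    refine hsum _ _ fun σ => ?_
    rw [mul_zero, Real.exp_zero, one_mul]
    have : mixedRows S₁ q₁ σ (M 0) =
        fun j => (1 : Matrix J J ℂ) (if j ∈ S₁ then σ j else f j) := by
      funext j
      by_cases hj : j ∈ S₁
      · rw [mixedRows_of_mem _ _ _ hj, if_pos hj, hM0]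
      · rw [mixedRows_of_notMem _ _ _ hj, if_neg hj, ← hM0]
    rw [this]
    exact Finset.single_le_sum
      (f := fun g : J → J => ‖Matrix.det (fun j => (1 : Matrix J J ℂ) (g j))‖)
      (fun _ _ => norm_nonneg _) (Finset.mem_univ fun j => if j ∈ S₁ then σ j else f j)
  have h1 : ∑ σ : J → J, Real.exp (-ω * x) * ‖(mixedRows S₁ q₁ σ (M x)).det‖ ≤
      2 * (N * C₀) * E := by
    refine (sum_norm_mixedRows_det_le hP hM hω S₁ q₁ le_rfl hx).trans ?_
    gcongr
  have hmid : ∑ σ : J → J, Real.exp (-ω * x) * ‖(mixedRows S₂ q₂ σ (M x)).det‖ ≤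
      N * (2 * (N * C₀) * E) := by
    refine hsum _ _ fun σ => le_trans ?_ h1
    -- Every initial minor of the second stage is a final minor of the first, with the indices of
    -- the rows frozen at `x` already equal to `f`.
    have : mixedRows S₂ q₂ σ (M x) =
        mixedRows S₁ q₁ (fun j => if c j = 2 then σ j else f j) (M x) := by
      funext j
      by_cases h2 : c j = 2
      · have hj2 : j ∈ S₂ := by simp [hS₂, h2]
        have hj1 : j ∈ S₁ := by simp [hS₁, h2]
        rw [mixedRows_of_mem _ _ _ hj2, mixedRows_of_mem _ _ _ hj1, if_pos h2]
      · have hj2 : j ∉ S₂ := by simp [hS₂, h2]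
        rw [mixedRows_of_notMem _ _ _ hj2]
        by_cases h0 : c j = 0
        · have hj1 : j ∉ S₁ := by simp [hS₁, h0]
          rw [mixedRows_of_notMem _ _ _ hj1]
          simp only [hq₂, hq₁, if_pos h0]
        · have hj1 : j ∈ S₁ := by simp [hS₁, h0]
          rw [mixedRows_of_mem _ _ _ hj1]
          simp only [hq₂, if_neg h0, if_neg h2]
    rw [this]
    exact Finset.single_le_sum
      (f := fun σ : J → J => Real.exp (-ω * x) * ‖(mixedRows S₁ q₁ σ (M x)).det‖)
      (fun _ _ => by positivity) (Finset.mem_univ _)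
  have h2 := sum_norm_mixedRows_det_le hP hM hω S₂ q₂ hx.1 (x := 1) ⟨hx.2, le_rfl⟩
  have h3 : Real.exp (-ω * 1) * ‖(mixedRows S₂ q₂ f (M 1)).det‖ ≤
      2 * (N * (2 * (N * C₀) * E)) * E := by
    refine (Finset.single_le_sum
      (f := fun σ : J → J => Real.exp (-ω * 1) * ‖(mixedRows S₂ q₂ σ (M 1)).det‖)
      (fun _ _ => by positivity) (Finset.mem_univ f)).trans (h2.trans ?_)
    gcongr
  have h4 : mixedRows S₂ q₂ f (M 1) = fun j => M ((![0, x, 1] : Fin 3 → ℝ) (c j)) (f j) := by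
    funext j
    by_cases h2 : c j = 2
    · rw [mixedRows_of_mem _ _ _ (by simp [hS₂, h2]), h2]; rfl
    · rw [mixedRows_of_notMem _ _ _ (by simp [hS₂, h2])]
      by_cases h0 : c j = 0
      · simp only [hq₂, if_pos h0, h0]; rfl
      · have h1 : c j = 1 := by
          generalize c j = i at h2 h0; fin_cases i <;> simp_all
        simp only [hq₂, if_neg h0]
        rw [h1]; rfl
  rw [h4] at h3
  calc _ = Real.exp ω * (Real.exp (-ω * 1) *
        ‖Matrix.det (fun j => M ((![0, x, 1] : Fin 3 → ℝ) (c j)) (f j))‖) := by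
        rw [← mul_assoc, ← Real.exp_add]; simp
    _ ≤ Real.exp ω * (2 * (N * (2 * (N * C₀) * E)) * E) := by gcongr
    _ = _ := mul_comm _ _

/-- Multilinear expansion in all rows at once. -/
theorem norm_det_sum_smul_le {K : ℝ} {α : Type*} [Fintype α] (coef : J → α → ℂ) (ρ : α → J → ℂ)
    (h : ∀ r : J → α, ‖Matrix.det (fun j => ρ (r j))‖ ≤ K) :
    ‖Matrix.det (fun j => ∑ s, coef j s • ρ s)‖ ≤ (∑ r : J → α, ∏ j, ‖coef j (r j)‖) * K := by
  have h1 : Matrix.det (fun j => ∑ s, coef j s • ρ s) =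
      ∑ r : J → α, (∏ j, coef j (r j)) * Matrix.det (fun j => ρ (r j)) := by
    refine (Matrix.detRowAlternating.toMultilinearMap.map_sum fun j s => coef j s • ρ s).trans ?_
    exact Finset.sum_congr rfl fun r _ =>
      Matrix.detRowAlternating.toMultilinearMap.map_smul_univ (fun j => coef j (r j)) _
  rw [h1, Finset.sum_mul]
  refine (norm_sum_le _ _).trans (Finset.sum_le_sum fun r _ => ?_)
  rw [norm_mul, norm_prod]
  exact mul_le_mul_of_nonneg_left (h r) (Finset.prod_nonneg fun _ _ => norm_nonneg _)

end Determinants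

/-! ### Exponential type of entire quotients, by the Poisson integral -/

section QuotientGrowth

open Metric Filter Real InnerProductSpace

/-- For `u` inside the disc, `|z - u|` agrees on the circle with `|R² - ū z| / R`. The logarithm of
the latter is harmonic on the closed disc, hence equal to its Poisson integral, and it dominates
`log |w - u|` inside. For `u` on the circle there is equality. -/
theorem poisson_log_norm_sub {R : ℝ} {w u : ℂ} (hw : w ∈ ball (0 : ℂ) R)
    (hu : u ∈ closedBall (0 : ℂ) R) (hwu : w ≠ u) :
    Real.log ‖w - u‖ ≤
      circleAverage ((Complex.re ∘ herglotzRieszKernel 0 w) • fun z => Real.log ‖z - u‖) 0 R := by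
  rcases (mem_closedBall_zero_iff.1 hu).eq_or_lt with h | h
  · have := circleAverage_re_herglotzRieszKernel_mul_log (mem_sphere_zero_iff_norm.2 h) hw
    exact this.ge
  have hR : 0 < R := pos_of_mem_ball hw
  have hw' : ‖w‖ < R := mem_ball_zero_iff.1 hw
  set g : ℂ → ℂ := fun z => (R ^ 2 - (starRingEnd ℂ) u * z) / R with hg
  have hgne : ∀ z ∈ closedBall (0 : ℂ) R, g z ≠ 0 := by
    intro z hz h0
    have hRne : (R : ℂ) ≠ 0 := by exact_mod_cast hR.ne'
    rw [hg, div_eq_zero_iff, or_iff_left hRne, sub_eq_zero] at h0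
    have h1 := congrArg norm h0
    rw [norm_mul, RCLike.norm_conj, norm_pow, Complex.norm_real, Real.norm_of_nonneg hR.le] at h1
    have h2 := mem_closedBall_zero_iff.1 hz
    nlinarith [norm_nonneg z, norm_nonneg u]
  have hgA : ∀ z, AnalyticAt ℂ g z := fun z => by
    have : Differentiable ℂ g := by fun_prop
    exact this.analyticAt z
  have hharm : HarmonicOnNhd (fun z => Real.log ‖g z‖) (closedBall 0 R) := fun z hz =>
    (hgA z).harmonicAt_log_norm (hgne z hz)
  have h1 := hharm.circleAverage_re_herglotzRieszKernel_smul hw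
  have h2 : circleAverage ((Complex.re ∘ herglotzRieszKernel 0 w) • fun z => Real.log ‖z - u‖) 0 R
      = Real.log ‖g w‖ := by
    rw [← h1]
    refine circleAverage_congr_sphere fun z hz => ?_
    rw [abs_of_pos hR] at hz
    have h3 := Complex.norm_canonicalFactor_eval_circle_eq_one (mem_ball_zero_iff.2 h) hz
    have hzu : z - u ≠ 0 := by
      intro h0
      rw [sub_eq_zero] at h0
      rw [mem_sphere_zero_iff_norm, h0] at hz
      exact h.ne hz
    have h4 : ‖g z‖ = ‖z - u‖ := by
      rw [Complex.canonicalFactor, norm_div, norm_mul,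
        div_eq_one_iff_eq (by simp [hR.ne', norm_ne_zero_iff.2 hzu])] at h3
      rw [hg, norm_div, h3, mul_div_cancel_left₀ _ (by simp [hR.ne'])]
    simp only [Pi.smul_apply', h4]
  rw [h2]
  refine Real.log_le_log (norm_pos_iff.2 (sub_ne_zero.2 hwu)) ?_
  rw [hg, norm_div, Complex.norm_real, Real.norm_of_nonneg hR.le, le_div_iff₀ hR]
  refine le_of_sq_le_sq ?_ (norm_nonneg _)
  rw [mul_pow, ← Complex.normSq_eq_norm_sq, ← Complex.normSq_eq_norm_sq]
  have hu2 : u.re * u.re + u.im * u.im ≤ R ^ 2 := by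
    rw [← Complex.normSq_apply, Complex.normSq_eq_norm_sq]; gcongr
  have hw2 : w.re * w.re + w.im * w.im ≤ R ^ 2 := by
    rw [← Complex.normSq_apply, Complex.normSq_eq_norm_sq]; gcongr
  simp only [Complex.normSq_apply, sub_re, sub_im, mul_re, mul_im, conj_re, conj_im, ← ofReal_pow,
    ofReal_re, ofReal_im]
  -- This is `|R² - ū w|² - R² |w - u|² = (R² - |u|²)(R² - |w|²) ≥ 0`.
  nlinarith [mul_nonneg (sub_nonneg.2 hu2) (sub_nonneg.2 hw2)]

theorem circleIntegrable_kernel_smul_log {R : ℝ} {w : ℂ} (hw : w ∈ ball (0 : ℂ) R) {f : ℂ → ℝ}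
    (hf : CircleIntegrable f 0 R) :
    CircleIntegrable ((Complex.re ∘ herglotzRieszKernel 0 w) • f) 0 R :=
  hf.continuousOn_smul
    (Complex.continuous_re.comp_continuousOn (continuousOn_herglotzRieszKernel_sphere hw))

/-- The Poisson integral of `log |F|` dominates `log |F|` for analytic `F`. -/
theorem log_norm_le_circleAverage {R : ℝ} {w : ℂ} {F : ℂ → ℂ} (hF : Differentiable ℂ F)
    (hw : w ∈ ball (0 : ℂ) R) (hFw : F w ≠ 0) :
    Real.log ‖F w‖ ≤
      circleAverage ((Complex.re ∘ herglotzRieszKernel 0 w) • fun z => Real.log ‖F z‖) 0 R := by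
  have hR : 0 < R := pos_of_mem_ball hw
  have hwc : w ∈ closedBall (0 : ℂ) R := ball_subset_closedBall hw
  have hFA : AnalyticOnNhd ℂ F (closedBall 0 R) := fun z _ => hF.analyticAt z
  set D := MeromorphicOn.divisor F (closedBall (0 : ℂ) R) with hD
  have hDfin : D.support.Finite := D.finiteSupport (isCompact_closedBall 0 R)
  have hord : ∀ u : closedBall (0 : ℂ) R, meromorphicOrderAt F u ≠ ⊤ := by
    refine (hFA.meromorphicOn.exists_meromorphicOrderAt_ne_top_iff_forall
      ⟨⟨w, hwc⟩, (convex_closedBall (0 : ℂ) R).isPreconnected⟩).1 ⟨⟨w, hwc⟩, ?_⟩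
    have h1 : meromorphicOrderAt F w = 0 := by
      rw [(hF.analyticAt w).meromorphicOrderAt_eq,
        (hF.analyticAt w).analyticOrderAt_eq_zero.2 hFw]; rfl
    rw [h1]; simp
  -- Write `F` as a finite product of powers of `z - u` times a zero-free `g`. The Poisson formula
  -- is exact for `log |g|`, and `poisson_log_norm_sub` treats each zero, with nonnegative
  -- multiplicity.
  obtain ⟨g, hgA, hgne, hFg⟩ := hFA.meromorphicOn.extract_zeros_poles hord hDfin
  have hlog := MeromorphicOn.extract_zeros_poles_log hgne hFg
  have hacc : AccPt w (𝓟 (closedBall (0 : ℂ) R)) := by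
    refine accPt_iff_frequently_nhdsNE.mpr (compl_notMem ?_)
    exact mem_nhdsWithin_of_mem_nhds (mem_of_superset (isOpen_ball.mem_nhds hw)
      ball_subset_closedBall)
  have hval := MeromorphicOn.log_norm_meromorphicTrailingCoeffAt_extract_zeros_poles hDfin hwc hacc
    (hF.analyticAt w).meromorphicAt (hgA w hwc) (hgne ⟨w, hwc⟩) hFg
  rw [(hF.analyticAt w).meromorphicTrailingCoeffAt_of_ne_zero hFw] at hval
  have hDnn : ∀ u, 0 ≤ D u := fun u => MeromorphicOn.AnalyticOnNhd.divisor_nonneg hFA u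
  have hDw : D w = 0 := by
    rw [hD, MeromorphicOn.AnalyticOnNhd.divisor_apply hFA hwc,
      (hF.analyticAt w).analyticOrderAt_eq_zero.2 hFw]
    rfl
  have hsupp : ∀ u, D u ≠ 0 → u ∈ closedBall (0 : ℂ) R ∧ w ≠ u := fun u hu =>
    ⟨D.supportWithinDomain hu, by rintro rfl; exact hu hDw⟩
  set k : ℂ → ℝ := Complex.re ∘ herglotzRieszKernel 0 w with hk
  have hsum1 : ∑ᶠ u : ℂ, (D u : ℝ) * Real.log ‖w - u‖ =
      ∑ u ∈ hDfin.toFinset, (D u : ℝ) * Real.log ‖w - u‖ := by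
    refine finsum_eq_sum_of_support_subset _ fun u hu => ?_
    simp only [Function.mem_support] at hu
    have : D u ≠ 0 := fun h => hu (by simp [h])
    simpa using this
  have hsum2 : (∑ᶠ u : ℂ, fun z : ℂ => (D u : ℝ) * Real.log ‖z - u‖) =
      ∑ u ∈ hDfin.toFinset, fun z : ℂ => (D u : ℝ) * Real.log ‖z - u‖ := by
    refine finsum_eq_sum_of_support_subset _ fun u hu => ?_
    simp only [Function.mem_support] at hu
    have : D u ≠ 0 := fun h => hu (by ext z; simp [h])
    simpa using this
  have hintu : ∀ u : ℂ, CircleIntegrable (fun z => Real.log ‖z - u‖) 0 R := fun u =>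
    (analyticOnNhd_id.sub analyticOnNhd_const).meromorphicOn.circleIntegrable_log_norm
  have hintg : CircleIntegrable (fun z => Real.log ‖g z‖) 0 R := by
    refine MeromorphicOn.circleIntegrable_log_norm ?_
    rw [abs_of_pos hR]
    exact (hgA.mono sphere_subset_closedBall).meromorphicOn
  have hg : circleAverage (k • fun z => Real.log ‖g z‖) 0 R = Real.log ‖g w‖ :=
    HarmonicOnNhd.circleAverage_re_herglotzRieszKernel_smul
      (fun z hz => (hgA z hz).harmonicAt_log_norm (hgne ⟨z, hz⟩)) hw
  have hmain : circleAverage (k • fun z => Real.log ‖F z‖) 0 R =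
      ∑ u ∈ hDfin.toFinset, (D u : ℝ) * circleAverage (k • fun z => Real.log ‖z - u‖) 0 R +
        Real.log ‖g w‖ := by
    have h1 : circleAverage (k • fun z => Real.log ‖F z‖) 0 R = circleAverage
        ((∑ u ∈ hDfin.toFinset, fun z => (D u : ℝ) • (k • fun z => Real.log ‖z - u‖) z) +
          k • fun z => Real.log ‖g z‖) 0 R := by
      -- The logarithmic identity may fail at zeros on the circle, which the average does not see.
      refine circleAverage_congr_codiscreteWithin ?_ hR.ne'
      rw [abs_of_pos hR]
      filter_upwards [codiscreteWithin_mono sphere_subset_closedBall hlog] with z hz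
      simp only [Pi.smul_apply', Pi.add_apply, hz, Finset.sum_apply, smul_eq_mul, mul_add]
      rw [← hD, hsum2, Finset.sum_apply, Finset.mul_sum]
      congr 1
      exact Finset.sum_congr rfl fun u _ => by ring
    rw [h1, circleAverage_add, circleAverage_sum, hg]
    · congr 1
      exact Finset.sum_congr rfl fun u _ => circleAverage_fun_smul
    · exact fun u _ => (circleIntegrable_kernel_smul_log hw (hintu u)).const_smul
    · exact CircleIntegrable.sum _ fun u _ =>
        (circleIntegrable_kernel_smul_log hw (hintu u)).const_smul
    · exact circleIntegrable_kernel_smul_log hw hintg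
  rw [hval, hsum1, hmain]
  gcongr with u hu
  · exact_mod_cast hDnn u
  · have hu' : D u ≠ 0 := by simpa using hu
    exact poisson_log_norm_sub hw (hsupp u hu').1 (hsupp u hu').2

/-- On the circle `log |F| = log |Δ F| - log |Δ| ≤ log M - log |Δ|`, and the right side is
nonnegative, so the Poisson kernel may be replaced by its maximum. The mean of `log |Δ|` is then
bounded below by Jensen's inequality, and no pointwise lower bound for `Δ` is required. -/
theorem log_norm_quotient_le {F Δ : ℂ → ℂ} (hF : Differentiable ℂ F) (hΔ : Differentiable ℂ Δ)
    {R M : ℝ} (hR : 0 < R) (hM : 1 ≤ M) (h0 : Δ 0 ≠ 0) (hΔM : ∀ z, ‖z‖ = R → ‖Δ z‖ ≤ M)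
    (hG : ∀ z, ‖z‖ = R → ‖Δ z * F z‖ ≤ M) {w : ℂ} (hw : ‖w‖ ≤ R / 2) (hFw : F w ≠ 0) :
    Real.log ‖F w‖ ≤ 3 * (Real.log M - Real.log ‖Δ 0‖) := by
  have hwb : w ∈ ball (0 : ℂ) R := mem_ball_zero_iff.2 (by linarith)
  set k : ℂ → ℝ := Complex.re ∘ herglotzRieszKernel 0 w with hk
  have hcirc : ∀ {f : ℂ → ℂ}, Differentiable ℂ f →
      CircleIntegrable (fun z => Real.log ‖f z‖) 0 R := fun hf =>
    MeromorphicOn.circleIntegrable_log_norm fun z _ => (hf.analyticAt z).meromorphicAt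
  have hJ : Real.log ‖Δ 0‖ ≤ circleAverage (fun z => Real.log ‖Δ z‖) 0 R := by
    have h1 := log_norm_le_circleAverage hΔ (mem_ball_self hR) h0
    refine h1.trans_eq (circleAverage_congr_sphere fun z hz => ?_)
    have hz0 : z ≠ 0 := by
      rintro rfl
      simp only [mem_sphere_iff_norm, sub_self, norm_zero] at hz
      exact hR.ne' (abs_eq_zero.1 hz.symm)
    -- At the centre the Poisson kernel is `1`, so the Poisson inequality becomes Jensen's.
    simp [herglotzRieszKernel_def, hz0]
  have hcod : ∀ {f : ℂ → ℂ} {x : ℂ}, Differentiable ℂ f → f x ≠ 0 →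
      ∀ᶠ z in codiscreteWithin (sphere (0 : ℂ) |R|), f z ≠ 0 := fun {f x} hf hx =>
    codiscreteWithin_mono (subset_univ _)
      (AnalyticOnNhd.preimage_zero_mem_codiscrete (x := x) (fun z _ => hf.analyticAt z) hx)
  have h1 : circleAverage (k • fun z => Real.log ‖F z‖) 0 R =
      circleAverage (k • fun z => Real.log ‖Δ z * F z‖ - Real.log ‖Δ z‖) 0 R := by
    refine circleAverage_congr_codiscreteWithin ?_ hR.ne'
    filter_upwards [hcod hF hFw, hcod hΔ h0] with z h1 h2
    simp only [Pi.smul_apply', norm_mul]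
    rw [Real.log_mul (norm_ne_zero_iff.2 h2) (norm_ne_zero_iff.2 h1)]
    ring_nf
  refine (log_norm_le_circleAverage hF hwb hFw).trans ?_
  rw [h1]
  have hlogM : 0 ≤ Real.log M := Real.log_nonneg hM
  have hlogle : ∀ {x : ℂ}, ‖x‖ ≤ M → Real.log ‖x‖ ≤ Real.log M := by
    intro x hx
    rcases eq_or_ne x 0 with rfl | hx0
    · simpa using hlogM
    · exact Real.log_le_log (norm_pos_iff.2 hx0) hx
  have hconst : CircleIntegrable (fun _ : ℂ => Real.log M) 0 R := circleIntegrable_const _ _ _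
  calc circleAverage (k • fun z => Real.log ‖Δ z * F z‖ - Real.log ‖Δ z‖) 0 R
      ≤ circleAverage (fun z => (3 : ℝ) • (Real.log M - Real.log ‖Δ z‖)) 0 R := by
        refine circleAverage_mono ?_ ?_ fun z hz => ?_
        · exact circleIntegrable_kernel_smul_log hwb ((hcirc (hΔ.mul hF)).sub (hcirc hΔ))
        · exact (hconst.sub (hcirc hΔ)).const_smul
        · rw [abs_of_pos hR] at hz
          have hzR : ‖z‖ = R := mem_sphere_zero_iff_norm.1 hz
          have hk0 : 0 ≤ k z := by
            refine le_trans ?_ (le_re_herglotzRieszKernel hz hwb)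
            simp only [sub_zero]
            exact div_nonneg (by linarith [norm_nonneg w]) (by linarith [norm_nonneg w])
          -- For `|w| ≤ R/2` the kernel is at most `(R + R/2) / (R - R/2) = 3`.
          have hk3 : k z ≤ 3 := by
            refine (re_herglotzRieszKernel_le hz hwb).trans ?_
            simp only [sub_zero]
            rw [div_le_iff₀ (by linarith)]
            linarith
          have h3 := hlogle (hΔM z hzR)
          have h4 := hlogle (hG z hzR)
          simp only [Pi.smul_apply', smul_eq_mul]
          calc k z * (Real.log ‖Δ z * F z‖ - Real.log ‖Δ z‖)
              ≤ k z * (Real.log M - Real.log ‖Δ z‖) := by gcongr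
            _ ≤ 3 * (Real.log M - Real.log ‖Δ z‖) := by
                gcongr
    _ = 3 * (Real.log M - circleAverage (fun z => Real.log ‖Δ z‖) 0 R) := by
        rw [circleAverage_fun_smul, smul_eq_mul]
        have := circleAverage_sub hconst (hcirc hΔ)
        rw [circleAverage_const] at this
        rw [← this]; rfl
    _ ≤ _ := by gcongr

/-- An entire quotient of entire functions of exponential type is of exponential type. -/
theorem exists_exp_bound_of_mul {F Δ : ℂ → ℂ} (hF : Differentiable ℂ F) (hΔ : Differentiable ℂ Δ)
    {c : ℂ} (hc : Δ c ≠ 0) {A B : ℝ} (hA : 0 ≤ A) (hB : 0 ≤ B)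
    (hΔM : ∀ z, ‖Δ z‖ ≤ Real.exp (A * ‖z‖ + B))
    (hG : ∀ z, ‖Δ z * F z‖ ≤ Real.exp (A * ‖z‖ + B)) :
    ∃ A' B', 0 ≤ A' ∧ ∀ z, ‖F z‖ ≤ Real.exp (A' * ‖z‖ + B') := by
  -- The quotient estimate is applied around `c` on the circle of radius `R = 2 (‖z - c‖ + 1) ≤ 2‖z‖
  -- + 2‖c‖ + 2` with `log M = A (R + ‖c‖) + B`; three times the difference to `log ‖Δ c‖` gives
  -- these constants.
  refine ⟨6 * A, 3 * (A * (3 * ‖c‖ + 2) + B - Real.log ‖Δ c‖), by positivity, fun z => ?_⟩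
  rcases eq_or_ne (F z) 0 with hz | hz
  · rw [hz, norm_zero]; exact (Real.exp_pos _).le
  set R := 2 * (‖z - c‖ + 1) with hRdef
  have hR : 0 < R := by positivity
  have hM : 1 ≤ Real.exp (A * (R + ‖c‖) + B) := Real.one_le_exp (by positivity)
  have hle : ∀ w : ℂ, ‖w‖ = R → A * ‖w + c‖ + B ≤ A * (R + ‖c‖) + B := fun w hw => by
    gcongr; rw [← hw]; exact norm_add_le _ _
  have h := log_norm_quotient_le (F := fun w => F (w + c)) (Δ := fun w => Δ (w + c))
    (hF.comp (differentiable_id.add_const c)) (hΔ.comp (differentiable_id.add_const c)) hR hM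
    (by simpa using hc) (fun w hw => (hΔM _).trans (Real.exp_le_exp.2 (hle w hw)))
    (fun w hw => (hG _).trans (Real.exp_le_exp.2 (hle w hw))) (w := z - c)
    (by rw [hRdef]; linarith) (by simpa using hz)
  simp only [sub_add_cancel, zero_add, Real.log_exp] at h
  rw [← Real.exp_log (norm_pos_iff.2 hz)]
  refine Real.exp_le_exp.2 (h.trans ?_)
  have h5 : R ≤ 2 * ‖z‖ + 2 * ‖c‖ + 2 := by
    rw [hRdef]; linarith [norm_sub_le z c]
  nlinarith

end QuotientGrowth

/-! ### Phragmén–Lindelöf in three sectors -/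

section Rays

open Filter Asymptotics

theorem arg_nonneg_combination_le {w : ℂ} (hw : 0 < w.im) {α β : ℝ} (hα : 0 ≤ α) (hβ : 0 ≤ β)
    (hv : (α : ℂ) + β * w ≠ 0) :
    0 ≤ arg (α + β * w) ∧ arg (α + β * w) ≤ arg w := by
  set v : ℂ := α + β * w with hvdef
  have hvim : 0 ≤ v.im := by simp [hvdef]; positivity
  have hv0 : 0 ≤ arg v := arg_nonneg_iff.2 hvim
  refine ⟨hv0, ?_⟩
  by_contra! hlt
  have hw0 : w ≠ 0 := by rintro rfl; simp at hw
  have hw1 : 0 ≤ arg w := arg_nonneg_iff.2 hw.le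
  have hw2 : arg w ≠ 0 := fun h => by
    rw [arg_eq_zero_iff] at h
    exact hw.ne' h.2
  have hw3 : 0 < arg w := lt_of_le_of_ne hw1 hw2.symm
  have hpos : 0 < Real.sin (arg v - arg w) :=
    Real.sin_pos_of_pos_of_lt_pi (by linarith) (by linarith [arg_le_pi v])
  -- The sign of the sine is that of the cross product, which here is `-α Im w ≤ 0`; both arguments
  -- lie in `[0, π]`.
  have h1 : ‖v‖ * ‖w‖ * Real.sin (arg v - arg w) = v.im * w.re - v.re * w.im := by
    rw [Real.sin_sub]
    calc _ = (‖v‖ * Real.sin (arg v)) * (‖w‖ * Real.cos (arg w)) -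
          (‖v‖ * Real.cos (arg v)) * (‖w‖ * Real.sin (arg w)) := by ring
      _ = _ := by
        rw [norm_mul_cos_arg v, norm_mul_sin_arg v, norm_mul_cos_arg w, norm_mul_sin_arg w]
  have h2 : v.im * w.re - v.re * w.im = -(α * w.im) := by simp [hvdef]; ring
  have h3 : 0 < ‖v‖ * ‖w‖ * Real.sin (arg v - arg w) :=
    mul_pos (mul_pos (norm_pos_iff.2 hv) (norm_pos_iff.2 hw0)) hpos
  have h4 : 0 ≤ α * w.im := mul_nonneg hα hw.le
  linarith

/-- Phragmén–Lindelöf principle in a sector of opening less than `π`. -/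
theorem norm_le_on_cone_of_im_pos {F : ℂ → ℂ} (hF : Differentiable ℂ F) {A B C : ℝ} (hA : 0 ≤ A)
    (hexp : ∀ z, ‖F z‖ ≤ Real.exp (A * ‖z‖ + B)) {p q : ℂ} (hp : p ≠ 0) (hpq : 0 < (q / p).im)
    (h1 : ∀ r : ℝ, 0 ≤ r → ‖F (r * p)‖ ≤ C) (h2 : ∀ r : ℝ, 0 ≤ r → ‖F (r * q)‖ ≤ C)
    {α β : ℝ} (hα : 0 ≤ α) (hβ : 0 ≤ β) : ‖F (α * p + β * q)‖ ≤ C := by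
  set w := q / p with hw
  have hq : q = w * p := by rw [hw, div_mul_cancel₀ _ hp]
  have hw0 : w ≠ 0 := by intro h; rw [h] at hpq; simp at hpq
  have hval : α * p + β * q = p * (α + β * w) := by rw [hq]; ring
  by_cases hv : (α : ℂ) + β * w = 0
  · rw [hval, hv, mul_zero]; simpa using h1 0 le_rfl
  obtain ⟨ha0, ha1⟩ := arg_nonneg_combination_le hpq hα hβ hv
  set θ := arg w with hθ
  have hθ0 : 0 < θ := by
    refine lt_of_le_of_ne (arg_nonneg_iff.2 hpq.le) fun h => ?_
    exact hpq.ne' (arg_eq_zero_iff.1 h.symm).2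
  have hθπ : θ < Real.pi := by
    refine lt_of_le_of_ne (arg_le_pi w) fun h => ?_
    exact hpq.ne' (arg_eq_pi_iff.1 h).2
  -- The substitution `p exp ζ` maps the strip `0 ≤ Im ζ ≤ θ` to the sector. Exponential type
  -- becomes growth `exp (A ‖p‖ exp |Re ζ|)`, which is admissible because `1 < π / θ`.
  have hpl := PhragmenLindelof.horizontal_strip (f := fun ζ => F (p * Complex.exp ζ))
    (a := 0) (b := θ) (C := C) (z := Complex.log (α + β * w))
    (Differentiable.diffContOnCl
      (hF.comp ((differentiable_const p).mul Complex.differentiable_exp))) ?_ ?_ ?_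
    (by rw [log_im]; exact ha0) (by rw [log_im]; exact ha1)
  · rwa [Complex.exp_log hv, ← hval] at hpl
  · refine ⟨1, ?_, A * ‖p‖, ?_⟩
    · rw [sub_zero, lt_div_iff₀ hθ0]; linarith
    · refine IsBigO.of_bound (Real.exp B) (Eventually.of_forall fun ζ => ?_)
      rw [Real.norm_of_nonneg (Real.exp_pos _).le, ← Real.exp_add]
      refine (hexp _).trans (Real.exp_le_exp.2 ?_)
      rw [norm_mul, Complex.norm_exp, one_mul, add_comm, mul_assoc]
      gcongr
      exact le_abs_self _
  · intro ζ hζ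
    have : Complex.exp ζ = (Real.exp ζ.re : ℝ) := by
      conv_lhs => rw [← re_add_im ζ, hζ]
      simp
    simp only [this, mul_comm p]
    exact h1 _ (Real.exp_pos _).le
  · intro ζ hζ
    have : p * Complex.exp ζ = ((Real.exp ζ.re / ‖w‖ : ℝ) : ℂ) * q := by
      conv_lhs => rw [← re_add_im ζ, hζ, Complex.exp_add]
      have h3 : (‖w‖ : ℂ) * Complex.exp (θ * I) = w := norm_mul_exp_arg_mul_I w
      have h4 : (‖w‖ : ℂ) ≠ 0 := ofReal_ne_zero.2 (norm_ne_zero_iff.2 hw0)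
      calc _ = Complex.exp ζ.re / ‖w‖ * ((‖w‖ : ℂ) * Complex.exp (θ * I) * p) := by field_simp
        _ = _ := by rw [h3, hq]; push_cast; rfl
    simp only [this]
    exact h2 _ (div_nonneg (Real.exp_pos _).le (norm_nonneg _))

theorem im_div_eq (p q : ℂ) : (q / p).im = ((starRingEnd ℂ) p * q).im / normSq p := by
  rw [div_eq_mul_inv, Complex.inv_def, ← mul_assoc, mul_comm q, im_mul_ofReal, div_eq_mul_inv]

theorem norm_le_on_cone {F : ℂ → ℂ} (hF : Differentiable ℂ F) {A B C : ℝ} (hA : 0 ≤ A)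
    (hexp : ∀ z, ‖F z‖ ≤ Real.exp (A * ‖z‖ + B)) {p q : ℂ} (hpq : ((starRingEnd ℂ) p * q).im ≠ 0)
    (h1 : ∀ r : ℝ, 0 ≤ r → ‖F (r * p)‖ ≤ C) (h2 : ∀ r : ℝ, 0 ≤ r → ‖F (r * q)‖ ≤ C)
    {α β : ℝ} (hα : 0 ≤ α) (hβ : 0 ≤ β) : ‖F (α * p + β * q)‖ ≤ C := by
  have hp : p ≠ 0 := by rintro rfl; simp at hpq
  have hq : q ≠ 0 := by rintro rfl; simp at hpq
  rcases lt_or_gt_of_ne hpq with h | h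
  · rw [add_comm]
    refine norm_le_on_cone_of_im_pos hF hA hexp hq ?_ h2 h1 hβ hα
    rw [im_div_eq]
    refine div_pos ?_ (normSq_pos.2 hq)
    simp only [mul_im, conj_re, conj_im] at h ⊢
    linarith
  · refine norm_le_on_cone_of_im_pos hF hA hexp hp ?_ h1 h2 hα hβ
    rw [im_div_eq]
    exact div_pos h (normSq_pos.2 hp)

/-- If `p` and `q` were on one real line through `0`, the relation with `t₃ ≠ 0` would put `r` there
too, against `hs`, which says that no line through `0` contains all three. -/
theorem cross_ne_zero {p q r : ℂ} {t₁ t₂ t₃ : ℝ} (h₃ : 0 < t₃)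
    (h : (t₁ : ℂ) * p + t₂ * q + t₃ * r = 0)
    (hs : ∀ d : ℂ, d ≠ 0 → ((starRingEnd ℂ) d * p).im ≠ 0 ∨ ((starRingEnd ℂ) d * q).im ≠ 0 ∨
      ((starRingEnd ℂ) d * r).im ≠ 0) :
    ((starRingEnd ℂ) p * q).im ≠ 0 := by
  intro h0
  have hlin : ∀ d : ℂ, t₁ * ((starRingEnd ℂ) d * p).im + t₂ * ((starRingEnd ℂ) d * q).im +
      t₃ * ((starRingEnd ℂ) d * r).im = 0 := by
    intro d
    have h1 := congrArg (fun x => ((starRingEnd ℂ) d * x).im) h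
    simp only [mul_zero, zero_im] at h1
    rw [← h1]
    simp only [mul_im, mul_re, add_re, add_im, ofReal_re, ofReal_im]
    ring
  have hself : ∀ d : ℂ, ((starRingEnd ℂ) d * d).im = 0 := fun d => by
    simp only [mul_im, conj_re, conj_im]; ring
  have hkey : ∀ d : ℂ, d ≠ 0 → ((starRingEnd ℂ) d * p).im = 0 →
      ((starRingEnd ℂ) d * q).im = 0 → False := by
    intro d hd hp hq
    have h2 := hlin d
    rw [hp, hq, mul_zero, mul_zero, zero_add, zero_add] at h2
    rcases hs d hd with h3 | h3 | h3
    · exact h3 hp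
    · exact h3 hq
    · exact h3 ((mul_eq_zero.1 h2).resolve_left h₃.ne')
  by_cases hp : p = 0
  · by_cases hq : q = 0
    · exact hkey 1 one_ne_zero (by simp [hp]) (by simp [hq])
    · exact hkey q hq (by simp [hp]) (hself q)
  · exact hkey p hp (hself p) h0

/-- Phragmén–Lindelöf principle for three rays that positively span the plane. -/
theorem norm_le_of_three_rays {z : Fin 3 → ℂ} (htri : (0 : ℂ) ∈ interior (convexHull ℝ (range z)))
    {F : ℂ → ℂ} (hF : Differentiable ℂ F) {A B C : ℝ} (hA : 0 ≤ A)
    (hexp : ∀ z, ‖F z‖ ≤ Real.exp (A * ‖z‖ + B))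
    (h : ∀ k, ∀ r : ℝ, 0 ≤ r → ‖F (r * z k)‖ ≤ C) (x : ℂ) : ‖F x‖ ≤ C := by
  have htop : affineSpan ℝ (range z) = ⊤ :=
    interior_convexHull_nonempty_iff_affineSpan_eq_top.1 ⟨0, htri⟩
  have hind : AffineIndependent ℝ z := by
    rw [affineIndependent_iff_finrank_vectorSpan_eq ℝ z (n := 2) (by simp),
      ← direction_affineSpan, htop, AffineSubspace.direction_top, finrank_top]
    exact Complex.finrank_real_complex
  let b : AffineBasis (Fin 3) ℝ ℂ := ⟨z, hind, htop⟩
  have ht : ∀ i, 0 < b.coord i 0 := by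
    have h1 := b.interior_convexHull
    have h2 : (0 : ℂ) ∈ interior (convexHull ℝ (range b)) := htri
    rw [h1] at h2
    exact h2
  have hcomb : ∀ y : ℂ, (b.coord 0 y : ℂ) * z 0 + b.coord 1 y * z 1 + b.coord 2 y * z 2 = y := by
    intro y
    have h1 := b.linear_combination_coord_eq_self y
    rw [Fin.sum_univ_three] at h1
    simp only [real_smul] at h1
    exact h1
  have hs : ∀ d : ℂ, d ≠ 0 → ((starRingEnd ℂ) d * z 0).im ≠ 0 ∨
      ((starRingEnd ℂ) d * z 1).im ≠ 0 ∨ ((starRingEnd ℂ) d * z 2).im ≠ 0 := by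
    intro d hd
    by_contra! hcon
    obtain ⟨h0, h1, h2⟩ := hcon
    -- If all three points lay on the line `ℝ d`, so would every combination of them, but `d * I`
    -- does not.
    have h3 := congrArg (fun x => ((starRingEnd ℂ) d * x).im) (hcomb (d * I))
    have h4 : ((starRingEnd ℂ) d * (d * I)).im = normSq d := by
      rw [← mul_assoc, mul_comm _ d, mul_conj]; simp
    have h5 : ((starRingEnd ℂ) d * ((b.coord 0 (d * I) : ℂ) * z 0 + b.coord 1 (d * I) * z 1 +
        b.coord 2 (d * I) * z 2)).im = b.coord 0 (d * I) * ((starRingEnd ℂ) d * z 0).im +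
        b.coord 1 (d * I) * ((starRingEnd ℂ) d * z 1).im +
        b.coord 2 (d * I) * ((starRingEnd ℂ) d * z 2).im := by
      generalize b.coord 0 (d * I) = c0
      generalize b.coord 1 (d * I) = c1
      generalize b.coord 2 (d * I) = c2
      simp only [mul_im, mul_re, add_re, add_im, ofReal_re, ofReal_im]
      ring
    rw [h4, h5, h0, h1, h2] at h3
    simp only [mul_zero, add_zero] at h3
    exact hd (normSq_eq_zero.1 h3.symm)
  set t : Fin 3 → ℝ := fun i => b.coord i 0 with htdef
  set c : Fin 3 → ℝ := fun i => b.coord i x with hcdef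
  have hzero : (t 0 : ℂ) * z 0 + t 1 * z 1 + t 2 * z 2 = 0 := hcomb 0
  have hx : (c 0 : ℂ) * z 0 + c 1 * z 1 + c 2 * z 2 = x := hcomb x
  have h01 : ((starRingEnd ℂ) (z 0) * z 1).im ≠ 0 := cross_ne_zero (ht 2) hzero hs
  have h12 : ((starRingEnd ℂ) (z 1) * z 2).im ≠ 0 :=
    cross_ne_zero (r := z 0) (t₁ := t 1) (t₂ := t 2) (ht 0) (by linear_combination hzero)
      fun d hd => by have := hs d hd; tauto
  have h02 : ((starRingEnd ℂ) (z 0) * z 2).im ≠ 0 :=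
    cross_ne_zero (r := z 1) (t₁ := t 0) (t₂ := t 2) (ht 1) (by linear_combination hzero)
      fun d hd => by have := hs d hd; tauto
  -- Subtracting the smallest ratio `c i / t i` times the relation `∑ t_j z_j = 0` kills the
  -- coefficient at `i` and keeps the others nonnegative, which places `x` in one of the three
  -- cones.
  obtain ⟨i, -, hi⟩ := Finset.exists_min_image Finset.univ (fun i => c i / t i)
    ⟨0, Finset.mem_univ 0⟩
  have hnn : ∀ j, 0 ≤ c j - c i / t i * t j := fun j => by
    have := hi j (Finset.mem_univ j)
    rw [le_div_iff₀ (ht j)] at this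
    linarith
  have hi0 : c i - c i / t i * t i = 0 := by rw [div_mul_cancel₀ _ (ht i).ne', sub_self]
  have hx' : ((c 0 - c i / t i * t 0 : ℝ) : ℂ) * z 0 + ((c 1 - c i / t i * t 1 : ℝ) : ℂ) * z 1 +
      ((c 2 - c i / t i * t 2 : ℝ) : ℂ) * z 2 = x := by
    calc _ = ((c 0 : ℂ) * z 0 + c 1 * z 1 + c 2 * z 2) -
          ((c i / t i : ℝ) : ℂ) * ((t 0 : ℂ) * z 0 + t 1 * z 1 + t 2 * z 2) := by push_cast; ring
      _ = x := by rw [hx, hzero, mul_zero, sub_zero]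
  rw [← hx']
  fin_cases i
  · simp only [Fin.zero_eta] at hi0 hnn ⊢
    rw [hi0, ofReal_zero, zero_mul, zero_add]
    exact norm_le_on_cone hF hA hexp h12 (h 1) (h 2) (hnn 1) (hnn 2)
  · simp only [Fin.mk_one] at hi0 hnn ⊢
    rw [hi0, ofReal_zero, zero_mul, add_zero]
    exact norm_le_on_cone hF hA hexp h02 (h 0) (h 2) (hnn 0) (hnn 2)
  · simp only [Fin.reduceFinMk] at hi0 hnn ⊢
    rw [hi0, ofReal_zero, zero_mul, add_zero]
    exact norm_le_on_cone hF hA hexp h01 (h 0) (h 1) (hnn 0) (hnn 1)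

end Rays

/-! ### Entire quotients from local factorizations -/

section EntireQuotient

open Filter Topology

theorem eq_of_eventuallyEq_nhdsNE {E : Type*} [TopologicalSpace E] [T2Space E] {f g : ℂ → E}
    {μ : ℂ} (hf : ContinuousAt f μ) (hg : ContinuousAt g μ) (h : f =ᶠ[𝓝[≠] μ] g) : f μ = g μ :=
  tendsto_nhds_unique ((hf.tendsto.mono_left nhdsWithin_le_nhds).congr' h)
    (hg.tendsto.mono_left nhdsWithin_le_nhds)

theorem eventually_ne_zero_of_entire {Δ : ℂ → ℂ} (hΔ : Differentiable ℂ Δ) {ν : ℂ}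
    (hν : Δ ν ≠ 0) (μ : ℂ) : ∀ᶠ x in 𝓝[≠] μ, Δ x ≠ 0 := by
  by_contra hcon
  simp only [not_eventually, not_not] at hcon
  have h := AnalyticOnNhd.eq_of_frequently_eq (f := Δ) (g := fun _ => 0) (z₀ := μ)
    (fun x _ => hΔ.analyticAt x) (fun x _ => analyticAt_const) hcon
  exact hν (congrFun h ν)

theorem exists_entire_quotient {G Δ : ℂ → ℂ} (hG : Differentiable ℂ G) (hΔ : Differentiable ℂ Δ)
    {ν : ℂ} (hν : Δ ν ≠ 0)
    (h : ∀ μ, ∃ u : ℂ → ℂ, AnalyticAt ℂ u μ ∧ ∀ᶠ x in 𝓝[≠] μ, G x = Δ x * u x) :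
    ∃ F : ℂ → ℂ, Differentiable ℂ F ∧ ∀ x, Δ x * F x = G x := by
  have hmer : MeromorphicOn (fun x => G x / Δ x) univ := fun x _ =>
    (hG.analyticAt x).meromorphicAt.div (hΔ.analyticAt x).meromorphicAt
  -- Pointwise division gives the value `0` at zeros of `Δ`; the normal form repairs these points,
  -- whose singularities are removable because of `u`.
  have heq := fun x => hmer.toMeromorphicNFOn_eq_self_on_nhdsNE (mem_univ x)
  have hdiff : Differentiable ℂ (toMeromorphicNFOn (fun x => G x / Δ x) univ) := by
    intro x
    obtain ⟨u, hu, hux⟩ := h x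
    refine AnalyticAt.differentiableAt ?_
    rw [← (meromorphicNFOn_toMeromorphicNFOn _ univ
      (mem_univ x)).meromorphicOrderAt_nonneg_iff_analyticAt, meromorphicOrderAt_congr (heq x),
      meromorphicOrderAt_congr (f₂ := u)]
    · exact hu.meromorphicOrderAt_nonneg
    · filter_upwards [hux, eventually_ne_zero_of_entire hΔ hν x] with y h1 h2
      rw [h1, mul_div_cancel_left₀ _ h2]
  refine ⟨_, hdiff, fun x => ?_⟩
  refine eq_of_eventuallyEq_nhdsNE (f := fun x => Δ x * _) (hΔ.continuous.mul
    hdiff.continuous).continuousAt hG.continuous.continuousAt ?_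
  filter_upwards [heq x, eventually_ne_zero_of_entire hΔ hν x] with y h1 h2
  rw [h1, mul_div_cancel₀ _ h2]

end EntireQuotient

/-! ### Operators whose resolvent is a quotient of entire functions -/

section CharacteristicPair

open Filter Topology

variable {H : Type*} [NormedAddCommGroup H] [InnerProductSpace ℂ H]

/-- `Δ` and `N` are entire, and `(T - μ)⁻¹ = Δ(μ)⁻¹ N(μ)` wherever `Δ(μ) ≠ 0`. -/
structure IsCharacteristicPair (T : H →ₗ.[ℂ] H) (Δ : ℂ → ℂ) (N : ℂ → H →L[ℂ] H) : Prop where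
  differentiable_det : Differentiable ℂ Δ
  differentiable_num : Differentiable ℂ N
  mem_graph : ∀ μ g, (N μ g, Δ μ • g + μ • N μ g) ∈ T.graph
  num_apply : ∀ μ y w, (y, w) ∈ T.graph → N μ (w - μ • y) = Δ μ • y

theorem mem_kerPow_succ {T : H →ₗ.[ℂ] H} {μ : ℂ} {k : ℕ} {y : H} :
    y ∈ kerPow T μ (k + 1) ↔ ∃ v ∈ kerPow T μ k, (y, v + μ • y) ∈ T.graph := by
  simp only [kerPow, Submodule.mem_map, Submodule.mem_comap, LinearPMap.mem_graph_iff]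
  constructor
  · rintro ⟨x, hx, rfl⟩
    exact ⟨_, hx, x, rfl, by simp⟩
  · rintro ⟨v, hv, x, hx, hTx⟩
    refine ⟨x, ?_, hx⟩
    have : (T.toFun - μ • T.domain.subtype) x = v := by
      change T x - μ • (x : H) = v
      rw [hTx, hx, add_sub_cancel_right]
    rwa [this]

theorem kerPow_le_succ (T : H →ₗ.[ℂ] H) (μ : ℂ) (k : ℕ) : kerPow T μ k ≤ kerPow T μ (k + 1) := by
  induction k with
  | zero => exact bot_le
  | succ k ih =>
    intro y hy
    obtain ⟨v, hv, h⟩ := mem_kerPow_succ.1 hy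
    exact mem_kerPow_succ.2 ⟨v, ih hv, h⟩

theorem monotone_kerPow (T : H →ₗ.[ℂ] H) (μ : ℂ) : Monotone (kerPow T μ) :=
  monotone_nat_of_le_succ (kerPow_le_succ T μ)

theorem mem_rootSubspace {T : H →ₗ.[ℂ] H} {μ : ℂ} {y : H} :
    y ∈ rootSubspace T μ ↔ ∃ k, y ∈ kerPow T μ k :=
  Submodule.mem_iSup_of_directed _ (monotone_kerPow T μ).directed_le

namespace IsCharacteristicPair

variable {T : H →ₗ.[ℂ] H} {Δ : ℂ → ℂ} {N : ℂ → H →L[ℂ] H}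

theorem mem_graph_iff (h : IsCharacteristicPair T Δ N) {ν : ℂ} (hν : Δ ν ≠ 0) {y w : H} :
    (y, w) ∈ T.graph ↔ N ν (w - ν • y) = Δ ν • y := by
  refine ⟨h.num_apply ν y w, fun hy => ?_⟩
  have h1 := T.graph.smul_mem (Δ ν)⁻¹ (h.mem_graph ν (w - ν • y))
  rw [hy] at h1
  have h2 : (Δ ν)⁻¹ • (Δ ν • y, Δ ν • (w - ν • y) + ν • Δ ν • y) = (y, w) := by
    rw [smul_comm ν, ← smul_add, sub_add_cancel, Prod.smul_mk, inv_smul_smul₀ hν,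
      inv_smul_smul₀ hν]
  rwa [h2] at h1

/-- At a point where `Δ ν ≠ 0` the graph is the solution set of an equation between continuous maps.
-/
theorem isClosed_graph (h : IsCharacteristicPair T Δ N) {ν : ℂ} (hν : Δ ν ≠ 0) :
    IsClosed (T.graph : Set (H × H)) := by
  have : (T.graph : Set (H × H)) = {p | N ν (p.2 - ν • p.1) = Δ ν • p.1} := by
    ext ⟨y, w⟩
    exact h.mem_graph_iff hν
  rw [this]
  exact isClosed_eq (by fun_prop) (by fun_prop)

/-- The hypothesis reads `(T - x) n(x) = v + (x - μ)^k r(x) g`. If `k > 0`, letting `x → μ` shows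
that `n μ` is a root vector of height `j + 1`, so `φ` kills it. The difference quotient of `n`
satisfies the same relation with `v` replaced by `n μ` and `k` lowered by one. Hence the first `k`
Taylor coefficients of `n` form a chain of root vectors. -/
theorem exists_factor (hcl : IsClosed (T.graph : Set (H × H))) (φ : H →L[ℂ] ℂ) {μ : ℂ}
    (hφ : ∀ j, ∀ y ∈ kerPow T μ j, φ y = 0) (g : H) {r : ℂ → ℂ} (hr : ContinuousAt r μ) (k : ℕ) :
    ∀ (n : ℂ → H) (v : H) (j : ℕ), v ∈ kerPow T μ j → AnalyticAt ℂ n μ →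
      (∀ᶠ x in 𝓝[≠] μ, (n x, x • n x + v + ((x - μ) ^ k * r x) • g) ∈ T.graph) →
      ∃ u : ℂ → ℂ, AnalyticAt ℂ u μ ∧ ∀ᶠ x in 𝓝[≠] μ, φ (n x) = (x - μ) ^ k * u x := by
  induction k with
  | zero =>
    intro n v j _ hn _
    exact ⟨fun x => φ (n x), (φ.analyticAt _).comp hn, Eventually.of_forall fun x => by simp⟩
  | succ k ih =>
    intro n v j hv hn hg
    have hgr : (n μ, v + μ • n μ) ∈ T.graph := by
      refine hcl.mem_of_tendsto (f := fun x =>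
        (n x, x • n x + v + ((x - μ) ^ (k + 1) * r x) • g)) ?_ hg
      have hc : ContinuousAt (fun x => (n x, x • n x + v + ((x - μ) ^ (k + 1) * r x) • g)) μ := by
        have := hn.continuousAt
        fun_prop
      have h2 := hc.tendsto.mono_left (nhdsWithin_le_nhds (s := {μ}ᶜ))
      simpa [add_comm] using h2
    have hmem : n μ ∈ kerPow T μ (j + 1) := mem_kerPow_succ.2 ⟨v, hv, hgr⟩
    obtain ⟨p, hp⟩ := hn
    obtain ⟨u, hu, hux⟩ := ih (dslope n μ) (n μ) (j + 1) hmem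
      hp.has_fpower_series_dslope_fslope.analyticAt (by
        filter_upwards [hg, self_mem_nhdsWithin] with x hx hxμ
        have hxμ' : x - μ ≠ 0 := sub_ne_zero.2 hxμ
        have h1 := T.graph.smul_mem (x - μ)⁻¹ (T.graph.sub_mem hx hgr)
        have h2 : n x = n μ + (x - μ) • dslope n μ x := by
          rw [sub_smul_dslope, add_sub_cancel]
        have h3 : (n x, x • n x + v + ((x - μ) ^ (k + 1) * r x) • g) - (n μ, v + μ • n μ) =
            (x - μ) • (dslope n μ x, x • dslope n μ x + n μ + ((x - μ) ^ k * r x) • g) := by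
          rw [h2, Prod.mk_sub_mk, Prod.smul_mk]
          congr 1 <;> module
        rwa [h3, inv_smul_smul₀ hxμ'] at h1)
    refine ⟨u, hu, ?_⟩
    filter_upwards [hux, self_mem_nhdsWithin] with x hx hxμ
    have h1 : n x = n μ + (x - μ) • dslope n μ x := by
      rw [sub_smul_dslope, add_sub_cancel]
    rw [h1, map_add, hφ _ _ hmem, map_smul, hx, smul_eq_mul]
    ring

theorem exists_det_eq_pow_smul (h : IsCharacteristicPair T Δ N) {ν : ℂ} (hν : Δ ν ≠ 0) (μ : ℂ) :
    ∃ (m : ℕ) (r : ℂ → ℂ), AnalyticAt ℂ r μ ∧ r μ ≠ 0 ∧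
      ∀ᶠ x in 𝓝 μ, Δ x = (x - μ) ^ m * r x := by
  have hΔμ := h.differentiable_det.analyticAt μ
  have hne : analyticOrderAt Δ μ ≠ ⊤ := by
    rw [Ne, analyticOrderAt_eq_top]
    intro h0
    obtain ⟨x, hx1, hx2⟩ := ((h0.filter_mono nhdsWithin_le_nhds).and
      (eventually_ne_zero_of_entire h.differentiable_det hν μ)).exists
    exact hx2 hx1
  obtain ⟨r, hr, hr0, hΔr⟩ := hΔμ.analyticOrderAt_ne_top.1 hne
  exact ⟨_, r, hr, hr0, hΔr⟩

/-- A functional that vanishes on every root subspace makes `φ (N(·) g) / Δ` entire. -/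
theorem exists_entire [CompleteSpace H] (h : IsCharacteristicPair T Δ N) {ν : ℂ}
    (hν : Δ ν ≠ 0) {φ : H →L[ℂ] ℂ} (hφ : ∀ μ j, ∀ y ∈ kerPow T μ j, φ y = 0) (g : H) :
    ∃ F : ℂ → ℂ, Differentiable ℂ F ∧ ∀ x, Δ x * F x = φ (N x g) := by
  have hN : Differentiable ℂ fun x => N x g :=
    h.differentiable_num.clm_apply (differentiable_const g)
  refine exists_entire_quotient (φ.differentiable.comp hN) h.differentiable_det hν fun μ => ?_
  obtain ⟨m, r, hr, hr0, hΔr⟩ := h.exists_det_eq_pow_smul hν μ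
  obtain ⟨u, hu, hux⟩ := exists_factor (h.isClosed_graph hν) φ (hφ μ) g hr.continuousAt
    m (fun x => N x g) 0 0 (Submodule.zero_mem _) (hN.analyticAt μ) (by
      filter_upwards [hΔr.filter_mono nhdsWithin_le_nhds] with x hx
      have := h.mem_graph x g
      rw [hx] at this
      simpa [add_comm] using this)
  refine ⟨fun x => u x / r x, hu.div hr hr0, ?_⟩
  filter_upwards [hux, hΔr.filter_mono nhdsWithin_le_nhds,
    (hr.continuousAt.eventually_ne hr0).filter_mono nhdsWithin_le_nhds] with x h1 h2 h3
  rw [h1, h2]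
  field_simp

end IsCharacteristicPair

end CharacteristicPair

/-! ### Completeness and minimality from a characteristic pair -/

section RootSubspaces

open Filter Topology

/-- Dividing by `x - ν` gains one power of `|x|`, as `|x - ν| ≥ (1 + |x|) / 2` once `|x| ≥ 2|ν| +
1`; the remaining ball is compact. -/
theorem exists_bound_of_eq_sub_mul_add {f f' : ℂ → ℂ} (hf' : Continuous f') {ν c : ℂ}
    (hff : ∀ x, f x = (x - ν) * f' x + c) {S : Set ℂ} {m : ℕ}
    (hb : ∃ K : ℝ, ∀ x ∈ S, ‖f x‖ ≤ K * (1 + ‖x‖) ^ (m + 1)) :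
    ∃ K : ℝ, ∀ x ∈ S, ‖f' x‖ ≤ K * (1 + ‖x‖) ^ m := by
  obtain ⟨K, hK⟩ := hb
  obtain ⟨K₁, hK₁⟩ := (isCompact_closedBall (0 : ℂ) (2 * ‖ν‖ + 1)).exists_bound_of_continuousOn
    hf'.continuousOn
  refine ⟨|K₁| + |2 * (K + ‖c‖)|, fun x hx => ?_⟩
  have h1 : 1 ≤ 1 + ‖x‖ := le_add_of_nonneg_right (norm_nonneg x)
  have h2 : 1 ≤ (1 + ‖x‖) ^ m := one_le_pow₀ h1
  by_cases hxb : ‖x‖ ≤ 2 * ‖ν‖ + 1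
  · calc ‖f' x‖ ≤ K₁ := hK₁ x (by simpa using hxb)
      _ ≤ |K₁| + |2 * (K + ‖c‖)| := (le_abs_self _).trans (le_add_of_nonneg_right (abs_nonneg _))
      _ ≤ _ := le_mul_of_one_le_right (by positivity) h2
  · push Not at hxb
    have h3 : (1 + ‖x‖) / 2 ≤ ‖x - ν‖ := by
      have := norm_sub_norm_le x ν
      linarith
    have h4 : ‖x - ν‖ * ‖f' x‖ ≤ K * (1 + ‖x‖) ^ (m + 1) + ‖c‖ := by
      rw [← norm_mul, show (x - ν) * f' x = f x - c by rw [hff x]; ring]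
      exact (norm_sub_le _ _).trans (by gcongr; exact hK x hx)
    have h5 : ‖c‖ ≤ ‖c‖ * (1 + ‖x‖) ^ (m + 1) :=
      le_mul_of_one_le_right (norm_nonneg _) (one_le_pow₀ h1)
    have h6 : (1 + ‖x‖) / 2 * ‖f' x‖ ≤ (1 + ‖x‖) / 2 * (2 * (K + ‖c‖) * (1 + ‖x‖) ^ m) := by
      calc _ ≤ ‖x - ν‖ * ‖f' x‖ := by gcongr
        _ ≤ (K + ‖c‖) * (1 + ‖x‖) ^ (m + 1) := by linarith
        _ = _ := by ring
    have h7 := le_of_mul_le_mul_left h6 (by positivity)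
    refine h7.trans ?_
    gcongr
    exact (le_abs_self _).trans (le_add_of_nonneg_left (abs_nonneg _))

variable {H : Type*} [NormedAddCommGroup H] [InnerProductSpace ℂ H]

namespace IsCharacteristicPair

variable {T : H →ₗ.[ℂ] H} {Δ : ℂ → ℂ} {N : ℂ → H →L[ℂ] H}

/-- The resolvent identity `R_x = (x - ν) R_x R_ν + R_ν`, multiplied by `Δ x` so that it holds for
every `x`. -/
theorem num_apply_resolvent (h : IsCharacteristicPair T Δ N) {ν : ℂ} (hν : Δ ν ≠ 0) (g : H)
    (x : ℂ) : N x g = (x - ν) • N x (((Δ ν)⁻¹ • N ν) g) + Δ x • ((Δ ν)⁻¹ • N ν) g := by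
  have h1 := T.graph.smul_mem (Δ ν)⁻¹ (h.mem_graph ν g)
  rw [Prod.smul_mk, smul_add, inv_smul_smul₀ hν, smul_comm _ ν] at h1
  have h2 := h.num_apply x _ _ h1
  simp only [map_sub, map_add, map_smul] at h2
  simp only [_root_.smul_apply, map_smul]
  rw [← h2]
  module

theorem denseRange_resolvent (h : IsCharacteristicPair T Δ N) {ν : ℂ} (hν : Δ ν ≠ 0)
    (hdense : Dense (T.domain : Set H)) : DenseRange ((Δ ν)⁻¹ • N ν) := by
  refine hdense.mono fun y hy => ?_
  refine ⟨T ⟨y, hy⟩ - ν • y, ?_⟩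
  have := h.num_apply ν y (T ⟨y, hy⟩) (T.mem_graph ⟨y, hy⟩)
  rw [_root_.smul_apply, this, inv_smul_smul₀ hν]

/-- The analytic core of completeness: the entire quotients `F g` have exponential type and
polynomial growth of degree `s` on the rays, and `s` applications of the resolvent remove that
growth. -/
theorem functional_eq_zero [CompleteSpace H] (h : IsCharacteristicPair T Δ N) {ν : ℂ}
    (hν : Δ ν ≠ 0) (hdense : Dense (T.domain : Set H)) {A B : ℝ} (hA : 0 ≤ A) (hB : 0 ≤ B)
    (hΔ : ∀ x, ‖Δ x‖ ≤ Real.exp (A * ‖x‖ + B))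
    (hN : ∀ x, Δ x ≠ 0 → ‖N x‖ ≤ Real.exp (A * ‖x‖ + B))
    {z : Fin 3 → ℂ} (htri : (0 : ℂ) ∈ interior (convexHull ℝ (range z))) {C R : ℝ} {s : ℕ}
    (hC : 0 ≤ C)
    (hray : ∀ k, ∀ r : ℝ, 0 ≤ r → R < ‖(r : ℂ) * z k‖ → Δ (r * z k) ≠ 0 ∧
      ‖N (r * z k)‖ ≤ C * ‖(r : ℂ) * z k‖ ^ s * ‖Δ (r * z k)‖)
    {φ : H →L[ℂ] ℂ} (hφ : ∀ μ j, ∀ y ∈ kerPow T μ j, φ y = 0) : φ = 0 := by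
  choose F hFd hF using fun g => h.exists_entire hν hφ g
  set Rν : H →L[ℂ] H := (Δ ν)⁻¹ • N ν with hRν
  -- The identity follows from the resolvent identity where `Δ x ≠ 0`, and extends by continuity.
  have hrec : ∀ g x, F g x = (x - ν) * F (Rν g) x + φ (Rν g) := by
    intro g x
    refine eq_of_eventuallyEq_nhdsNE (f := F g) (g := fun x => (x - ν) * F (Rν g) x + φ (Rν g))
      (hFd g).continuous.continuousAt ?_ ?_
    · have := (hFd (Rν g)).continuous
      exact Continuous.continuousAt (by fun_prop)
    · filter_upwards [eventually_ne_zero_of_entire h.differentiable_det hν x] with y hy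
      refine mul_left_cancel₀ hy ?_
      rw [hF, h.num_apply_resolvent hν g y, mul_add, mul_left_comm, hF, map_add, map_smul, map_smul,
        smul_eq_mul, smul_eq_mul]
  set S : Set ℂ := {x | ∃ k, ∃ r : ℝ, 0 ≤ r ∧ x = r * z k} with hS
  have hb0 : ∀ g, ∃ K : ℝ, ∀ x ∈ S, ‖F g x‖ ≤ K * (1 + ‖x‖) ^ s := by
    intro g
    obtain ⟨K₁, hK₁⟩ := (isCompact_closedBall (0 : ℂ) R).exists_bound_of_continuousOn
      (hFd g).continuous.continuousOn
    refine ⟨|K₁| + C * (‖φ‖ * ‖g‖), ?_⟩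
    rintro _ ⟨k, r, hr, rfl⟩
    set x : ℂ := r * z k
    have h1 : 1 ≤ 1 + ‖x‖ := le_add_of_nonneg_right (norm_nonneg x)
    by_cases hxb : ‖x‖ ≤ R
    · calc ‖F g x‖ ≤ K₁ := hK₁ x (by simpa using hxb)
        _ ≤ |K₁| + C * (‖φ‖ * ‖g‖) := (le_abs_self _).trans
          (le_add_of_nonneg_right (by positivity))
        _ ≤ _ := le_mul_of_one_le_right (by positivity) (one_le_pow₀ h1)
    · obtain ⟨hx0, hx1⟩ := hray k r hr (not_le.1 hxb)
      have h2 : ‖Δ x‖ * ‖F g x‖ ≤ ‖Δ x‖ * (C * (‖φ‖ * ‖g‖) * (1 + ‖x‖) ^ s) := by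
        rw [← norm_mul, hF]
        calc ‖φ (N x g)‖ ≤ ‖φ‖ * (‖N x‖ * ‖g‖) :=
              (φ.le_opNorm _).trans (by gcongr; exact (N x).le_opNorm g)
          _ ≤ ‖φ‖ * ((C * (1 + ‖x‖) ^ s * ‖Δ x‖) * ‖g‖) := by
            gcongr
            refine hx1.trans ?_
            gcongr
            exact le_add_of_nonneg_left zero_le_one
          _ = _ := by ring
      refine (le_of_mul_le_mul_left h2 (norm_pos_iff.2 hx0)).trans ?_
      gcongr
      exact le_add_of_nonneg_left (abs_nonneg _)
  have hbm : ∀ m g, (∃ K : ℝ, ∀ x ∈ S, ‖F g x‖ ≤ K * (1 + ‖x‖) ^ m) →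
      ∃ K : ℝ, ∀ x ∈ S, ‖F ((Rν ^ m) g) x‖ ≤ K := by
    intro m
    induction m with
    | zero => intro g hg; simpa using hg
    | succ m ih =>
      intro g hg
      rw [pow_succ]
      exact ih (Rν g) (exists_bound_of_eq_sub_mul_add (hFd _).continuous (hrec g) hg)
  have hgrowth : ∀ g, ∃ A' B', 0 ≤ A' ∧ ∀ x, ‖F g x‖ ≤ Real.exp (A' * ‖x‖ + B') := by
    intro g
    refine exists_exp_bound_of_mul (B := B + ‖φ‖ * ‖g‖) (hFd g) h.differentiable_det hν hA
      (by positivity) (fun x => (hΔ x).trans (Real.exp_le_exp.2 ?_)) fun x => ?_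
    · have : 0 ≤ ‖φ‖ * ‖g‖ := by positivity
      linarith
    -- At zeros of `Δ` the product `Δ F` vanishes, so the bound on `N` is needed only where the
    -- resolvent exists.
    · by_cases hx : Δ x = 0
      · rw [hx, zero_mul, norm_zero]; positivity
      · rw [hF, ← add_assoc, Real.exp_add]
        calc ‖φ (N x g)‖ ≤ ‖φ‖ * (‖N x‖ * ‖g‖) :=
              (φ.le_opNorm _).trans (by gcongr; exact (N x).le_opNorm g)
          _ = ‖N x‖ * (‖φ‖ * ‖g‖) := by ring
          _ ≤ _ := by
            gcongr
            · exact hN x hx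
            · linarith [Real.add_one_le_exp (‖φ‖ * ‖g‖)]
  have hconst : ∀ g x, F ((Rν ^ s) g) x = F ((Rν ^ s) g) 0 := by
    intro g x
    obtain ⟨K, hK⟩ := hbm s g (hb0 g)
    obtain ⟨A', B', hA', hexp⟩ := hgrowth ((Rν ^ s) g)
    refine (hFd _).apply_eq_apply_of_bounded ?_ x 0
    refine (Metric.isBounded_closedBall (x := (0 : ℂ)) (r := K)).subset ?_
    rintro _ ⟨y, rfl⟩
    rw [mem_closedBall_zero_iff]
    exact norm_le_of_three_rays htri (hFd _) hA' hexp (fun k r hr => hK _ ⟨k, r, hr, rfl⟩) y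
  -- In `hrec` for `Rν ^ s g` both functions `F` are constant, so the factor of `x - ν` must vanish;
  -- comparing `x = ν` with `x = ν + 1` shows it.
  have hzero : ∀ g x, F ((Rν ^ (s + 1)) g) x = 0 := by
    intro g x
    have h1 : ∀ x, F ((Rν ^ s) g) 0 = (x - ν) * F ((Rν ^ (s + 1)) g) 0 +
        φ ((Rν ^ (s + 1)) g) := by
      intro x
      have h2 := hrec ((Rν ^ s) g) x
      rw [hconst] at h2
      rw [h2]
      have h3 : Rν ((Rν ^ s) g) = (Rν ^ s) (Rν g) := by
        change (Rν * Rν ^ s) g = (Rν ^ s * Rν) g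
        rw [← pow_succ, ← pow_succ']
      have h4 : (Rν ^ (s + 1)) g = (Rν ^ s) (Rν g) := by rw [pow_succ]; rfl
      rw [h3, h4, hconst (Rν g) x]
    have h5 := h1 ν
    have h6 := h1 (ν + 1)
    have h4 : (Rν ^ (s + 1)) g = (Rν ^ s) (Rν g) := by rw [pow_succ]; rfl
    rw [h4, hconst, ← h4]
    linear_combination h5 - h6
  have hφR : ∀ g, φ ((Rν ^ (s + 2)) g) = 0 := by
    intro g
    have h1 := hrec ((Rν ^ (s + 1)) g) ν
    rw [hzero, sub_self, zero_mul, zero_add] at h1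
    rw [pow_succ']
    exact h1.symm
  have hd : ∀ m : ℕ, DenseRange (Rν ^ m) := by
    intro m
    induction m with
    | zero => exact fun x => subset_closure ⟨x, rfl⟩
    | succ m ih =>
      rw [pow_succ]
      exact ih.comp (h.denseRange_resolvent hν hdense) (Rν ^ m).continuous
  ext y
  exact congrFun ((hd (s + 2)).equalizer φ.continuous continuous_const
    (funext fun g => hφR g)) y

theorem closure_iSup_rootSubspace [CompleteSpace H] (h : IsCharacteristicPair T Δ N) {ν : ℂ}
    (hν : Δ ν ≠ 0) (hdense : Dense (T.domain : Set H)) {A B : ℝ} (hA : 0 ≤ A) (hB : 0 ≤ B)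
    (hΔ : ∀ x, ‖Δ x‖ ≤ Real.exp (A * ‖x‖ + B))
    (hN : ∀ x, Δ x ≠ 0 → ‖N x‖ ≤ Real.exp (A * ‖x‖ + B))
    {z : Fin 3 → ℂ} (htri : (0 : ℂ) ∈ interior (convexHull ℝ (range z))) {C R : ℝ} {s : ℕ}
    (hC : 0 ≤ C)
    (hray : ∀ k, ∀ r : ℝ, 0 ≤ r → R < ‖(r : ℂ) * z k‖ → Δ (r * z k) ≠ 0 ∧
      ‖N (r * z k)‖ ≤ C * ‖(r : ℂ) * z k‖ ^ s * ‖Δ (r * z k)‖) :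
    (⨆ μ, rootSubspace T μ).topologicalClosure = ⊤ := by
  rw [Submodule.topologicalClosure_eq_top_iff, Submodule.eq_bot_iff]
  intro x hx
  have h0 : innerSL ℂ x = 0 := by
    refine h.functional_eq_zero hν hdense hA hB hΔ hN htri hC hray fun μ j y hy => ?_
    rw [innerSL_apply_apply]
    exact (Submodule.mem_orthogonal' _ _).1 hx y
      (Submodule.mem_iSup_of_mem μ (mem_rootSubspace.2 ⟨j, hy⟩))
  have h1 : inner ℂ x x = 0 := by rw [← innerSL_apply_apply (𝕜 := ℂ), h0]; rfl
  exact inner_self_eq_zero.1 h1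

/-- On a root vector of height at most `k` the resolvent has no singularity except a pole at `μ` of
order at most `k`. For `k > 0` the construction gives `q μ = -(T - μ)^(k-1) y`, so `q μ = 0` lowers
the height. For `k = 0` the truncated `k - 1` is `0`, consistent with `y = 0`. -/
theorem exists_polar (h : IsCharacteristicPair T Δ N) {μ : ℂ} {k : ℕ} :
    ∀ {y : H}, y ∈ kerPow T μ k → ∃ q : ℂ → H, Differentiable ℂ q ∧
      (∀ x, (x - μ) ^ k • N x y = Δ x • q x) ∧ (q μ = 0 → y ∈ kerPow T μ (k - 1)) := by
  induction k with
  | zero =>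
    intro y hy
    rw [show y = 0 from hy]
    exact ⟨fun _ => 0, differentiable_const _, by simp, fun _ => Submodule.zero_mem _⟩
  | succ k ih =>
    intro y hy
    obtain ⟨v, hv, hgr⟩ := mem_kerPow_succ.1 hy
    obtain ⟨q, hq, hqv, hq0⟩ := ih hv
    have hkey : ∀ x, N x v = (x - μ) • N x y + Δ x • y := by
      intro x
      rw [← h.num_apply x _ _ hgr]
      simp only [map_sub, map_add, map_smul]
      module
    rcases k with _ | k
    · have hv0 : v = 0 := hv
      refine ⟨fun _ => -y, differentiable_const _, fun x => ?_, fun h0 => ?_⟩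
      · have := hkey x
        rw [hv0, map_zero] at this
        rw [zero_add, pow_one, smul_neg, eq_neg_iff_add_eq_zero, this]
      · exact neg_eq_zero.1 h0
    · refine ⟨fun x => q x - (x - μ) ^ (k + 1) • y, by fun_prop, fun x => ?_, fun h0 => ?_⟩
      · rw [smul_sub, ← hqv x, hkey x]
        module
      · simp only [sub_self, ne_eq, Nat.add_eq_zero_iff, one_ne_zero, and_false,
          not_false_eq_true, zero_pow, zero_smul, sub_zero] at h0
        exact mem_kerPow_succ.2 ⟨v, hq0 h0, hgr⟩

/-- Regularity at `μ` makes the leading polar coefficient vanish, so the height drops step by step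
to `0`. -/
theorem eq_zero_of_regular (h : IsCharacteristicPair T Δ N) {ν : ℂ} (hν : Δ ν ≠ 0) {μ : ℂ} {y : H}
    {u : ℂ → H} (hu : ContinuousAt u μ) (huN : ∀ᶠ x in 𝓝[≠] μ, N x y = Δ x • u x) {k : ℕ} :
    y ∈ kerPow T μ k → y = 0 := by
  induction k with
  | zero => exact fun hy => hy
  | succ k ih =>
    intro hy
    obtain ⟨q, hq, hqv, hq0⟩ := h.exists_polar hy
    refine ih (hq0 ?_)
    have h1 : q μ = (μ - μ) ^ (k + 1) • u μ := by
      refine eq_of_eventuallyEq_nhdsNE (f := q) (g := fun x => (x - μ) ^ (k + 1) • u x)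
        hq.continuous.continuousAt (by fun_prop) ?_
      filter_upwards [huN, eventually_ne_zero_of_entire h.differentiable_det hν μ] with x hx hx0
      have h2 := hqv x
      rw [hx, smul_comm] at h2
      exact (smul_right_injective H hx0 h2).symm
    simpa using h1

/-- The pole of `N / Δ` at `μ` has order at most the order `m` of the zero of `Δ`, so by
`exists_polar` heights cannot exceed `m`. -/
theorem exists_rootSubspace_eq_kerPow (h : IsCharacteristicPair T Δ N) {ν : ℂ} (hν : Δ ν ≠ 0)
    (μ : ℂ) : ∃ m, rootSubspace T μ = kerPow T μ m := by
  obtain ⟨m, r, hr, hr0, hΔr⟩ := h.exists_det_eq_pow_smul hν μ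
  refine ⟨m, le_antisymm (iSup_le fun k => ?_) (le_iSup (kerPow T μ) m)⟩
  have hstep : ∀ k, m ≤ k → kerPow T μ (k + 1) ≤ kerPow T μ k := by
    intro k hk y hy
    obtain ⟨q, hq, hqv, hq0⟩ := h.exists_polar hy
    refine hq0 ?_
    have h1 : r μ • q μ = (μ - μ) ^ (k + 1 - m) • N μ y := by
      have hNc : Continuous N := h.differentiable_num.continuous
      have hrc := hr.continuousAt
      have hqc := hq.continuous
      refine eq_of_eventuallyEq_nhdsNE (f := fun x => r x • q x)
        (g := fun x => (x - μ) ^ (k + 1 - m) • N x y) (by fun_prop)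
        (Continuous.continuousAt (by fun_prop)) ?_
      filter_upwards [hΔr.filter_mono nhdsWithin_le_nhds, self_mem_nhdsWithin] with x hx hxμ
      have hxμ' : (x - μ) ^ m ≠ 0 := pow_ne_zero _ (sub_ne_zero.2 hxμ)
      have h2 := hqv x
      rw [hx, mul_smul, show k + 1 = m + (k + 1 - m) by omega, pow_add, mul_smul] at h2
      exact (smul_right_injective H hxμ' h2).symm
    rw [sub_self, zero_pow (by omega), zero_smul] at h1
    exact (smul_eq_zero.1 h1).resolve_left hr0
  have hall : ∀ i, kerPow T μ (m + i) ≤ kerPow T μ m := by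
    intro i
    induction i with
    | zero => exact le_rfl
    | succ i ih => exact (hstep (m + i) (Nat.le_add_right m i)).trans ih
  exact (monotone_kerPow T μ (Nat.le_add_left k m)).trans (hall k)

end IsCharacteristicPair

/-- `T - μ` maps `kerPow T μ (k + 1)` into `kerPow T μ k`, and its kernel is the eigenspace. -/
theorem fg_kerPow {T : H →ₗ.[ℂ] H} {μ : ℂ} (h1 : (kerPow T μ 1).FG) (k : ℕ) :
    (kerPow T μ k).FG := by
  induction k with
  | zero => exact Submodule.fg_bot
  | succ k ih =>
    refine Submodule.FG.map _ (Submodule.fg_of_fg_map_of_fg_inf_ker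
      (T.toFun - μ • T.domain.subtype) ?_ ?_)
    · exact Submodule.FG.of_le ih (Submodule.map_comap_le _ _)
    · have h2 : (LinearMap.ker (T.toFun - μ • T.domain.subtype)).FG :=
        Submodule.fg_of_fg_map_injective T.domain.subtype T.domain.injective_subtype h1
      exact Submodule.FG.of_le h2 inf_le_right

namespace IsCharacteristicPair

variable {T : H →ₗ.[ℂ] H} {Δ : ℂ → ℂ} {N : ℂ → H →L[ℂ] H}

/-- Regularity of `N(·) y / Δ` at a zero of `Δ` of order `m` means that the first `m` derivatives of
`N` at `μ` annihilate `y`, an intersection of kernels of bounded operators. -/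
theorem exists_closed_regular_subspace [CompleteSpace H] (h : IsCharacteristicPair T Δ N) {ν : ℂ}
    (hν : Δ ν ≠ 0) (μ : ℂ) :
    ∃ Z : Submodule ℂ H, IsClosed (Z : Set H) ∧ ∀ y, y ∈ Z ↔
      ∃ u : ℂ → H, AnalyticAt ℂ u μ ∧ ∀ᶠ x in 𝓝 μ, N x y = Δ x • u x := by
  obtain ⟨m, r, hr, hr0, hΔr⟩ := h.exists_det_eq_pow_smul hν μ
  have hder : ∀ (y : H) (j : ℕ), iteratedDeriv j (fun x => N x y) =
      fun x => iteratedDeriv j N x y := by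
    intro y j
    induction j with
    | zero => simp
    | succ j ih =>
      rw [iteratedDeriv_succ, ih]
      funext x
      have hd : DifferentiableAt ℂ (iteratedDeriv j N) x :=
        (h.differentiable_num.contDiff (n := ⊤)).differentiable_iteratedDeriv j
          (by exact_mod_cast WithTop.coe_lt_top _) x
      rw [iteratedDeriv_succ]
      have := hd.hasDerivAt.clm_apply (hasDerivAt_const x y)
      simpa using this.deriv
  refine ⟨⨅ j : Fin m, (iteratedDeriv (j : ℕ) N μ).ker, ?_, fun y => ?_⟩
  · rw [Submodule.coe_iInf]
    exact isClosed_iInter fun j => (iteratedDeriv j N μ).isClosed_ker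
  · have hN : AnalyticAt ℂ (fun x => N x y) μ :=
      (h.differentiable_num.clm_apply (differentiable_const y)).analyticAt μ
    have h1 : y ∈ (⨅ j : Fin m, (iteratedDeriv (j : ℕ) N μ).ker) ↔
        ∀ j < m, iteratedDeriv j (fun x => N x y) μ = 0 := by
      simp only [Submodule.mem_iInf, LinearMap.mem_ker, Fin.forall_iff, hder]
      rfl
    rw [h1, ← natCast_le_analyticOrderAt_iff_iteratedDeriv_eq_zero hN,
      natCast_le_analyticOrderAt hN]
    constructor
    · rintro ⟨g, hg, hgN⟩
      refine ⟨fun x => (r x)⁻¹ • g x, (hr.inv hr0).smul hg, ?_⟩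
      filter_upwards [hgN, hΔr, hr.continuousAt.eventually_ne hr0] with x h1 h2 h3
      rw [h1, h2, mul_smul, smul_inv_smul₀ h3]
    · rintro ⟨u, hu, huN⟩
      refine ⟨fun x => r x • u x, hr.smul hu, ?_⟩
      filter_upwards [huN, hΔr] with x h1 h2
      rw [h1, h2, mul_smul]

/-- The members other than `e μ i` lie in `Z ⊔ W`, where `Z` consists of the vectors with resolvent
regular at `μ` and `W` is spanned by the remaining basis vectors at `μ`. This sum is closed because
`W` is finite-dimensional. As `Z` meets the root subspace at `μ` only in `0`, membership of `e μ i`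
would put it in `W`, against linear independence. -/
theorem isMinimalFamily [CompleteSpace H] (h : IsCharacteristicPair T Δ N) {ν : ℂ}
    (hν : Δ ν ≠ 0) (hfin : ∀ μ, (kerPow T μ 1).FG) {ι : ℂ → Type*}
    (e : ∀ μ : ℂ, Module.Basis (ι μ) ℂ (rootSubspace T μ)) :
    IsMinimalFamily (fun p : Σ μ : ℂ, ι μ => (e p.1 p.2 : H)) := by
  rintro ⟨μ, i⟩ hmem
  obtain ⟨Z, hZc, hZ⟩ := h.exists_closed_regular_subspace hν μ
  set W : Submodule ℂ H := Submodule.span ℂ ((fun j => (e μ j : H)) '' {j | j ≠ i}) with hW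
  have hWr : W ≤ rootSubspace T μ := by
    rw [hW, Submodule.span_le]
    rintro _ ⟨j, -, rfl⟩
    exact (e μ j).2
  have hWf : FiniteDimensional ℂ W := by
    obtain ⟨m, hm⟩ := h.exists_rootSubspace_eq_kerPow hν μ
    have h1 : (rootSubspace T μ).FG := hm ▸ fg_kerPow (hfin μ) m
    exact Module.Finite.iff_fg.2 (Submodule.FG.of_le h1 hWr)
  have hle : Submodule.span ℂ ((fun p : Σ μ : ℂ, ι μ => (e p.1 p.2 : H)) ''
      {j | j ≠ ⟨μ, i⟩}) ≤ Z ⊔ W := by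
    rw [Submodule.span_le]
    rintro _ ⟨⟨μ', j⟩, hj, rfl⟩
    by_cases hμ : μ' = μ
    · subst hμ
      refine Submodule.mem_sup_right (Submodule.subset_span ⟨j, fun hji => hj ?_, rfl⟩)
      rw [hji]
    · refine Submodule.mem_sup_left ((hZ _).2 ?_)
      obtain ⟨k, hk⟩ := mem_rootSubspace.1 (e μ' j).2
      -- On a root vector at `μ' ≠ μ` the only pole of the resolvent is at `μ'`, so it is regular at
      -- `μ`.
      obtain ⟨q, hq, hqv, -⟩ := h.exists_polar hk
      have hne : (μ - μ') ^ k ≠ 0 := pow_ne_zero _ (sub_ne_zero.2 (Ne.symm hμ))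
      refine ⟨fun x => ((x - μ') ^ k)⁻¹ • q x, ?_, ?_⟩
      · exact (AnalyticAt.inv (f := fun x : ℂ => (x - μ') ^ k) (by fun_prop) hne).smul
          (hq.analyticAt μ)
      · have hc : ContinuousAt (fun x : ℂ => (x - μ') ^ k) μ := by fun_prop
        filter_upwards [hc.eventually_ne hne] with x hx
        rw [smul_comm, ← hqv x, inv_smul_smul₀ hx]
  have hcl := Submodule.isClosed_sup_finiteDimensional Z W hZc
  have hmem' : (e μ i : H) ∈ Z ⊔ W := (closure_minimal hle hcl) hmem
  obtain ⟨y, hy, w, hw, hyw⟩ := Submodule.mem_sup.1 hmem'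
  have hyr : y ∈ rootSubspace T μ := by
    rw [eq_sub_of_add_eq hyw]
    exact Submodule.sub_mem _ (e μ i).2 (hWr hw)
  obtain ⟨k, hk⟩ := mem_rootSubspace.1 hyr
  obtain ⟨u, hu, huN⟩ := (hZ y).1 hy
  have hy0 : y = 0 :=
    h.eq_zero_of_regular hν hu.continuousAt (huN.filter_mono nhdsWithin_le_nhds) hk
  rw [hy0, zero_add] at hyw
  have hli : LinearIndependent ℂ fun j => (e μ j : H) :=
    (e μ).linearIndependent.map' _ (Submodule.ker_subtype _)
  refine hli.notMem_span_image (s := {j | j ≠ i}) (x := i) (by simp) ?_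
  rw [← hyw]
  exact hw

end IsCharacteristicPair

theorem isCompleteFamily_of_closure_eq_top {T : H →ₗ.[ℂ] H}
    (h : (⨆ μ, rootSubspace T μ).topologicalClosure = ⊤) {ι : ℂ → Type*}
    (e : ∀ μ : ℂ, Module.Basis (ι μ) ℂ (rootSubspace T μ)) :
    IsCompleteFamily (fun p : Σ μ : ℂ, ι μ => (e p.1 p.2 : H)) := by
  have hle : (⨆ μ, rootSubspace T μ) ≤
      Submodule.span ℂ (range fun p : Σ μ : ℂ, ι μ => (e p.1 p.2 : H)) := by
    refine iSup_le fun μ y hy => ?_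
    have h1 : (⟨y, hy⟩ : rootSubspace T μ) ∈ Submodule.span ℂ (range (e μ)) := by
      rw [(e μ).span_eq]; trivial
    have h2 := Submodule.mem_map_of_mem (f := (rootSubspace T μ).subtype) h1
    rw [Submodule.map_span] at h2
    refine Submodule.span_mono ?_ h2
    rintro _ ⟨_, ⟨j, rfl⟩, rfl⟩
    exact ⟨⟨μ, j⟩, rfl⟩
  refine (Submodule.dense_iff_topologicalClosure_eq_top.2 h).mono hle

end RootSubspaces

/-! ### The boundary value problem as a first order system -/

section System

variable {n : ℕ}

/-- The potential part `-i B Q` of the first order system `y' = (i μ B - i B Q) y + i B g`. -/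
noncomputable def potential (b : Fin n → ℂ) (Q : ℝ → Matrix (Fin n) (Fin n) ℂ) (t : ℝ) :
    Matrix (Fin n) (Fin n) ℂ :=
  -(Matrix.diagonal (fun j => I * b j) * Q t)

/-- The coefficient `i μ B - i B Q` of the first order system. -/
noncomputable def coeffMatrix (b : Fin n → ℂ) (Q : ℝ → Matrix (Fin n) (Fin n) ℂ) (μ : ℂ) (t : ℝ) :
    Matrix (Fin n) (Fin n) ℂ :=
  Matrix.diagonal (fun j => I * b j * μ) + potential b Q t

theorem potential_apply (b : Fin n → ℂ) (Q : ℝ → Matrix (Fin n) (Fin n) ℂ) (t : ℝ)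
    (i j : Fin n) : potential b Q t i j = -(I * b i * Q t i j) := by
  simp [potential, Matrix.diagonal_mul]

theorem coeffMatrix_mulVec (b : Fin n → ℂ) (Q : ℝ → Matrix (Fin n) (Fin n) ℂ) (μ : ℂ) (t : ℝ)
    (v : Fin n → ℂ) (j : Fin n) :
    (coeffMatrix b Q μ t *ᵥ v) j = I * b j * (μ * v j - (Q t *ᵥ v) j) := by
  simp only [coeffMatrix, potential, Matrix.add_mulVec, Matrix.neg_mulVec, ← Matrix.mulVec_mulVec,
    Pi.add_apply, Pi.neg_apply, Matrix.mulVec_diagonal]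
  ring

theorem entryIntegrable_potential {Q : ℝ → Matrix (Fin n) (Fin n) ℂ}
    (hQ : ∀ j k, IntegrableOn (fun x => Q x j k) (Icc (0 : ℝ) 1)) (b : Fin n → ℂ) :
    EntryIntegrable (potential b Q) := by
  intro i j
  simp only [potential_apply]
  have h := (hQ i j).mono_set Ioc_subset_Icc_self
  exact (((intervalIntegrable_iff_integrableOn_Ioc_of_le zero_le_one).2 h).const_mul _).neg

theorem entryIntegrable_coeffMatrix {Q : ℝ → Matrix (Fin n) (Fin n) ℂ}
    (hQ : ∀ j k, IntegrableOn (fun x => Q x j k) (Icc (0 : ℝ) 1)) (b : Fin n → ℂ) (μ : ℂ) :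
    EntryIntegrable (coeffMatrix b Q μ) := by
  intro i j
  have h := (entryIntegrable_potential hQ b i j)
  exact (intervalIntegrable_const (c := Matrix.diagonal (fun j => I * b j * μ) i j)).add h

theorem inv_diagonal_mulVec {b : Fin n → ℂ} (hb : ∀ j, b j ≠ 0) (v : Fin n → ℂ) :
    (Matrix.diagonal b)⁻¹ *ᵥ v = fun j => (b j)⁻¹ * v j := by
  have h : (Matrix.diagonal b)⁻¹ = Matrix.diagonal fun j => (b j)⁻¹ := by
    refine Matrix.inv_eq_right_inv ?_
    rw [Matrix.diagonal_mul_diagonal, ← Matrix.diagonal_one]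
    congr 1
    funext j
    exact mul_inv_cancel₀ (hb j)
  rw [h]
  funext j
  exact Matrix.mulVec_diagonal _ _ _

theorem diffExpr_eq_iff {b : Fin n → ℂ} (hb : ∀ j, b j ≠ 0) (Q : ℝ → Matrix (Fin n) (Fin n) ℂ)
    (μ : ℂ) {y : ℝ → Fin n → ℂ} {x : ℝ} (g : Fin n → ℂ) :
    diffExpr b Q y x = g + μ • y x ↔
      deriv y x = coeffMatrix b Q μ x *ᵥ y x + fun j => I * b j * g j := by
  rw [diffExpr, inv_diagonal_mulVec hb, funext_iff, funext_iff]
  refine forall_congr' fun j => ?_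
  simp only [Pi.add_apply, Pi.smul_apply, smul_eq_mul, coeffMatrix_mulVec]
  have hbj := hb j
  constructor
  · intro h
    have h2 : deriv y x j = I * b j * (-I * ((b j)⁻¹ * deriv y x j)) := by
      field_simp
      rw [Complex.I_sq]; ring
    rw [h2, eq_sub_of_add_eq h]
    ring
  · intro h
    rw [h]
    field_simp
    ring_nf
    rw [Complex.I_sq]; ring

instance isProbabilityMeasure_unitVol : IsProbabilityMeasure unitVol := ⟨by simp [unitVol]⟩

theorem integrable_of_L2 (g : L2 n) : Integrable g unitVol :=
  (Lp.memLp g).integrable one_le_two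

theorem integral_norm_le_norm (g : L2 n) : ∫ x, ‖g x‖ ∂unitVol ≤ ‖g‖ := by
  rw [integral_norm_eq_lintegral_enorm (Lp.aestronglyMeasurable g), Lp.norm_def,
    ← eLpNorm_one_eq_lintegral_enorm]
  exact ENNReal.toReal_mono (Lp.memLp g).eLpNorm_ne_top
    (eLpNorm_le_eLpNorm_of_exponent_le one_le_two (Lp.aestronglyMeasurable g))

/-- The source term `i B g` of the first order system. -/
noncomputable def source (b : Fin n → ℂ) (g : L2 n) (x : ℝ) : Fin n → ℂ := fun j => I * b j * g x j

theorem intervalIntegrable_source (b : Fin n → ℂ) (g : L2 n) :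
    IntervalIntegrable (source b g) volume 0 1 := by
  refine intervalIntegrable_pi fun j => ?_
  rw [intervalIntegrable_iff_integrableOn_Ioc_of_le zero_le_one]
  have h1 : Integrable (fun x => g x j) unitVol :=
    (EuclideanSpace.proj (𝕜 := ℂ) j).integrable_comp (integrable_of_L2 g)
  exact (IntegrableOn.mono_set (f := fun x => g x j) (t := Icc (0 : ℝ) 1) (μ := volume) h1
    Ioc_subset_Icc_self).const_mul _

theorem norm_source_le (b : Fin n → ℂ) (g : L2 n) (x : ℝ) :
    ‖source b g x‖ ≤ ‖b‖ * ‖g x‖ := by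
  refine (pi_norm_le_iff_of_nonneg (by positivity)).2 fun j => ?_
  rw [source, norm_mul, norm_mul, norm_I, one_mul]
  gcongr
  · exact norm_le_pi_norm b j
  · exact PiLp.norm_apply_le (g x) j

theorem ae_unitVol_iff {p : ℝ → Prop} :
    (∀ᵐ x ∂unitVol, p x) ↔ ∀ᵐ x, x ∈ Icc (0 : ℝ) 1 → p x :=
  ae_restrict_iff' measurableSet_Icc

theorem integral_congr_of_ae_unitVol {F : Type*} [NormedAddCommGroup F] [NormedSpace ℝ F]
    {f g : ℝ → F} (h : f =ᵐ[unitVol] g) (x : unitInterval) :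
    ∫ t in (0 : ℝ)..x, f t = ∫ t in (0 : ℝ)..x, g t := by
  refine intervalIntegral.integral_congr_ae ?_
  filter_upwards [ae_unitVol_iff.1 h] with t ht hx
  rw [uIoc_of_le x.2.1] at hx
  exact ht ⟨hx.1.le, hx.2.trans x.2.2⟩

/-- The primitive of the source term, as an operator on `L²`. -/
noncomputable def sourceOp (b : Fin n → ℂ) : L2 n →L[ℂ] C(unitInterval, Fin n → ℂ) :=
  LinearMap.mkContinuous
    { toFun := fun g => primitive (source b g) (intervalIntegrable_source b g)
      map_add' := fun g g' => by
        ext1 x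
        have hx : uIcc (0 : ℝ) x ⊆ uIcc 0 1 :=
          uIcc_subset_uIcc left_mem_uIcc (by rw [uIcc_of_le zero_le_one]; exact x.2)
        simp only [primitive_apply, ContinuousMap.add_apply]
        rw [← intervalIntegral.integral_add ((intervalIntegrable_source b g).mono_set hx)
          ((intervalIntegrable_source b g').mono_set hx)]
        refine integral_congr_of_ae_unitVol ?_ x
        filter_upwards [Lp.coeFn_add g g'] with t ht
        funext j
        simp only [source, ht, Pi.add_apply, PiLp.add_apply, mul_add]
      map_smul' := fun c g => by
        ext1 x
        simp only [primitive_apply, ContinuousMap.smul_apply, RingHom.id_apply]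
        rw [← intervalIntegral.integral_smul]
        refine integral_congr_of_ae_unitVol ?_ x
        filter_upwards [Lp.coeFn_smul c g] with t ht
        funext j
        simp only [source, ht, Pi.smul_apply, PiLp.smul_apply, smul_eq_mul]
        ring }
    ‖b‖ fun g => by
      refine (ContinuousMap.norm_le _ (by positivity)).2 fun x => ?_
      have hI : IntegrableOn (fun t => ‖b‖ * ‖g t‖) (Icc 0 1) :=
        (integrable_of_L2 g).norm.const_mul ‖b‖
      have hI' : IntervalIntegrable (fun t => ‖b‖ * ‖g t‖) volume 0 1 :=
        (intervalIntegrable_iff_integrableOn_Ioc_of_le zero_le_one).2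
          (hI.mono_set Ioc_subset_Icc_self)
      have hx : uIcc (0 : ℝ) x ⊆ uIcc 0 1 :=
        uIcc_subset_uIcc left_mem_uIcc (by rw [uIcc_of_le zero_le_one]; exact x.2)
      calc ‖∫ t in (0 : ℝ)..x, source b g t‖ ≤ ∫ t in (0 : ℝ)..x, ‖b‖ * ‖g t‖ :=
            intervalIntegral.norm_integral_le_of_norm_le x.2.1
              (Filter.Eventually.of_forall fun t _ => norm_source_le b g t) (hI'.mono_set hx)
        _ ≤ ∫ t in (0 : ℝ)..1, ‖b‖ * ‖g t‖ :=
            intervalIntegral.integral_mono_interval le_rfl x.2.1 x.2.2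
              (Filter.Eventually.of_forall fun t => by positivity) hI'
        _ = ‖b‖ * ∫ t, ‖g t‖ ∂unitVol := by
            rw [intervalIntegral.integral_const_mul, intervalIntegral.integral_of_le zero_le_one,
              ← integral_Icc_eq_integral_Ioc]
        _ ≤ ‖b‖ * ‖g‖ := by gcongr; exact integral_norm_le_norm g

theorem sourceOp_apply (b : Fin n → ℂ) (g : L2 n) :
    sourceOp b g = primitive (source b g) (intervalIntegrable_source b g) := rfl

theorem memLp_toLp_lineExt (Y : C(unitInterval, Fin n → ℂ)) :
    MemLp (fun x => (WithLp.toLp 2 (lineExt Y x) : EuclideanSpace ℂ (Fin n))) 2 unitVol := by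
  have hc : Continuous fun x => (WithLp.toLp 2 (lineExt Y x) : EuclideanSpace ℂ (Fin n)) :=
    (EuclideanSpace.equiv (Fin n) ℂ).symm.continuous.comp (continuous_lineExt Y)
  refine MemLp.of_bound hc.aestronglyMeasurable
    (‖((EuclideanSpace.equiv (Fin n) ℂ).symm : (Fin n → ℂ) →L[ℂ] EuclideanSpace ℂ (Fin n))‖ * ‖Y‖)
    (Filter.Eventually.of_forall fun x => ?_)
  exact (((EuclideanSpace.equiv (Fin n) ℂ).symm :
    (Fin n → ℂ) →L[ℂ] EuclideanSpace ℂ (Fin n)).le_opNorm _).trans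
    (by gcongr; exact norm_lineExt_le Y x)

/-- The embedding of the continuous functions on `[0,1]` into `L²`. -/
noncomputable def embedL2 (n : ℕ) : C(unitInterval, Fin n → ℂ) →L[ℂ] L2 n :=
  LinearMap.mkContinuous
    { toFun := fun Y => (memLp_toLp_lineExt Y).toLp _
      map_add' := fun Y Y' => by
        rw [← MemLp.toLp_add]; rfl
      map_smul' := fun c Y => by
        rw [RingHom.id_apply, ← MemLp.toLp_const_smul]; rfl }
    (((measureUnivNNReal unitVol) ^ (ENNReal.toReal 2)⁻¹ : NNReal) *
      ‖((EuclideanSpace.equiv (Fin n) ℂ).symm : (Fin n → ℂ) →L[ℂ] EuclideanSpace ℂ (Fin n))‖)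
    fun Y => by
      rw [mul_assoc]
      refine Lp.norm_le_of_ae_bound (by positivity) ?_
      filter_upwards [(memLp_toLp_lineExt Y).coeFn_toLp] with x hx
      simp only [LinearMap.coe_mk, AddHom.coe_mk]
      rw [hx]
      exact (((EuclideanSpace.equiv (Fin n) ℂ).symm :
        (Fin n → ℂ) →L[ℂ] EuclideanSpace ℂ (Fin n)).le_opNorm _).trans
        (by gcongr; exact norm_lineExt_le Y x)

theorem coeFn_embedL2 (Y : C(unitInterval, Fin n → ℂ)) :
    ∀ᵐ x ∂unitVol, embedL2 n Y x = WithLp.toLp 2 (lineExt Y x) :=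
  (memLp_toLp_lineExt Y).coeFn_toLp

theorem embedL2_eq {f : L2 n} {Y : C(unitInterval, Fin n → ℂ)} {y : ℝ → Fin n → ℂ}
    (hf : ∀ᵐ x ∂unitVol, f x = WithLp.toLp 2 (y x)) (hY : ∀ x : unitInterval, Y x = y x) :
    f = embedL2 n Y := by
  refine Lp.ext ?_
  filter_upwards [hf, coeFn_embedL2 Y, ae_restrict_mem measurableSet_Icc] with x h1 h2 h3
  rw [h1, h2, lineExt_of_mem Y h3, hY]

theorem isSolution_iff_diffExpr {b : Fin n → ℂ} (hb : ∀ j, b j ≠ 0)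
    (Q : ℝ → Matrix (Fin n) (Fin n) ℂ) (μ : ℂ) (g y : ℝ → Fin n → ℂ) :
    IsSolution (coeffMatrix b Q μ) (fun x j => I * b j * g x j) y ↔
      AbsolutelyContinuousOnInterval y 0 1 ∧
        ∀ᵐ x ∂unitVol, diffExpr b Q y x = g x + μ • y x := by
  refine and_congr_right fun hy => ?_
  rw [← ae_unitVol_iff]
  refine Filter.eventually_congr ?_
  filter_upwards [ae_differentiableAt_of_ac hy] with x hx
  rw [diffExpr_eq_iff hb]
  exact ⟨fun h => h.deriv, fun h => h ▸ hx.hasDerivAt⟩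

theorem mem_bvpGraph_iff_isSolution {b : Fin n → ℂ} (hb : ∀ j, b j ≠ 0)
    (Q : ℝ → Matrix (Fin n) (Fin n) ℂ) (C D : Matrix (Fin n) (Fin n) ℂ) (μ : ℂ) (f g : L2 n) :
    (f, g + μ • f) ∈ bvpGraph b Q C D ↔
      ∃ y : ℝ → Fin n → ℂ, IsSolution (coeffMatrix b Q μ) (source b g) y ∧
        (∀ᵐ x ∂unitVol, f x = WithLp.toLp 2 (y x)) ∧ C *ᵥ y 0 + D *ᵥ y 1 = 0 := by
  refine exists_congr fun y => ?_
  have h1 := isSolution_iff_diffExpr hb Q μ (fun x => (g x).ofLp) y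
  change _ ↔ IsSolution _ (fun x j => I * b j * (g x).ofLp j) y ∧ _
  rw [h1, and_assoc]
  refine and_congr_right fun _ => ?_
  rw [and_left_comm]
  refine and_congr_left fun ⟨hf, _⟩ => ?_
  refine Filter.eventually_congr ?_
  filter_upwards [hf, Lp.coeFn_add g (μ • f), Lp.coeFn_smul μ f] with x h1 h2 h3
  rw [h2, Pi.add_apply, h3, Pi.smul_apply, h1]
  constructor
  · intro h
    have := congrArg WithLp.ofLp h
    simpa using this.symm
  · intro h
    rw [h]
    ext j
    simp

end System

/-! ### The resolvent of the boundary value problem -/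

section CharacteristicPairOfSystem

variable {n : ℕ}

theorem differentiable_det {J : Type*} [Fintype J] [DecidableEq J] {M : ℂ → Matrix J J ℂ}
    (h : ∀ i j, Differentiable ℂ fun μ => M μ i j) : Differentiable ℂ fun μ => (M μ).det := by
  simp only [Matrix.det_apply']
  fun_prop

theorem differentiable_adjugate {J : Type*} [Fintype J] [DecidableEq J] {M : ℂ → Matrix J J ℂ}
    (h : ∀ i j, Differentiable ℂ fun μ => M μ i j) (i j : J) :
    Differentiable ℂ fun μ => (M μ).adjugate i j := by
  simp only [Matrix.adjugate_apply]
  refine differentiable_det fun k l => ?_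
  by_cases hk : k = j
  · subst hk; simp
  · simpa [Matrix.updateRow_ne hk] using h k l

/-- Multiplication by a matrix, as a continuous linear map. -/
noncomputable def mulVecOp (M : Matrix (Fin n) (Fin n) ℂ) : (Fin n → ℂ) →L[ℂ] (Fin n → ℂ) :=
  LinearMap.toContinuousLinearMap M.mulVecLin

theorem mulVecOp_eq_sum (M : Matrix (Fin n) (Fin n) ℂ) :
    mulVecOp M = ∑ i, ∑ j, M i j •
      ((ContinuousLinearMap.proj j : (Fin n → ℂ) →L[ℂ] ℂ).smulRight (Pi.single i (1 : ℂ))) := by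
  ext v k
  change (M *ᵥ v) k = _
  simp [sum_apply, Matrix.mulVec, dotProduct, Pi.single_apply]

theorem differentiable_mulVecOp {M : ℂ → Matrix (Fin n) (Fin n) ℂ}
    (h : ∀ i j, Differentiable ℂ fun μ => M μ i j) : Differentiable ℂ fun μ => mulVecOp (M μ) := by
  simp only [mulVecOp_eq_sum]
  refine Differentiable.fun_sum fun i _ => Differentiable.fun_sum fun j _ => ?_
  exact (h i j).smul_const _

variable {Q : ℝ → Matrix (Fin n) (Fin n) ℂ}

/-- The solution operator of the first order system with spectral parameter `μ`. -/
noncomputable def systemOp (hQ : ∀ j k, IntegrableOn (fun x => Q x j k) (Icc (0 : ℝ) 1))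
    (b : Fin n → ℂ) (μ : ℂ) : C(unitInterval, Fin n → ℂ) →L[ℂ] C(unitInterval, Fin n → ℂ) :=
  solutionOp (coeffMatrix b Q μ) (entryIntegrable_coeffMatrix hQ b μ)

/-- The derivative `i B` of the coefficient with respect to the spectral parameter. -/
noncomputable def leadingMatrix (b : Fin n → ℂ) (_ : ℝ) : Matrix (Fin n) (Fin n) ℂ :=
  Matrix.diagonal fun j => I * b j

theorem entryIntegrable_leadingMatrix (b : Fin n → ℂ) : EntryIntegrable (leadingMatrix b) :=
  fun _ _ => intervalIntegrable_const

/-- The Volterra operator is affine in `μ`; as `1` minus it is always invertible, the solution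
operator is entire. -/
theorem volterra_coeffMatrix (hQ : ∀ j k, IntegrableOn (fun x => Q x j k) (Icc (0 : ℝ) 1))
    (b : Fin n → ℂ) (μ : ℂ) :
    volterra (coeffMatrix b Q μ) (entryIntegrable_coeffMatrix hQ b μ) =
      μ • volterra (leadingMatrix b) (entryIntegrable_leadingMatrix b) +
      volterra (potential b Q) (entryIntegrable_potential hQ b) := by
  ext1 y
  ext1 x
  have hx : uIcc (0 : ℝ) x ⊆ uIcc 0 1 :=
    uIcc_subset_uIcc left_mem_uIcc (by rw [uIcc_of_le zero_le_one]; exact x.2)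
  have h1 := ((entryIntegrable_potential hQ b).mulVec
    (continuous_lineExt y).continuousOn).mono_set hx
  have h2 : IntervalIntegrable (fun t => μ • leadingMatrix b t *ᵥ lineExt y t)
      volume 0 x := by
    refine Continuous.intervalIntegrable ?_ _ _
    exact ((mulVecOp (Matrix.diagonal fun j => I * b j)).continuous.comp
      (continuous_lineExt y)).const_smul μ
  simp only [_root_.add_apply, _root_.smul_apply, ContinuousMap.add_apply, ContinuousMap.smul_apply,
    volterra_apply]
  rw [← intervalIntegral.integral_smul, ← intervalIntegral.integral_add h2 h1]
  congr 1
  funext t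
  rw [coeffMatrix, Matrix.add_mulVec]
  congr 1
  funext j
  simp only [leadingMatrix, Pi.smul_apply, Matrix.mulVec_diagonal, smul_eq_mul]
  ring

theorem differentiable_inverse_affine {A : Type*} [NormedRing A] [NormedAlgebra ℂ A]
    [CompleteSpace A] {V W : A} (h : ∀ μ : ℂ, IsUnit (1 - (μ • V + W))) :
    Differentiable ℂ fun μ : ℂ => Ring.inverse (1 - (μ • V + W)) := fun μ =>
  DifferentiableAt.comp (g := Ring.inverse) μ (differentiableAt_inverse (𝕜 := ℂ) (h μ))
    (show DifferentiableAt ℂ (fun μ : ℂ => 1 - (μ • V + W)) μ by fun_prop)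

theorem differentiable_systemOp (hQ : ∀ j k, IntegrableOn (fun x => Q x j k) (Icc (0 : ℝ) 1))
    (b : Fin n → ℂ) : Differentiable ℂ (systemOp hQ b) := by
  have h1 : systemOp hQ b = fun μ => Ring.inverse (1 - (μ • volterra
      (leadingMatrix b) (entryIntegrable_leadingMatrix b) +
      volterra (potential b Q) (entryIntegrable_potential hQ b))) := by
    funext μ
    rw [← volterra_coeffMatrix hQ, systemOp, solutionOp]
  rw [h1]
  refine differentiable_inverse_affine
    (A := C(unitInterval, Fin n → ℂ) →L[ℂ] C(unitInterval, Fin n → ℂ)) fun μ => ?_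
  rw [← volterra_coeffMatrix hQ b μ]
  exact isUnit_one_sub_volterra _ (entryIntegrable_coeffMatrix hQ b μ)

/-- Evaluation at `1`. -/
noncomputable def evalOne (n : ℕ) : C(unitInterval, Fin n → ℂ) →L[ℂ] (Fin n → ℂ) :=
  ContinuousMap.evalCLM ℂ 1

theorem systemOp_constOp_apply (hQ : ∀ j k, IntegrableOn (fun x => Q x j k) (Icc (0 : ℝ) 1))
    (b : Fin n → ℂ) (μ : ℂ) (v : Fin n → ℂ) (x : unitInterval) :
    systemOp hQ b μ (constOp v) x =
      (Matrix.of fun i j => systemOp hQ b μ (constOp (Pi.single j 1)) x i) *ᵥ v := by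
  set L : (Fin n → ℂ) →L[ℂ] (Fin n → ℂ) :=
    (ContinuousMap.evalCLM ℂ x).comp ((systemOp hQ b μ).comp constOp)
  change L v = _
  have hv : v = ∑ j, v j • Pi.single j (1 : ℂ) := by
    funext i; simp [Pi.single_apply]
  conv_lhs => rw [hv, map_sum]
  funext i
  simp only [Matrix.mulVec, dotProduct, Matrix.of_apply, Finset.sum_apply, map_smul,
    Pi.smul_apply, smul_eq_mul]
  refine Finset.sum_congr rfl fun j _ => ?_
  rw [mul_comm]
  rfl

/-- The boundary matrix `C + D Φ(1, μ)`. -/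
noncomputable def boundaryMatrix (hQ : ∀ j k, IntegrableOn (fun x => Q x j k) (Icc (0 : ℝ) 1))
    (b : Fin n → ℂ) (C D : Matrix (Fin n) (Fin n) ℂ) (μ : ℂ) : Matrix (Fin n) (Fin n) ℂ :=
  C + D * Matrix.of fun i j => systemOp hQ b μ (constOp (Pi.single j 1)) 1 i

theorem boundaryMatrix_mulVec (hQ : ∀ j k, IntegrableOn (fun x => Q x j k) (Icc (0 : ℝ) 1))
    (b : Fin n → ℂ) (C D : Matrix (Fin n) (Fin n) ℂ) (μ : ℂ) (v : Fin n → ℂ) :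
    boundaryMatrix hQ b C D μ *ᵥ v =
      C *ᵥ v + D *ᵥ systemOp hQ b μ (constOp v) 1 := by
  rw [boundaryMatrix, Matrix.add_mulVec, ← Matrix.mulVec_mulVec, ← systemOp_constOp_apply]

theorem differentiable_boundaryMatrix
    (hQ : ∀ j k, IntegrableOn (fun x => Q x j k) (Icc (0 : ℝ) 1))
    (b : Fin n → ℂ) (C D : Matrix (Fin n) (Fin n) ℂ) (i j : Fin n) :
    Differentiable ℂ fun μ => boundaryMatrix hQ b C D μ i j := by
  have h : ∀ i j, Differentiable ℂ fun μ => systemOp hQ b μ (constOp (Pi.single j 1)) 1 i := by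
    intro i j
    have h1 := (differentiable_systemOp hQ b).clm_apply
      (differentiable_const (constOp (Pi.single j (1 : ℂ))))
    exact ((ContinuousLinearMap.proj (R := ℂ) (φ := fun _ : Fin n => ℂ) i).comp
      (evalOne n)).differentiable.comp h1
  simp only [boundaryMatrix, Matrix.add_apply, Matrix.mul_apply, Matrix.of_apply]
  fun_prop

/-- The numerator of the resolvent. -/
noncomputable def resolventNum (hQ : ∀ j k, IntegrableOn (fun x => Q x j k) (Icc (0 : ℝ) 1))
    (b : Fin n → ℂ) (C D : Matrix (Fin n) (Fin n) ℂ) (μ : ℂ) : L2 n →L[ℂ] L2 n :=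
  (embedL2 n).comp ((systemOp hQ b μ).comp
    ((boundaryMatrix hQ b C D μ).det • sourceOp b -
      constOp.comp ((mulVecOp (boundaryMatrix hQ b C D μ).adjugate).comp ((mulVecOp D).comp
        ((evalOne n).comp ((systemOp hQ b μ).comp (sourceOp b)))))))

theorem differentiable_resolventNum
    (hQ : ∀ j k, IntegrableOn (fun x => Q x j k) (Icc (0 : ℝ) 1))
    (b : Fin n → ℂ) (C D : Matrix (Fin n) (Fin n) ℂ) :
    Differentiable ℂ (resolventNum hQ b C D) := by
  have h1 := differentiable_systemOp hQ b
  have h2 := differentiable_det (differentiable_boundaryMatrix hQ b C D)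
  have h3 := differentiable_mulVecOp
    (differentiable_adjugate (differentiable_boundaryMatrix hQ b C D))
  refine (differentiable_const _).clm_comp (h1.clm_comp ((h2.smul_const _).sub
    ((differentiable_const _).clm_comp (h3.clm_comp ((differentiable_const _).clm_comp
    ((differentiable_const _).clm_comp (h1.clm_comp (differentiable_const _))))))))

/-- Solutions of the inhomogeneous equation are parametrized by `v = y(0)`, and the boundary
condition becomes a linear system for `v` with matrix `C + D Φ(1, μ)`. -/
theorem mem_bvpGraph_iff {b : Fin n → ℂ} (hb : ∀ j, b j ≠ 0)
    (hQ : ∀ j k, IntegrableOn (fun x => Q x j k) (Icc (0 : ℝ) 1))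
    (C D : Matrix (Fin n) (Fin n) ℂ) (μ : ℂ) (f g : L2 n) :
    (f, g + μ • f) ∈ bvpGraph b Q C D ↔
      ∃ v : Fin n → ℂ, f = embedL2 n (systemOp hQ b μ (constOp v + sourceOp b g)) ∧
        boundaryMatrix hQ b C D μ *ᵥ v + D *ᵥ systemOp hQ b μ (sourceOp b g) 1 = 0 := by
  have hbc : ∀ v, C *ᵥ v + D *ᵥ systemOp hQ b μ (constOp v + sourceOp b g) 1 =
      boundaryMatrix hQ b C D μ *ᵥ v + D *ᵥ systemOp hQ b μ (sourceOp b g) 1 := by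
    intro v
    rw [boundaryMatrix_mulVec, map_add, ContinuousMap.add_apply, Matrix.mulVec_add, add_assoc]
  rw [mem_bvpGraph_iff_isSolution hb]
  constructor
  · rintro ⟨y, hy, hf, hbd⟩
    have h1 := hy.restrict_eq (entryIntegrable_coeffMatrix hQ b μ) (intervalIntegrable_source b g)
    refine ⟨y 0, embedL2_eq hf fun x => ?_, ?_⟩
    · rw [systemOp, sourceOp_apply, ← h1]; rfl
    · rw [← hbc, systemOp, sourceOp_apply, ← h1]
      exact hbd
  · rintro ⟨v, rfl, hv⟩
    refine ⟨_, isSolution_solutionOp (entryIntegrable_coeffMatrix hQ b μ)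
      (intervalIntegrable_source b g) v, coeFn_embedL2 _, ?_⟩
    rw [← hbc] at hv
    rw [lineExt_of_mem _ (left_mem_Icc.2 zero_le_one),
      lineExt_of_mem _ (right_mem_Icc.2 zero_le_one)]
    have h0 := solutionOp_apply_zero (entryIntegrable_coeffMatrix hQ b μ)
      (constOp v + primitive (source b g) (intervalIntegrable_source b g))
    have h1 : (⟨0, left_mem_Icc.2 zero_le_one⟩ : unitInterval) = 0 := rfl
    have h2 : (⟨1, right_mem_Icc.2 zero_le_one⟩ : unitInterval) = 1 := rfl
    have h3 : (constOp v + primitive (source b g) (intervalIntegrable_source b g)) 0 = v := by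
      simp [primitive_apply]
    rw [h1, h2, h0, h3]
    exact hv

/-- Cramer's rule for the initial value `v`. Using the adjugate instead of the inverse keeps the
numerator entire and the identities valid at the zeros of the determinant. -/
theorem isCharacteristicPair_bvp {b : Fin n → ℂ} (hb : ∀ j, b j ≠ 0)
    (hQ : ∀ j k, IntegrableOn (fun x => Q x j k) (Icc (0 : ℝ) 1))
    (C D : Matrix (Fin n) (Fin n) ℂ) :
    IsCharacteristicPair (bvpOperator b Q C D) (fun μ => (boundaryMatrix hQ b C D μ).det)
      (resolventNum hQ b C D) where
  differentiable_det := differentiable_det (differentiable_boundaryMatrix hQ b C D)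
  differentiable_num := differentiable_resolventNum hQ b C D
  mem_graph μ g := by
    rw [bvpOperator_graph, mem_bvpGraph_iff hb hQ]
    set U := boundaryMatrix hQ b C D μ with hU
    set w := D *ᵥ systemOp hQ b μ (sourceOp b g) 1 with hw
    refine ⟨-(U.adjugate *ᵥ w), ?_, ?_⟩
    · change embedL2 n (systemOp hQ b μ (U.det • sourceOp b g - constOp (U.adjugate *ᵥ w))) = _
      rw [map_smul, map_neg, neg_add_eq_sub]
    · rw [Matrix.mulVec_neg, Matrix.mulVec_mulVec, Matrix.mul_adjugate, map_smul, map_smul,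
        ContinuousMap.smul_apply, Matrix.mulVec_smul, Matrix.smul_mulVec, Matrix.one_mulVec,
        neg_add_cancel]
  num_apply μ y w h := by
    obtain ⟨g, rfl⟩ : ∃ g, w = g + μ • y := ⟨w - μ • y, by simp⟩
    rw [bvpOperator_graph, mem_bvpGraph_iff hb hQ] at h
    obtain ⟨v, rfl, hv⟩ := h
    rw [add_sub_cancel_right]
    set U := boundaryMatrix hQ b C D μ with hU
    change embedL2 n (systemOp hQ b μ (U.det • sourceOp b g - constOp (U.adjugate *ᵥ (D *ᵥ
      systemOp hQ b μ (sourceOp b g) 1)))) = _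
    rw [eq_neg_of_add_eq_zero_right hv, Matrix.mulVec_neg, Matrix.mulVec_mulVec,
      Matrix.adjugate_mul, Matrix.smul_mulVec, Matrix.one_mulVec, map_neg, map_smul constOp,
      sub_neg_eq_add]
    simp only [map_add, map_smul, smul_add]
    rw [add_comm]

theorem fg_kerPow_one_bvp {b : Fin n → ℂ} (hb : ∀ j, b j ≠ 0)
    (hQ : ∀ j k, IntegrableOn (fun x => Q x j k) (Icc (0 : ℝ) 1))
    (C D : Matrix (Fin n) (Fin n) ℂ) (μ : ℂ) : (kerPow (bvpOperator b Q C D) μ 1).FG := by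
  set L : (Fin n → ℂ) →ₗ[ℂ] L2 n :=
    ((embedL2 n).comp ((systemOp hQ b μ).comp constOp)).toLinearMap
  refine Submodule.FG.of_le (T := LinearMap.range L) ?_ fun y hy => ?_
  · rw [LinearMap.range_eq_map]
    exact Module.Finite.fg_top.map L
  · obtain ⟨v, hv, hgr⟩ := mem_kerPow_succ.1 hy
    rw [show v = 0 from hv, bvpOperator_graph, mem_bvpGraph_iff hb hQ] at hgr
    obtain ⟨v, hv, -⟩ := hgr
    rw [map_zero, add_zero] at hv
    exact ⟨v, hv.symm⟩

theorem isFundamentalMatrix_iff {b : Fin n → ℂ} (hb : ∀ j, b j ≠ 0) (μ : ℂ)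
    (Φ : ℝ → Matrix (Fin n) (Fin n) ℂ) :
    IsFundamentalMatrix b Q μ Φ ↔ Φ 0 = 1 ∧
      ∀ k, IsSolution (coeffMatrix b Q μ) 0 fun x j => Φ x j k := by
  refine and_congr_right fun _ => forall_congr' fun k => ?_
  have h := isSolution_iff_diffExpr hb Q μ 0 fun x j => Φ x j k
  simp only [Pi.zero_apply, mul_zero, zero_add] at h
  exact h.symm

theorem solution_homogeneous_eq {b : Fin n → ℂ}
    (hQ : ∀ j k, IntegrableOn (fun x => Q x j k) (Icc (0 : ℝ) 1)) {μ : ℂ} {y : ℝ → Fin n → ℂ}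
    (hy : IsSolution (coeffMatrix b Q μ) 0 y) (x : unitInterval) :
    y x = systemOp hQ b μ (constOp (y 0)) x := by
  have hh : IntervalIntegrable (0 : ℝ → Fin n → ℂ) volume 0 1 := intervalIntegrable_const
  have h1 := hy.restrict_eq (entryIntegrable_coeffMatrix hQ b μ) hh
  have h2 : primitive (0 : ℝ → Fin n → ℂ) hh = 0 := by
    ext1 x; simp [primitive_apply]
  rw [h2, add_zero] at h1
  rw [systemOp, ← h1]
  rfl

theorem isSolution_systemOp_const {b : Fin n → ℂ}
    (hQ : ∀ j k, IntegrableOn (fun x => Q x j k) (Icc (0 : ℝ) 1)) (μ : ℂ) (v : Fin n → ℂ) :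
    IsSolution (coeffMatrix b Q μ) 0 (lineExt (systemOp hQ b μ (constOp v))) := by
  have hh : IntervalIntegrable (0 : ℝ → Fin n → ℂ) volume 0 1 := intervalIntegrable_const
  have h1 := isSolution_solutionOp (entryIntegrable_coeffMatrix hQ b μ) hh v
  have h2 : primitive (0 : ℝ → Fin n → ℂ) hh = 0 := by
    ext1 x; simp [primitive_apply]
  rwa [h2, add_zero] at h1

theorem lineExt_systemOp_zero {b : Fin n → ℂ}
    (hQ : ∀ j k, IntegrableOn (fun x => Q x j k) (Icc (0 : ℝ) 1)) (μ : ℂ) (v : Fin n → ℂ) :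
    lineExt (systemOp hQ b μ (constOp v)) 0 = v := by
  have h := lineExt_coe (systemOp hQ b μ (constOp v)) 0
  rw [systemOp, solutionOp_apply_zero] at h
  exact h

/-- The fundamental matrix is a choice; existence makes it meaningful, and uniqueness on `[0,1]`
fixes its value at `1`. -/
theorem charDet_eq {b : Fin n → ℂ} (hb : ∀ j, b j ≠ 0)
    (hQ : ∀ j k, IntegrableOn (fun x => Q x j k) (Icc (0 : ℝ) 1))
    (C D : Matrix (Fin n) (Fin n) ℂ) (μ : ℂ) :
    charDet b Q C D μ = (boundaryMatrix hQ b C D μ).det := by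
  have hex : ∃ Φ, IsFundamentalMatrix b Q μ Φ := by
    refine ⟨fun x => Matrix.of fun i j =>
      lineExt (systemOp hQ b μ (constOp (Pi.single j 1))) x i, ?_⟩
    rw [isFundamentalMatrix_iff hb]
    refine ⟨?_, fun k => isSolution_systemOp_const hQ μ _⟩
    ext i j
    rw [Matrix.of_apply, lineExt_systemOp_zero, Matrix.one_apply, Pi.single_apply]
  have hΦ : IsFundamentalMatrix b Q μ (fundamentalMatrix b Q μ) := Classical.epsilon_spec hex
  rw [isFundamentalMatrix_iff hb] at hΦ
  rw [charDet, boundaryMatrix]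
  congr 3
  ext i j
  have h1 := solution_homogeneous_eq hQ (hΦ.2 j) 1
  have h2 : (fun i => fundamentalMatrix b Q μ 0 i j) = Pi.single j 1 := by
    rw [hΦ.1]
    funext i
    rw [Matrix.one_apply, Pi.single_apply]
  rw [h2] at h1
  exact congrFun h1 i

end CharacteristicPairOfSystem

/-! ### Density of the domain -/

section DenseDomain

/-- Lagrange's identity: the derivative of the pairing cancels. It yields a left inverse of the
fundamental matrix. -/
theorem dotProduct_adjoint_solution {J : Type*} [Fintype J] {A : ℝ → Matrix J J ℂ}
    {ψ y : ℝ → J → ℂ} (hψ : IsSolution (fun t => -(A t)ᵀ) 0 ψ) (hy : IsSolution A 0 y) {x : ℝ}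
    (hx : x ∈ Icc (0 : ℝ) 1) : ψ x ⬝ᵥ y x = ψ 0 ⬝ᵥ y 0 := by
  have hac : AbsolutelyContinuousOnInterval (fun t => ψ t ⬝ᵥ y t) 0 1 :=
    ac_finset_sum _ fun j _ => (ac_pi_apply hψ.1 j).fun_smul (ac_pi_apply hy.1 j)
  have h := ac_eq_add_integral (h := fun _ => (0 : ℂ)) hac intervalIntegrable_const ?_
    (x := x) (by rwa [uIcc_of_le zero_le_one])
  · simpa using h
  · rw [uIcc_of_le zero_le_one]
    filter_upwards [hψ.2, hy.2] with t h1 h2 ht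
    have h3 := fun j => ((hasDerivAt_pi.1 (h1 ht)) j).mul ((hasDerivAt_pi.1 (h2 ht)) j)
    have h4 := HasDerivAt.fun_sum (u := Finset.univ) fun j _ => h3 j
    refine h4.congr_deriv ?_
    simp only [Pi.zero_apply, add_zero, Finset.sum_add_distrib]
    change (-(A t)ᵀ *ᵥ ψ t) ⬝ᵥ y t + ψ t ⬝ᵥ (A t *ᵥ y t) = 0
    rw [Matrix.neg_mulVec, neg_dotProduct, Matrix.mulVec_transpose, Matrix.dotProduct_mulVec,
      neg_add_cancel]

variable {n : ℕ} {Q : ℝ → Matrix (Fin n) (Fin n) ℂ}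

/-- The values of a fundamental system of solutions separate points. -/
theorem eq_zero_of_dotProduct_solutions {b : Fin n → ℂ}
    (hQ : ∀ j k, IntegrableOn (fun x => Q x j k) (Icc (0 : ℝ) 1)) {μ : ℂ} {x : ℝ}
    (hx : x ∈ Icc (0 : ℝ) 1) {w : Fin n → ℂ}
    (hw : ∀ k, w ⬝ᵥ lineExt (systemOp hQ b μ (constOp (Pi.single k 1))) x = 0) : w = 0 := by
  have hA := entryIntegrable_coeffMatrix hQ b μ
  have hA' : EntryIntegrable fun t => -(coeffMatrix b Q μ t)ᵀ := fun i j => (hA j i).neg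
  have hh : IntervalIntegrable (0 : ℝ → Fin n → ℂ) volume 0 1 := intervalIntegrable_const
  let ψ : Fin n → ℝ → Fin n → ℂ := fun i =>
    lineExt (solutionOp _ hA' (constOp (Pi.single i 1) + primitive 0 hh))
  have hψ : ∀ i, IsSolution (fun t => -(coeffMatrix b Q μ t)ᵀ) 0 (ψ i) := fun i =>
    isSolution_solutionOp hA' hh _
  have hψ0 : ∀ i, ψ i 0 = Pi.single i 1 := fun i => by
    have h := lineExt_coe (solutionOp _ hA' (constOp (Pi.single i 1) + primitive 0 hh)) 0
    rw [solutionOp_apply_zero] at h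
    exact h.trans (by simp [primitive_apply])
  let Ψ : Matrix (Fin n) (Fin n) ℂ := Matrix.of fun i => ψ i x
  let Φ : Matrix (Fin n) (Fin n) ℂ := Matrix.of fun j k =>
    lineExt (systemOp hQ b μ (constOp (Pi.single k 1))) x j
  have h1 : Ψ * Φ = 1 := by
    ext i k
    have h2 := dotProduct_adjoint_solution (hψ i)
      (isSolution_systemOp_const (b := b) hQ μ (Pi.single k 1)) hx
    rw [hψ0, lineExt_systemOp_zero, single_dotProduct, one_mul, Pi.single_apply] at h2
    rw [Matrix.one_apply]
    exact h2
  have h2 : w ᵥ* Φ = 0 := funext hw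
  rw [← Matrix.vecMul_one w, ← mul_eq_one_comm.1 h1, ← Matrix.vecMul_vecMul, h2,
    Matrix.zero_vecMul]

/-- For integrable `Q` a smooth `y` need not have `Q y` in `L²`. A cutoff times a solution `Y` at
spectral parameter `0` does belong to the domain: `Q` cancels and the image is `-i B⁻¹ φ' Y`, which
is continuous. -/
theorem cutoff_mem_domain {b : Fin n → ℂ} (hb : ∀ j, b j ≠ 0)
    (hQ : ∀ j k, IntegrableOn (fun x => Q x j k) (Icc (0 : ℝ) 1))
    (C D : Matrix (Fin n) (Fin n) ℂ) (v : Fin n → ℂ) {φ : ℝ → ℝ} (hφ : ContDiff ℝ 1 φ)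
    (hφc : HasCompactSupport φ) (hφs : tsupport φ ⊆ Ioo 0 1) :
    ∃ f ∈ (bvpOperator b Q C D).domain, ∀ᵐ x ∂unitVol,
      f x = WithLp.toLp 2 (φ x • lineExt (systemOp hQ b 0 (constOp v)) x) := by
  set Y := systemOp hQ b 0 (constOp v) with hY
  have hYs : IsSolution (coeffMatrix b Q 0) 0 (lineExt Y) := isSolution_systemOp_const hQ 0 v
  let F : C(unitInterval, Fin n → ℂ) := ⟨fun x => φ x • Y x,
    (hφ.continuous.comp continuous_subtype_val).smul Y.continuous⟩
  let G : C(unitInterval, Fin n → ℂ) := ⟨fun x j => (I * b j)⁻¹ * (deriv φ x • Y x) j, by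
    have := (hφ.continuous_deriv le_rfl).comp (continuous_subtype_val (p := (· ∈ unitInterval)))
    have h2 := this.smul Y.continuous
    exact continuous_pi fun j => ((continuous_apply j).comp h2).const_mul _⟩
  have hF : ∀ᵐ x ∂unitVol, embedL2 n F x = WithLp.toLp 2 (φ x • lineExt Y x) := by
    filter_upwards [coeFn_embedL2 F, ae_restrict_mem measurableSet_Icc] with x h1 h2
    rw [h1, lineExt_of_mem _ h2, lineExt_of_mem _ h2]
    rfl
  refine ⟨embedL2 n F, ?_, hF⟩
  have hgr : (embedL2 n F, embedL2 n G + (0 : ℂ) • embedL2 n F) ∈ bvpGraph b Q C D := by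
    rw [mem_bvpGraph_iff_isSolution hb]
    refine ⟨fun x => φ x • lineExt Y x, ⟨?_, ?_⟩, hF, ?_⟩
    · obtain ⟨K, hK⟩ := hφ.lipschitzWith_of_hasCompactSupport hφc one_ne_zero
      exact (hK.lipschitzOnWith.absolutelyContinuousOnInterval).fun_smul hYs.1
    · have hG := ae_unitVol_iff.1 (coeFn_embedL2 G)
      filter_upwards [hG, hYs.2] with x h1 h2 hx
      have h3 := (hφ.differentiable one_ne_zero x).hasDerivAt.smul (h2 hx)
      refine h3.congr_deriv ?_
      funext j
      have hne : I * b j ≠ 0 := mul_ne_zero I_ne_zero (hb j)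
      simp only [Pi.add_apply, source, h1 hx, lineExt_of_mem G hx, Pi.zero_apply, add_zero,
        Matrix.mulVec_smul]
      change _ = _ + I * b j * ((I * b j)⁻¹ * (deriv φ x • Y ⟨x, hx⟩) j)
      rw [mul_inv_cancel_left₀ hne, lineExt_of_mem Y hx]
    · have h0 : φ 0 = 0 := image_eq_zero_of_notMem_tsupport fun h => by simpa using hφs h
      have h1 : φ 1 = 0 := image_eq_zero_of_notMem_tsupport fun h => by simpa using hφs h
      simp [h0, h1]
  rw [← bvpOperator_graph] at hgr
  exact LinearPMap.mem_domain_of_mem_graph hgr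

/-- Orthogonality of `h` to all cutoffs of a solution makes its pointwise inner product with that
solution vanish almost everywhere. A fundamental system spans at every point, so `h = 0`. -/
theorem dense_domain_bvp {b : Fin n → ℂ} (hb : ∀ j, b j ≠ 0)
    (hQ : ∀ j k, IntegrableOn (fun x => Q x j k) (Icc (0 : ℝ) 1))
    (C D : Matrix (Fin n) (Fin n) ℂ) :
    Dense ((bvpOperator b Q C D).domain : Set (L2 n)) := by
  rw [Submodule.dense_iff_topologicalClosure_eq_top, Submodule.topologicalClosure_eq_top_iff,
    Submodule.eq_bot_iff]
  intro h hh
  let y : Fin n → ℝ → Fin n → ℂ := fun k => lineExt (systemOp hQ b 0 (constOp (Pi.single k 1)))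
  let p : Fin n → ℝ → ℂ := fun k x => inner ℂ (h x) (WithLp.toLp 2 (y k x))
  have hpI : ∀ k, IntegrableOn (p k) (Icc 0 1) := by
    intro k
    have h1 : MemLp (fun x => (WithLp.toLp 2 (y k x) : EuclideanSpace ℂ (Fin n))) 2 unitVol :=
      memLp_toLp_lineExt _
    have h2 := L2.integrable_inner (𝕜 := ℂ) h (h1.toLp _)
    refine h2.congr ?_
    filter_upwards [h1.coeFn_toLp] with x hx
    rw [hx]
  have hp0 : ∀ k, ∀ᵐ x, x ∈ Ioo (0 : ℝ) 1 → p k x = 0 := by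
    intro k
    refine isOpen_Ioo.ae_eq_zero_of_integral_contDiff_smul_eq_zero
      ((hpI k).mono_set Ioo_subset_Icc_self).locallyIntegrableOn fun φ hφ hφc hφs => ?_
    obtain ⟨f, hf, hfx⟩ := cutoff_mem_domain hb hQ C D (Pi.single k 1)
      (hφ.of_le (by exact_mod_cast le_top)) hφc hφs
    have h1 := (Submodule.mem_orthogonal' _ _).1 hh f hf
    rw [L2.inner_def] at h1
    rw [← setIntegral_eq_integral_of_forall_compl_eq_zero (s := Icc (0 : ℝ) 1), ← h1]
    · refine integral_congr_ae ?_
      filter_upwards [hfx] with x hx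
      rw [hx, WithLp.toLp_smul, inner_smul_right_eq_smul]
    · intro x hx
      rw [image_eq_zero_of_notMem_tsupport fun h => hx (Ioo_subset_Icc_self (hφs h)), zero_smul]
  refine Lp.ext ?_
  have h3 : ∀ᵐ x ∂unitVol, ∀ k, p k x = 0 := by
    rw [ae_all_iff]
    intro k
    rw [ae_unitVol_iff]
    filter_upwards [hp0 k, ae_mem_Ioo_of_mem_Icc] with x h1 h2 hx
    exact h1 (h2 hx)
  filter_upwards [h3, ae_restrict_mem measurableSet_Icc,
    Lp.coeFn_zero (EuclideanSpace ℂ (Fin n)) 2 unitVol] with x h4 hx h5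
  rw [h5]
  have h6 : (fun j => (starRingEnd ℂ) (h x j)) = 0 := by
    refine eq_zero_of_dotProduct_solutions hQ (b := b) (μ := 0) hx fun k => ?_
    refine Eq.trans ?_ (h4 k)
    simp only [p, y, PiLp.inner_apply, RCLike.inner_apply, dotProduct]
    exact Finset.sum_congr rfl fun j _ => mul_comm _ _
  ext j
  have := congrFun h6 j
  simpa using this

end DenseDomain

/-! ### Upper bounds for the determinant and the resolvent numerator -/

section Growth

variable {n : ℕ} {Q : ℝ → Matrix (Fin n) (Fin n) ℂ}

/-- The solution of the system with source `i B g` that vanishes at `0`. -/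
noncomputable def forcedSolution (hQ : ∀ j k, IntegrableOn (fun x => Q x j k) (Icc (0 : ℝ) 1))
    (b : Fin n → ℂ) (μ : ℂ) (g : L2 n) (t : ℝ) : Fin n → ℂ :=
  lineExt (systemOp hQ b μ (sourceOp b g)) t

/-- The fundamental matrix bordered by the solution with source `i B g`. -/
noncomputable def extendedMatrix (hQ : ∀ j k, IntegrableOn (fun x => Q x j k) (Icc (0 : ℝ) 1))
    (b : Fin n → ℂ) (μ : ℂ) (g : L2 n) (t : ℝ) : Matrix (Fin n ⊕ Unit) (Fin n ⊕ Unit) ℂ :=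
  Matrix.fromBlocks
    (Matrix.of fun i j => lineExt (systemOp hQ b μ (constOp (Pi.single j 1))) t i)
    (Matrix.of fun i _ => forcedSolution hQ b μ g t i) 0 1

/-- The potential part of the coefficient of the extended system. -/
noncomputable def extendedPotential (b : Fin n → ℂ) (Q : ℝ → Matrix (Fin n) (Fin n) ℂ) (g : L2 n)
    (t : ℝ) : Matrix (Fin n ⊕ Unit) (Fin n ⊕ Unit) ℂ :=
  Matrix.fromBlocks (potential b Q t) (Matrix.of fun i _ => source b g t i) 0 0

theorem isSolution_forcedSolution (hQ : ∀ j k, IntegrableOn (fun x => Q x j k) (Icc (0 : ℝ) 1))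
    (b : Fin n → ℂ) (μ : ℂ) (g : L2 n) :
    IsSolution (coeffMatrix b Q μ) (source b g) (forcedSolution hQ b μ g) := by
  have h := isSolution_solutionOp (entryIntegrable_coeffMatrix hQ b μ)
    (intervalIntegrable_source b g) 0
  rwa [map_zero, zero_add] at h

theorem forcedSolution_zero (hQ : ∀ j k, IntegrableOn (fun x => Q x j k) (Icc (0 : ℝ) 1))
    (b : Fin n → ℂ) (μ : ℂ) (g : L2 n) : forcedSolution hQ b μ g 0 = 0 := by
  have h := lineExt_coe (systemOp hQ b μ (sourceOp b g)) 0
  rw [systemOp, solutionOp_apply_zero] at h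
  exact h.trans (by simp [sourceOp_apply, primitive_apply])

theorem extendedMatrix_zero (hQ : ∀ j k, IntegrableOn (fun x => Q x j k) (Icc (0 : ℝ) 1))
    (b : Fin n → ℂ) (μ : ℂ) (g : L2 n) : extendedMatrix hQ b μ g 0 = 1 := by
  rw [extendedMatrix, ← Matrix.fromBlocks_one]
  congr 1
  · ext i j
    rw [Matrix.of_apply, lineExt_systemOp_zero, Matrix.one_apply, Pi.single_apply]
  · ext i j
    rw [Matrix.of_apply, forcedSolution_zero]
    rfl

theorem entryIntegrable_extendedPotential
    (hQ : ∀ j k, IntegrableOn (fun x => Q x j k) (Icc (0 : ℝ) 1)) (b : Fin n → ℂ) (g : L2 n) :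
    EntryIntegrable (extendedPotential b Q g) := by
  have hs := intervalIntegrable_source b g
  rintro (i | i) (j | j)
  · exact entryIntegrable_potential hQ b i j
  · exact ⟨hs.1.eval i, hs.2.eval i⟩
  · exact intervalIntegrable_const
  · exact intervalIntegrable_const

/-- Bordering makes the inhomogeneous problem homogeneous of size `n + 1` with additional exponent
`0`; the source becomes part of the potential. -/
theorem isMatrixSolution_extendedMatrix
    (hQ : ∀ j k, IntegrableOn (fun x => Q x j k) (Icc (0 : ℝ) 1)) (b : Fin n → ℂ) (μ : ℂ)
    (g : L2 n) :
    IsMatrixSolution (fun t => Matrix.diagonal (Sum.elim (fun j => I * b j * μ) fun _ => 0) +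
      extendedPotential b Q g t) (extendedMatrix hQ b μ g) := by
  have hΦ := fun k => isSolution_systemOp_const (b := b) hQ μ (Pi.single k 1)
  have hy := isSolution_forcedSolution hQ b μ g
  have hcoef : ∀ t, Matrix.diagonal (Sum.elim (fun j => I * b j * μ) fun _ : Unit => (0 : ℂ)) +
      extendedPotential b Q g t = Matrix.fromBlocks (coeffMatrix b Q μ t)
        (Matrix.of fun i _ => source b g t i) 0 0 := by
    intro t
    rw [extendedPotential, ← Matrix.fromBlocks_diagonal, Matrix.fromBlocks_add, coeffMatrix]
    simp
  refine ⟨?_, ?_⟩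
  · rintro (i | i) (j | j)
    · exact ac_pi_apply (hΦ j).1 i
    · exact ac_pi_apply hy.1 i
    · exact ac_const _ _ _
    · exact ac_const _ _ _
  · filter_upwards [Filter.eventually_all.2 fun k => (hΦ k).2, hy.2] with t h1 h2 ht
    rw [hcoef, extendedMatrix, Matrix.fromBlocks_multiply]
    rintro (i | i)
    · refine hasDerivAt_pi.2 ?_
      rintro (j | j)
      · refine (hasDerivAt_pi.1 (h1 j ht) i).congr_deriv ?_
        simp [Matrix.mul_apply, Matrix.mulVec, dotProduct]
      · refine (hasDerivAt_pi.1 (h2 ht) i).congr_deriv ?_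
        simp [Matrix.mul_apply, Matrix.mulVec, dotProduct]
    · refine hasDerivAt_pi.2 ?_
      rintro (j | j)
      · refine (hasDerivAt_const t (0 : ℂ)).congr_deriv ?_
        simp
      · refine (hasDerivAt_const t ((1 : Matrix Unit Unit ℂ) i j)).congr_deriv ?_
        simp

theorem integral_entrySum_extendedPotential_le
    (hQ : ∀ j k, IntegrableOn (fun x => Q x j k) (Icc (0 : ℝ) 1)) (b : Fin n → ℂ) {g : L2 n}
    (hg : ‖g‖ ≤ 1) :
    ∫ t in (0 : ℝ)..1, entrySum (extendedPotential b Q g t) ≤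
      (∫ t in (0 : ℝ)..1, entrySum (potential b Q t)) + n * ‖b‖ := by
  have hI : IntegrableOn (fun t => n * ‖b‖ * ‖g t‖) (Icc 0 1) :=
    (integrable_of_L2 g).norm.const_mul _
  have hI' : IntervalIntegrable (fun t => n * ‖b‖ * ‖g t‖) volume 0 1 :=
    (intervalIntegrable_iff_integrableOn_Ioc_of_le zero_le_one).2
      (hI.mono_set Ioc_subset_Icc_self)
  have hP := (entryIntegrable_potential hQ b).entrySum
  calc ∫ t in (0 : ℝ)..1, entrySum (extendedPotential b Q g t)
      ≤ ∫ t in (0 : ℝ)..1, (entrySum (potential b Q t) + n * ‖b‖ * ‖g t‖) := by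
        refine intervalIntegral.integral_mono_on zero_le_one
          (entryIntegrable_extendedPotential hQ b g).entrySum (hP.add hI') fun t _ => ?_
        have h1 : ∑ i, ‖source b g t i‖ ≤ n * ‖b‖ * ‖g t‖ := by
          calc ∑ i, ‖source b g t i‖ ≤ ∑ _i : Fin n, ‖b‖ * ‖g t‖ :=
                Finset.sum_le_sum fun i _ => (norm_le_pi_norm _ i).trans (norm_source_le b g t)
            _ = _ := by simp [mul_assoc]
        simp only [entrySum, extendedPotential, Fintype.sum_sum_type, Matrix.fromBlocks_apply₁₁,
          Matrix.fromBlocks_apply₁₂, Matrix.fromBlocks_apply₂₁, Matrix.fromBlocks_apply₂₂,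
          Matrix.of_apply, Finset.sum_add_distrib, Matrix.zero_apply, norm_zero,
          Finset.sum_const_zero, add_zero, Finset.univ_unique, Finset.sum_singleton]
        linarith
    _ = (∫ t in (0 : ℝ)..1, entrySum (potential b Q t)) + n * ‖b‖ * ∫ t, ‖g t‖ ∂unitVol := by
        rw [intervalIntegral.integral_add hP hI', intervalIntegral.integral_const_mul,
          intervalIntegral.integral_of_le (f := fun t => ‖g t‖) zero_le_one,
          ← integral_Icc_eq_integral_Ioc]
    _ ≤ (∫ t in (0 : ℝ)..1, entrySum (potential b Q t)) + n * ‖b‖ * 1 := by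
        gcongr
        exact (integral_norm_le_norm g).trans hg
    _ = _ := by rw [mul_one]

/-- The exponential type in direction `μ`: the sum of the positive parts of `Re (i b_j μ)`. -/
noncomputable def growthExponent (b : Fin n → ℂ) (μ : ℂ) : ℝ := ∑ j, max (I * b j * μ).re 0

/-- The additional exponent `0` of the bordered system does not raise the maximal partial sum. -/
theorem re_sum_le_growthExponent (b : Fin n → ℂ) (μ : ℂ) (T : Finset (Fin n ⊕ Unit)) :
    (∑ j ∈ T, Sum.elim (fun j => I * b j * μ) (fun _ => 0) j).re ≤ growthExponent b μ := by
  rw [Complex.re_sum]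
  calc ∑ j ∈ T, (Sum.elim (fun j => I * b j * μ) (fun _ => 0) j).re
      ≤ ∑ j ∈ T, max (Sum.elim (fun j => I * b j * μ) (fun _ => 0) j).re 0 :=
        Finset.sum_le_sum fun j _ => le_max_left _ _
    _ ≤ ∑ j, max (Sum.elim (fun j => I * b j * μ) (fun _ : Unit => (0 : ℂ)) j).re 0 :=
        Finset.sum_le_sum_of_subset_of_nonneg (Finset.subset_univ _)
          fun _ _ _ => le_max_right _ _
    _ = _ := by simp [growthExponent, Fintype.sum_sum_type]

theorem growthExponent_le (b : Fin n → ℂ) (μ : ℂ) :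
    growthExponent b μ ≤ (∑ j, ‖b j‖) * ‖μ‖ := by
  rw [growthExponent, Finset.sum_mul]
  refine Finset.sum_le_sum fun j _ => max_le ?_ (by positivity)
  calc (I * b j * μ).re ≤ ‖I * b j * μ‖ := re_le_norm _
    _ = ‖b j‖ * ‖μ‖ := by rw [norm_mul, norm_mul, norm_I, one_mul]

/-- The coefficients of the rows of the bordered boundary matrix with respect to the rows of the
extended matrix at the times `0`, `x` and `1`. -/
noncomputable def borderCoef (C D : Matrix (Fin n) (Fin n) ℂ) (l : Fin 3 × (Fin n ⊕ Unit)) :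
    Fin n ⊕ Unit → Fin 3 × (Fin n ⊕ Unit) → ℂ :=
  Sum.elim (fun r s => Sum.elim (fun k => (![C r k, 0, D r k] : Fin 3 → ℂ) s.1) (fun _ => 0) s.2)
    fun _ s => if s = l then 1 else 0

/-- Since the extended matrix is `1` at time `0`, the rows of `C` are combinations of its rows at
time `0`, and those of `D Φ(1)` of its rows at time `1`. The last row is the single row selected by
`l`. -/
theorem sum_borderCoef_smul (hQ : ∀ j k, IntegrableOn (fun x => Q x j k) (Icc (0 : ℝ) 1))
    (b : Fin n → ℂ) (C D : Matrix (Fin n) (Fin n) ℂ) (μ : ℂ) (g : L2 n) (x : ℝ)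
    (l : Fin 3 × (Fin n ⊕ Unit)) :
    (fun j => ∑ s, borderCoef C D l j s •
      extendedMatrix hQ b μ g ((![0, x, 1] : Fin 3 → ℝ) s.1) s.2) =
    Matrix.fromBlocks (boundaryMatrix hQ b C D μ)
      (Matrix.of fun i _ => (D *ᵥ forcedSolution hQ b μ g 1) i)
      (Matrix.of fun _ j => extendedMatrix hQ b μ g ((![0, x, 1] : Fin 3 → ℝ) l.1) l.2 (Sum.inl j))
      (Matrix.of fun _ j =>
        extendedMatrix hQ b μ g ((![0, x, 1] : Fin 3 → ℝ) l.1) l.2 (Sum.inr j)) := by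
  funext j
  rcases j with i | i
  · simp only [borderCoef, Sum.elim_inl, Fintype.sum_prod_type, Fin.sum_univ_three,
      Fintype.sum_sum_type, Matrix.cons_val_zero, Matrix.cons_val_one, Matrix.cons_val, zero_smul,
      Sum.elim_inr, Finset.sum_const_zero, add_zero, extendedMatrix_zero]
    have h1 : ∀ Y : C(unitInterval, Fin n → ℂ), lineExt Y 1 = Y 1 := fun Y => lineExt_coe Y 1
    funext k
    rcases k with k | k
    · simp [extendedMatrix, boundaryMatrix, Matrix.mul_apply, Matrix.one_apply, h1]
    · simp [extendedMatrix, Matrix.mulVec, dotProduct]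
  · simp only [borderCoef, Sum.elim_inr, ite_smul, one_smul, zero_smul, Finset.sum_ite_eq',
      Finset.mem_univ, if_true]
    funext k
    rcases k with k | k <;> rfl

theorem exists_norm_bordered_det_le (hQ : ∀ j k, IntegrableOn (fun x => Q x j k) (Icc (0 : ℝ) 1))
    (b : Fin n → ℂ) (C D : Matrix (Fin n) (Fin n) ℂ) :
    ∃ K : ℝ, 0 ≤ K ∧ ∀ (μ : ℂ) (g : L2 n) (x : ℝ) (l : Fin 3 × (Fin n ⊕ Unit)), ‖g‖ ≤ 1 →
      x ∈ Icc (0 : ℝ) 1 →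
      ‖(Matrix.fromBlocks (boundaryMatrix hQ b C D μ)
        (Matrix.of fun i _ => (D *ᵥ forcedSolution hQ b μ g 1) i)
        (Matrix.of fun _ j =>
          extendedMatrix hQ b μ g ((![0, x, 1] : Fin 3 → ℝ) l.1) l.2 (Sum.inl j))
        (Matrix.of fun _ j =>
          extendedMatrix hQ b μ g ((![0, x, 1] : Fin 3 → ℝ) l.1) l.2 (Sum.inr j))).det‖ ≤
        K * Real.exp (growthExponent b μ) := by
  obtain ⟨K, hK0, hK⟩ := exists_norm_det_rows_le (Fin n ⊕ Unit)
    ((∫ t in (0 : ℝ)..1, entrySum (potential b Q t)) + n * ‖b‖)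
  refine ⟨(∑ l, ∑ r : Fin n ⊕ Unit → Fin 3 × (Fin n ⊕ Unit),
    ∏ j, ‖borderCoef C D l j (r j)‖) * K, by positivity,
    fun μ g x l hg hx => ?_⟩
  rw [← sum_borderCoef_smul]
  refine (norm_det_sum_smul_le (K := K * Real.exp (growthExponent b μ)) (borderCoef C D l)
    (fun s => extendedMatrix hQ b μ g ((![0, x, 1] : Fin 3 → ℝ) s.1) s.2) fun r => ?_).trans ?_
  · exact hK _ _ _ _ x (entryIntegrable_extendedPotential hQ b g)
      (isMatrixSolution_extendedMatrix hQ b μ g) (extendedMatrix_zero hQ b μ g)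
      (integral_entrySum_extendedPotential_le hQ b hg) (re_sum_le_growthExponent b μ) hx
      (fun j => (r j).2) fun j => (r j).1
  · rw [mul_assoc]
    gcongr
    exact Finset.single_le_sum (f := fun l => ∑ r : Fin n ⊕ Unit → Fin 3 × (Fin n ⊕ Unit),
      ∏ j, ‖borderCoef C D l j (r j)‖) (fun _ _ => by positivity) (Finset.mem_univ l)

/-- With `U` the boundary matrix and `y` the forced solution, the bordered determinant is by the
Schur complement `det U (y(x)_i - Φ(x)_i U⁻¹ D y(1))`, the `i`-th component at `x` of the resolvent
numerator. The large terms cancel inside the determinant, where estimating `y` and `Φ` separately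
would lose an exponential. -/
theorem exists_norm_det_boundaryMatrix_le
    (hQ : ∀ j k, IntegrableOn (fun x => Q x j k) (Icc (0 : ℝ) 1))
    (b : Fin n → ℂ) (C D : Matrix (Fin n) (Fin n) ℂ) :
    ∃ K : ℝ, 0 ≤ K ∧ ∀ μ, ‖(boundaryMatrix hQ b C D μ).det‖ ≤
        K * Real.exp (growthExponent b μ) ∧
      ((boundaryMatrix hQ b C D μ).det ≠ 0 →
        ‖resolventNum hQ b C D μ‖ ≤ K * Real.exp (growthExponent b μ)) := by
  obtain ⟨K, hK0, hK⟩ := exists_norm_bordered_det_le hQ b C D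
  refine ⟨max K (‖embedL2 n‖ * K), hK0.trans (le_max_left _ _), fun μ => ⟨?_, fun hdet => ?_⟩⟩
  · have h := hK μ 0 0 (0, Sum.inr ()) (by simp) (by simp)
    have h1 : (Matrix.of fun (_ : Unit) (j : Fin n) => extendedMatrix hQ b μ 0
        ((![0, 0, 1] : Fin 3 → ℝ) ((0 : Fin 3), (Sum.inr () : Fin n ⊕ Unit)).1)
        ((0 : Fin 3), (Sum.inr () : Fin n ⊕ Unit)).2 (Sum.inl j)) = 0 := rfl
    have h2 : (Matrix.of fun (_ : Unit) (j : Unit) => extendedMatrix hQ b μ 0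
        ((![0, 0, 1] : Fin 3 → ℝ) ((0 : Fin 3), (Sum.inr () : Fin n ⊕ Unit)).1)
        ((0 : Fin 3), (Sum.inr () : Fin n ⊕ Unit)).2 (Sum.inr j)) = 1 := rfl
    rw [h1, h2, Matrix.det_fromBlocks_zero₂₁, Matrix.det_one, mul_one] at h
    refine h.trans ?_
    gcongr
    exact le_max_left _ _
  · refine ContinuousLinearMap.opNorm_le_of_unit_norm (by positivity) fun g hg => ?_
    set U := boundaryMatrix hQ b C D μ with hU
    have hbound : ‖systemOp hQ b μ (U.det • sourceOp b g - constOp (U.adjugate *ᵥ (D *ᵥ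
        systemOp hQ b μ (sourceOp b g) 1)))‖ ≤ K * Real.exp (growthExponent b μ) := by
      refine (ContinuousMap.norm_le _ (by positivity)).2 fun x => ?_
      refine (pi_norm_le_iff_of_nonneg (by positivity)).2 fun i => ?_
      refine le_of_eq_of_le ?_ (hK μ g x (1, Sum.inl i) hg.le x.2)
      congr 1
      let _ := Matrix.invertibleOfIsUnitDet U (isUnit_iff_ne_zero.2 hdet)
      rw [Matrix.det_fromBlocks₁₁, Matrix.det_unique (n := Unit)]
      have hadj : U.adjugate = U.det • ⅟U := by
        rw [← Matrix.mul_one U.adjugate, ← mul_invOf_self U, ← Matrix.mul_assoc,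
          Matrix.adjugate_mul, Matrix.smul_mul, Matrix.one_mul]
      rw [hadj, map_sub, map_smul, ContinuousMap.sub_apply, ContinuousMap.smul_apply,
        systemOp_constOp_apply, Matrix.smul_mulVec, Matrix.mulVec_smul, ← smul_sub,
        Pi.smul_apply, smul_eq_mul]
      have h1 : forcedSolution hQ b μ g 1 = systemOp hQ b μ (sourceOp b g) 1 := lineExt_coe _ 1
      rw [h1, Matrix.sub_apply, Matrix.mul_assoc, Matrix.mul_apply, Pi.sub_apply]
      congr 2
      · exact congrFun (lineExt_coe _ x).symm i
      · change (∑ j, systemOp hQ b μ (constOp (Pi.single j 1)) x i * (⅟U *ᵥ _) j) = _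
        refine Finset.sum_congr rfl fun j _ => ?_
        congr 1
        exact congrFun (lineExt_coe _ x).symm i
    calc ‖resolventNum hQ b C D μ g‖ ≤ ‖embedL2 n‖ * (K * Real.exp (growthExponent b μ)) :=
          ((embedL2 n).le_opNorm _).trans (by gcongr; exact hbound)
      _ = ‖embedL2 n‖ * K * Real.exp (growthExponent b μ) := by ring
      _ ≤ _ := by gcongr; exact le_max_right _ _

end Growth

/-- The positive parts select exactly the `b_j` in `tau b z`, so along the ray the upper bound for
the numerator carries the same exponential as the assumed lower bound for the determinant. -/
theorem growthExponent_real_mul {n : ℕ} (b : Fin n → ℂ) (z : ℂ) {r : ℝ} (hr : 0 < r) :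
    growthExponent b (r * z) = (I * tau b z * (r * z)).re := by
  have h1 : ∀ j, (I * b j * (r * z)).re = r * (I * b j * z).re := fun j => by
    rw [show I * b j * (r * z) = (r : ℂ) * (I * b j * z) by ring, re_ofReal_mul]
  rw [tau, Finset.mul_sum, Finset.sum_mul, Complex.re_sum, growthExponent, Finset.sum_filter]
  refine Finset.sum_congr rfl fun j _ => ?_
  rw [h1]
  split_ifs with h
  · exact max_eq_left (mul_pos hr h).le
  · exact max_eq_right (mul_nonpos_of_nonneg_of_nonpos hr.le (not_lt.1 h))

end FirstOrderBVP

/-! ### Conclusion -/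

open FirstOrderBVP in
theorem mainTheorem4 {n : ℕ} (b : Fin n → ℂ) (hb : ∀ j, b j ≠ 0)
    (Q : ℝ → Matrix (Fin n) (Fin n) ℂ)
    (hQ : ∀ j k, IntegrableOn (fun x => Q x j k) (Icc (0 : ℝ) 1))
    (C D : Matrix (Fin n) (Fin n) ℂ) (hCD : (Matrix.fromCols C D).rank = n)
    (z : Fin 3 → ℂ) (hz : ∀ k, Feasible b (z k))
    (htri : (0 : ℂ) ∈ interior (convexHull ℝ (range z)))
    (c R : ℝ) (hc : 0 < c) (hR : 0 < R) (s : ℕ)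
    (hΔ : ∀ k, ∀ μ : ℂ, R < ‖μ‖ → arg μ = arg (z k) →
      c * Real.exp (I * tau b (z k) * μ).re / ‖μ‖ ^ s ≤ ‖charDet b Q C D μ‖)
    (ι : ℂ → Type*)
    (e : ∀ μ : ℂ, Module.Basis (ι μ) ℂ (rootSubspace (bvpOperator b Q C D) μ)) :
    IsCompleteFamily (fun p : Σ μ : ℂ, ι μ => (e p.1 p.2 : L2 n)) ∧
      IsMinimalFamily (fun p : Σ μ : ℂ, ι μ => (e p.1 p.2 : L2 n)) := by
  have hpair := isCharacteristicPair_bvp hb hQ C D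
  obtain ⟨K, hK0, hK⟩ := exists_norm_det_boundaryMatrix_le hQ b C D
  have hlow : ∀ k, ∀ r : ℝ, 0 ≤ r → R < ‖(r : ℂ) * z k‖ →
      0 < ‖(r : ℂ) * z k‖ ∧ c * Real.exp (growthExponent b (r * z k)) / ‖(r : ℂ) * z k‖ ^ s ≤
        ‖(boundaryMatrix hQ b C D (r * z k)).det‖ := by
    intro k r hr hlt
    have hpos : 0 < ‖(r : ℂ) * z k‖ := hR.trans hlt
    have hr0 : 0 < r := hr.lt_of_ne fun h => by simp [← h] at hpos
    have h := hΔ k (r * z k) hlt (arg_real_mul _ hr0)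
    rw [charDet_eq hb hQ, ← growthExponent_real_mul b (z k) hr0] at h
    exact ⟨hpos, h⟩
  have hray : ∀ k, ∀ r : ℝ, 0 ≤ r → R < ‖(r : ℂ) * z k‖ →
      (boundaryMatrix hQ b C D (r * z k)).det ≠ 0 ∧ ‖resolventNum hQ b C D (r * z k)‖ ≤
        K / c * ‖(r : ℂ) * z k‖ ^ s * ‖(boundaryMatrix hQ b C D (r * z k)).det‖ := by
    intro k r hr hlt
    obtain ⟨hpos, h⟩ := hlow k r hr hlt
    have hne : (boundaryMatrix hQ b C D (r * z k)).det ≠ 0 :=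
      norm_pos_iff.1 (lt_of_lt_of_le (by positivity) h)
    refine ⟨hne, ((hK _).2 hne).trans ?_⟩
    rw [div_le_iff₀ (by positivity)] at h
    calc K * Real.exp (growthExponent b (r * z k))
        = K / c * (c * Real.exp (growthExponent b (r * z k))) := by field_simp
      _ ≤ K / c * (‖(boundaryMatrix hQ b C D (r * z k)).det‖ * ‖(r : ℂ) * z k‖ ^ s) := by gcongr
      _ = _ := by ring
  -- For `n = 0` the empty determinant is `1`; otherwise feasibility gives `z 0 ≠ 0`, and the point
  -- of modulus `R + 1` on its ray serves.
  obtain ⟨ν, hν⟩ : ∃ ν, (boundaryMatrix hQ b C D ν).det ≠ 0 := by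
    rcases n with _ | n
    · exact ⟨0, by simp⟩
    · have hz0 : 0 < ‖z 0‖ := norm_pos_iff.2 fun h => (hz 0).1 0 (by simp [h])
      refine ⟨_, (hray 0 ((R + 1) / ‖z 0‖) (by positivity) ?_).1⟩
      rw [norm_mul, norm_real, Real.norm_of_nonneg (by positivity), div_mul_cancel₀ _ hz0.ne']
      linarith
  -- The factor `K` is absorbed into the exponent through `K ≤ exp K`.
  have hexp : ∀ μ, K * Real.exp (growthExponent b μ) ≤ Real.exp ((∑ j, ‖b j‖) * ‖μ‖ + K) := by
    intro μ
    rw [add_comm, Real.exp_add]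
    gcongr
    · linarith [Real.add_one_le_exp K]
    · exact growthExponent_le b μ
  refine ⟨isCompleteFamily_of_closure_eq_top ?_ e,
    hpair.isMinimalFamily hν (fg_kerPow_one_bvp hb hQ C D) e⟩
  exact hpair.closure_iSup_rootSubspace hν (dense_domain_bvp hb hQ C D)
    (A := ∑ j, ‖b j‖) (B := K) (by positivity) hK0 (fun μ => (hK μ).1.trans (hexp μ))
    (fun μ hμ => ((hK μ).2 hμ).trans (hexp μ)) htri (C := K / c) (R := R) (s := s)
    (by positivity) hray
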